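/- Let $K$ be an algebraically closed field of characteristic $0$, let $1\le m<n$ be coprime integers, and let $$n=m_1\ell_1+m_2,\quad m_1=m_2\ell_2+m_3,\quad\dots,\quad m_{e-1}=m_e\ell_e\qquad(m_1=m,\ m_e=1)$$ be the Euclidean algorithm for $(n,m)$, with $e$ lines. Let $\mathbb P^8$ be the projective space of nonzero $3\times 3$ matrices $\varphi$ over $K$ up to scalars, on which $\mathrm{PGL}(3)$ acts by right multiplication. Let $C$ be the plane curve $x^n=y^mz^{n-m}$, with points of the plane written as columns $(z:x:y)$. Let $B\subset\mathbb P^8$ be the set of matrices whose second and third rows vanish (rank-one matrices with image the cusp $(1:0:0)$), and let $P$ be the set of matrices whose third row vanishes (image contained in the tangent cone $y=0$). For nonsingular $B\subset P\subset V$, the $\ell$-directed blow-up of $V$ along $B$ in the direction of $P$ is obtained by $\ell$ successive blow-ups: first along $B$, then each time along the intersection of the last exceptional divisor with the proper transform of $P$. Its exceptional divisor is the last exceptional divisor produced; its distinguished subvariety is the intersection of this divisor with the proper transform of $P$. Let $V_1\to\mathbb P^8$ be the $\ell_1$-directed blow-up along $B$ in the direction of $P$, with exceptional divisor $E_1$ and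 distinguished subvariety $B_1$; for $1<i\le e$ let $V_i\to V_{i-1}$ be the $\ell_i$-directed blow-up along $B_{i-1}$ in the direction of $E_{i-1}$, with exceptional divisor $E_i$ and distinguished subvariety $B_i$. Put $E_0=P$, $\widetilde V=V_e$ and $\pi:\widetilde V\to\mathbb P^8$. Then the action of each $g\in\mathrm{PGL}(3)$ lifts uniquely to $\widetilde V$, and there is an open immersion $\mathbb A^8\hookrightarrow\widetilde V$ (a chart $U$ with coordinates $s_1,\dots,s_8$) with the following properties. 1. (Coordinate description.) If $e>1$ is odd, then for some integers $A,B\ge 0$ with $Bm-An=1$ the restriction of $\pi$ to $U$ is $$(s_1,\dots,s_8)\mapsto\begin{pmatrix}1&s_1&s_2\\ s_3^ms_6^A&s_3^ms_6^As_4&s_3^ms_6^As_5\\ s_3^ns_6^B&s_3^ns_6^Bs_7&s_3^ns_6^Bs_8\end{pmatrix}.$$ If $e$ is even, then for some integers $A,B\ge 0$ with $An-Bm=1$ it is $$(s_1,\dots,s_8)\mapsto\begin{pmatrix}1&s_1&s_2\\ s_3^As_6^m&s_3^As_6^ms_4&s_3^As_6^ms_5\\ s_3^Bs_6^n&s_3^Bs_6^ns_7&s_3^Bs_6^ns_8\end{pmatrix}.$$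 If $e=1$ (that is, $m=1$) it is $$(s_1,\dots,s_8)\mapsto\begin{pmatrix}1&s_1&s_2\\ s_3&s_3s_4&s_3s_5\\ s_3^ns_6&s_3^ns_7&s_3^ns_8\end{pmatrix}.$$ 2. ($U$ is essential.) A point of $\widetilde V$ can be moved into $U$ by the action of $\mathrm{PGL}(3)$ if and only if it lies neither on the proper transform of the locus of matrices with vanishing first row, nor on that of the locus of matrices with vanishing second row, nor on the proper transform of any of $E_0,\dots,E_{e-2}$ or of an exceptional divisor of one of the individual blow-ups other than $E_1,\dots,E_e$. In particular, every point of $\widetilde V$ at which the point-conditions meet and whose image in $\mathbb P^8$ has nonzero first row can be moved into $U$. Here the point-conditions are the proper transforms in $\widetilde V$ of all hypersurfaces $\{\varphi : \varphi(\xi)\text{ satisfies the equation of }C\}$, $\xi\in\mathbb P^2$; they meet exactly along the support of the base locus of the lifted rational map $\varphi\mapsto\{p: \varphi(p)\in C\}$ from $\widetilde V$ to the space of plane curves of degree $n$. -/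

import Mathlib

open CategoryTheory AlgebraicGeometry TopologicalSpace MvPolynomial

universe u

attribute [local instance] MvPolynomial.gradedAlgebra

noncomputable section

/-! ## Blow-ups of schemes along closed subsets -/

/-- An ideal sheaf is invertible if it is locally generated by one nonzerodivisor, that is, if it
is the ideal sheaf of an effective Cartier divisor. -/
def IsInvertibleIdealSheaf {X : Scheme.{u}} (J : X.IdealSheafData) : Prop :=
  ∀ x : X, ∃ U : X.affineOpens, x ∈ U.1 ∧
    ∃ a ∈ nonZeroDivisors Γ(X, U.1), J.ideal U = Ideal.span {a}

/-- `π : X' ⟶ X` is the blow-up of `X` along the closed subset `Z` (with its reduced structure):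
the inverse image ideal sheaf of the ideal of `Z` is invertible on `X'`, and `π` is universal
with this property. This determines `π` up to a unique isomorphism. -/
structure IsBlowup {X' X : Scheme.{u}} (π : X' ⟶ X) (Z : Closeds X) : Prop where
  invertible :
    IsInvertibleIdealSheaf ((Scheme.IdealSheafData.vanishingIdeal Z).comap π)
  existsUnique_lift : ∀ (T : Scheme.{u}) (f : T ⟶ X),
    IsInvertibleIdealSheaf ((Scheme.IdealSheafData.vanishingIdeal Z).comap f) →
      ∃! f' : T ⟶ X', f' ≫ π = f

/-- The closed set `π ⁻¹(Z)`. -/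
def preimageClosed {X' X : Scheme.{u}} (π : X' ⟶ X) (Z : Closeds X) : Closeds X' :=
  Z.preimage π.continuous

/-- The proper transform of `W` under `π`, where `π` is an isomorphism over the complement
of `Z`: the closure of `π ⁻¹(W \ Z)`. -/
def properTransform {X' X : Scheme.{u}} (π : X' ⟶ X) (Z W : Closeds X) : Closeds X' :=
  Closeds.closure (π ⁻¹' ((W : Set X) \ Z))

/-! ## The projective space of 3 × 3 matrices -/

section P8

variable (K : Type u) [Field K]

/-- Homogeneous coordinate ring of the space of matrices; `X (i, j)` is the entry in row `i` and
column `j`. -/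
abbrev MatrixCoordRing : Type u := MvPolynomial (Fin 3 × Fin 3) K

abbrev matrixGrading : ℕ → Submodule K (MatrixCoordRing K) :=
  homogeneousSubmodule (Fin 3 × Fin 3) K

/-- The projective space `ℙ⁸` of nonzero `3 × 3` matrices up to scalars. -/
abbrev P8 : Scheme.{u} := Proj (matrixGrading K)

/-- The closed subset of `ℙ⁸` where all polynomials of `s` vanish. -/
def zeroSet (s : Set (MatrixCoordRing K)) : Closeds (P8 K) :=
  ⟨ProjectiveSpectrum.zeroLocus (matrixGrading K) s,
    ProjectiveSpectrum.isClosed_zeroLocus (matrixGrading K) s⟩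

/-- The set of matrices whose `i`-th row vanishes. -/
def rowZero (i : Fin 3) : Closeds (P8 K) :=
  zeroSet K (Set.range fun j : Fin 3 => X (i, j))

/-- `B ≅ ℙ²`: the rank-one matrices with image the cusp `(1 : 0 : 0)`. -/
def cuspLocus : Closeds (P8 K) := rowZero K 1 ⊓ rowZero K 2

/-- `P ≅ ℙ⁵`: the matrices with image contained in the tangent cone at the cusp, i.e. in the line
on which the last coordinate vanishes. -/
def tangentLocus : Closeds (P8 K) := rowZero K 2

variable {K}

/-- The linear form `φ ↦ (φ ξ)_i` on the space of matrices. -/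
def rowForm (i : Fin 3) (ξ : Fin 3 → K) : MatrixCoordRing K :=
  ∑ j, C (ξ j) * X (i, j)

/-- The point-condition of the point `ξ ∈ ℙ²` for the curve `x ^ n = y ^ m z ^ (n - m)`, where
the point `(z : x : y)` of the plane is written as a column: the matrices `φ` such that `φ ξ`
satisfies the equation of the curve. -/
def pointCondition (m n : ℕ) (ξ : Fin 3 → K) : Closeds (P8 K) :=
  zeroSet K {rowForm 0 ξ ^ (n - m) * rowForm 2 ξ ^ m - rowForm 1 ξ ^ n}

/-- Substitution `φ ↦ φ g` on the homogeneous coordinate ring. -/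
def rightMulAlgHom (g : Matrix (Fin 3) (Fin 3) K) : MatrixCoordRing K →ₐ[K] MatrixCoordRing K :=
  aeval fun p : Fin 3 × Fin 3 => ∑ l, X (p.1, l) * C (g l p.2)

lemma rightMulAlgHom_comp (g h : Matrix (Fin 3) (Fin 3) K) :
    (rightMulAlgHom g).comp (rightMulAlgHom h) = rightMulAlgHom (g * h) := by
  apply MvPolynomial.algHom_ext
  rintro ⟨i, k⟩
  simp only [rightMulAlgHom, AlgHom.comp_apply, aeval_X, map_sum, map_mul, Matrix.mul_apply,
    MvPolynomial.algHom_C, MvPolynomial.algebraMap_eq, Finset.sum_mul, Finset.mul_sum]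
  rw [Finset.sum_comm]
  simp only [mul_assoc]

lemma rightMulAlgHom_one : rightMulAlgHom (1 : Matrix (Fin 3) (Fin 3) K) = AlgHom.id K _ := by
  apply MvPolynomial.algHom_ext
  rintro ⟨i, k⟩
  simp [rightMulAlgHom, Matrix.one_apply, apply_ite (C : K → MatrixCoordRing K)]

lemma rightMulAlgHom_mem (g : Matrix (Fin 3) (Fin 3) K) {d : ℕ} {a : MatrixCoordRing K}
    (ha : a ∈ matrixGrading K d) : rightMulAlgHom g a ∈ matrixGrading K d := by
  rw [mem_homogeneousSubmodule] at ha ⊢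
  have h := ha.aeval (fun p : Fin 3 × Fin 3 => ∑ l, X (p.1, l) * C (g l p.2))
    (n := 1) (fun p => IsHomogeneous.sum _ _ _ fun l _ => by
      simpa using (isHomogeneous_X K (p.1, l)).mul (isHomogeneous_C _ (g l p.2)))
  simpa [rightMulAlgHom] using h

/-- `rightMulAlgHom` as a homomorphism of graded rings. -/
def rightMulGraded (g : Matrix (Fin 3) (Fin 3) K) :
    GradedRingHom (matrixGrading K) (matrixGrading K) where
  __ := (rightMulAlgHom g : MatrixCoordRing K →+* MatrixCoordRing K)
  map_mem := fun ha => rightMulAlgHom_mem g ha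

lemma rightMulGraded_irrelevant (g : GL (Fin 3) K) :
    HomogeneousIdeal.irrelevant (matrixGrading K) ≤
      (HomogeneousIdeal.irrelevant (matrixGrading K)).map
        (rightMulGraded (g : Matrix (Fin 3) (Fin 3) K)) := by
  refine (HomogeneousIdeal.toIdeal_irrelevant_le _).mpr fun d hd a ha => ?_
  let f' : GradedRingHom (matrixGrading K) (matrixGrading K) :=
    rightMulGraded ((g⁻¹ : GL (Fin 3) K) : Matrix (Fin 3) (Fin 3) K)
  have hfa : f' a ∈ HomogeneousIdeal.irrelevant (matrixGrading K) :=
    HomogeneousIdeal.mem_irrelevant_of_mem _ hd (rightMulAlgHom_mem _ ha)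
  have h := Ideal.mem_map_of_mem (rightMulGraded (g : Matrix (Fin 3) (Fin 3) K)) hfa
  have hid : rightMulGraded (g : Matrix (Fin 3) (Fin 3) K) (f' a) = a := by
    change ((rightMulAlgHom (g : Matrix (Fin 3) (Fin 3) K)).comp
      (rightMulAlgHom ((g⁻¹ : GL (Fin 3) K) : Matrix (Fin 3) (Fin 3) K))) a = a
    rw [rightMulAlgHom_comp, ← Units.val_mul, mul_inv_cancel, Units.val_one, rightMulAlgHom_one]
    rfl
  rw [hid] at h
  exact h

/-- The action of `g` on `ℙ⁸` by right multiplication, `φ ↦ φ g`. It depends only on the class of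
`g` in `PGL(3)`. -/
def rightMul (g : GL (Fin 3) K) : P8 K ⟶ P8 K :=
  Proj.map (rightMulGraded (g : Matrix (Fin 3) (Fin 3) K)) (rightMulGraded_irrelevant g)

lemma map_irrelevant_eq_top {R : Type u} [CommRing R] [Algebra K R]
    (M : Matrix (Fin 3) (Fin 3) R) (h : M 0 0 = 1) :
    (HomogeneousIdeal.irrelevant (matrixGrading K)).toIdeal.map
      ((Scheme.ΓSpecIso (CommRingCat.of R)).inv.hom.comp
        (aeval (R := K) fun p : Fin 3 × Fin 3 => M p.1 p.2).toRingHom) = ⊤ := by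
  rw [Ideal.eq_top_iff_one]
  have hX : (X (0, 0) : MatrixCoordRing K) ∈
      (HomogeneousIdeal.irrelevant (matrixGrading K)).toIdeal := by
    rw [HomogeneousIdeal.mem_iff, HomogeneousIdeal.mem_irrelevant_iff, GradedRing.proj_apply,
      DirectSum.decompose_of_mem_ne (matrixGrading K) (i := 1) (j := 0)
        ((mem_homogeneousSubmodule 1 _).mpr (isHomogeneous_X K (0, 0))) one_ne_zero]
  simpa [h] using Ideal.mem_map_of_mem ((Scheme.ΓSpecIso (CommRingCat.of R)).inv.hom.comp
        (aeval (R := K) fun p : Fin 3 × Fin 3 => M p.1 p.2).toRingHom) hX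

/-- The morphism `Spec R ⟶ ℙ⁸` given by a `3 × 3` matrix over the `K`-algebra `R` whose upper left
entry is `1`. -/
def matrixPoint (K : Type u) [Field K] {R : Type u} [CommRing R] [Algebra K R]
    (M : Matrix (Fin 3) (Fin 3) R) (h : M 0 0 = 1) : Spec (CommRingCat.of R) ⟶ P8 K :=
  Proj.fromOfGlobalSections (matrixGrading K)
    ((Scheme.ΓSpecIso (CommRingCat.of R)).inv.hom.comp
      (aeval (R := K) fun p : Fin 3 × Fin 3 => M p.1 p.2).toRingHom)
    (map_irrelevant_eq_top M h)

end P8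

/-! ## Directed blow-ups -/

/-- A scheme over `ℙ⁸` with the closed subsets that are followed through a sequence of directed
blow-ups. -/
structure BlowupStage (K : Type u) [Field K] where
  /-- the scheme obtained so far -/
  V : Scheme.{u}
  /-- its map to `ℙ⁸` -/
  π : V ⟶ P8 K
  /-- the center of the next blow-up -/
  center : Closeds V
  /-- the (proper transform of the) subvariety that gives the direction -/
  dir : Closeds V
  /-- the last exceptional divisor of the current directed blow-up (empty before the first blow-up
  of the sequence producing it) -/
  exc : Closeds V
  /-- the union of the proper transforms of all previous exceptional divisors and directions,
  except `exc` and `dir` -/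
  rest : Closeds V

variable {K : Type u} [Field K]

namespace BlowupStage

variable (K) in
/-- The starting point: `B ⊂ P ⊂ ℙ⁸`. -/
def initial : BlowupStage K where
  V := P8 K
  π := 𝟙 _
  center := cuspLocus K
  dir := tangentLocus K
  exc := ⊥
  rest := ⊥

/-- The data after a blow-up `β : V' ⟶ V` along the center: the new exceptional divisor is the
inverse image of the center; the next center is its intersection with the proper transform of the
direction. -/
def blowup (c : BlowupStage K) {V' : Scheme.{u}} (β : V' ⟶ c.V) : BlowupStage K where
  V := V'
  π := β ≫ c.π
  center := preimageClosed β c.center ⊓ properTransform β c.center c.dir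
  dir := properTransform β c.center c.dir
  exc := preimageClosed β c.center
  rest := properTransform β c.center (c.rest ⊔ c.exc)

/-- The passage to the next directed blow-up: its first center is the distinguished subvariety of
the last exceptional divisor, and its direction is this exceptional divisor. -/
def turn (c : BlowupStage K) : BlowupStage K where
  V := c.V
  π := c.π
  center := c.center
  dir := c.exc
  exc := ⊥
  rest := c.rest ⊔ c.dir

/-- `IsDirectedBlowup ℓ c c'`: the stage `c'` arises from `c` by the `ℓ`-directed blow-up along
`c.center` in the direction of `c.dir`. -/
inductive IsDirectedBlowup : ℕ → BlowupStage K → BlowupStage K → Prop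
  | one (c : BlowupStage K) (V' : Scheme.{u}) (β : V' ⟶ c.V) (hβ : IsBlowup β c.center) :
      IsDirectedBlowup 1 c (c.blowup β)
  | succ (ℓ : ℕ) (c c' : BlowupStage K) (h : IsDirectedBlowup ℓ c c')
      (V' : Scheme.{u}) (β : V' ⟶ c'.V) (hβ : IsBlowup β c'.center) :
      IsDirectedBlowup (ℓ + 1) c (c'.blowup β)

/-- `IsDirectedSequence [ℓ₁, …, ℓₑ] c c'`: the stage `c'` arises from `c` by successive
`ℓ₁`-, …, `ℓₑ`-directed blow-ups, each after the first along the distinguished subvariety of the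
preceding exceptional divisor in the direction of that divisor. -/
inductive IsDirectedSequence : List ℕ → BlowupStage K → BlowupStage K → Prop
  | single (ℓ : ℕ) (c c' : BlowupStage K) (h : IsDirectedBlowup ℓ c c') :
      IsDirectedSequence [ℓ] c c'
  | cons (ℓ : ℕ) (L : List ℕ) (c c' c'' : BlowupStage K) (h : IsDirectedBlowup ℓ c c')
      (h' : IsDirectedSequence L c'.turn c'') :
      IsDirectedSequence (ℓ :: L) c c''

/-- `τ` is a lift to `V` of the action of `g` on `ℙ⁸`. -/
def IsLift (c : BlowupStage K) (g : GL (Fin 3) K) (τ : c.V ⟶ c.V) : Prop :=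
  τ ≫ c.π = c.π ≫ rightMul g

/-- The point `x` can be moved into `U` by the action of `PGL(3)`. -/
def CanBeMovedInto (c : BlowupStage K) (x : c.V) (U : Set c.V) : Prop :=
  ∃ (g : GL (Fin 3) K) (τ : c.V ⟶ c.V), c.IsLift g τ ∧ τ x ∈ U

/-- The proper transform in `V` of a closed subset of `ℙ⁸` (all blow-ups take place over `B`). -/
def transform (c : BlowupStage K) (W : Closeds (P8 K)) : Closeds c.V :=
  properTransform c.π (cuspLocus K) W

/-- The set of points of `V` at which all point-conditions meet, i.e. the support of the base
locus of the lift to `V` of the rational map `φ ↦ {p | F (φ p) = 0}` to the space of curves. -/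
def baseSet (c : BlowupStage K) (m n : ℕ) : Set c.V :=
  {x | ∀ ξ : Fin 3 → K, ξ ≠ 0 → x ∈ c.transform (pointCondition m n ξ)}

end BlowupStage

/-- The quotients `[ℓ₁, …, ℓₑ]` in the Euclidean algorithm
`a = b ℓ₁ + m₂`, `b = m₂ ℓ₂ + m₃`, …, `mₑ₋₁ = mₑ ℓₑ`. -/
def euclidQuotients (a b : ℕ) : List ℕ :=
  if _h : b = 0 then [] else a / b :: euclidQuotients b (a % b)
termination_by b
decreasing_by exact Nat.mod_lt a (Nat.pos_of_ne_zero _h)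

/-! ## The coordinate expressions -/

section Chart

variable (K)

/-- Coordinate ring of affine 8-space. -/
abbrev ChartRing : Type u := MvPolynomial (Fin 8) K

/-- The coordinates `s₁, …, s₈`: here `coord K i` is `sᵢ₊₁`. -/
abbrev coord (i : Fin 8) : ChartRing K := X i

/-- The matrix with rows `(1, s₁, s₂)`, `r (1, s₄, s₅)` and `t (1, s₇, s₈)`. -/
def chartMatrix (r t : ChartRing K) : Matrix (Fin 3) (Fin 3) (ChartRing K) :=
  !![1, coord K 0, coord K 1;
     r, r * coord K 3, r * coord K 4;
     t, t * coord K 6, t * coord K 7]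

/-- The matrix with rows `(1, s₁, s₂)`, `s₃ (1, s₄, s₅)` and `s₃ ^ n (s₆, s₇, s₈)`. -/
def chartMatrixOne (n : ℕ) : Matrix (Fin 3) (Fin 3) (ChartRing K) :=
  !![1, coord K 0, coord K 1;
     coord K 2, coord K 2 * coord K 3, coord K 2 * coord K 4;
     coord K 2 ^ n * coord K 5, coord K 2 ^ n * coord K 6, coord K 2 ^ n * coord K 7]

end Chart

end

/-! The construction is toric in suitable coordinates. Every center is covered by charts that are
affine spaces, in which the center is a coordinate subspace. After the first directed blow-up, the
second and third rows of the matrix are, in these charts, monomials in two coordinates times rows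
with an entry 1. A divisor is therefore recorded by the vector `v` of the orders to which the second
and third rows vanish along it. Blowing up the crossing of two divisors adds their vectors. The
subspace `P`, of codimension three, plays the role of a divisor with vector `(0, 1)`; the divisors
of the first directed blow-up have the vectors `(1, 1), …, (1, ℓ₁)`.

The defect `n * v.1 - m * v.2` (`orderDefect`) compares the orders of the two terms of a
point-condition. It is `-m` for `P` and `n - m * ℓ₁ = m₂` for `E₁`. Each directed blow-up adds the
vector of the direction repeatedly, so the defects run through the Euclidean algorithm with
alternating signs, and the last divisor has defect 0. The determinant of the two vectors at the
crossing stays `±1`. Hence, by coprimality, the last vector is `(m, n)`, and the other vector `(A,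
B)` satisfies the Bézout relation (`exists_isPost_of_isDirectedSequence`,
`eq_of_orderDefect_eq_zero`).

Movability is tested on germs, that is, on morphisms from spectra of local domains. Off the excluded
loci the two rows are exactly divisible by monomials with the two final exponent vectors. A general
`g` makes the first entries of all rows units. Because the exponent matrix is unimodular, these
units can be absorbed into the two coordinates, so the translated germ agrees in `ℙ⁸` with a germ in
`U` (`canBeMovedInto_of_monomialRows`). It also agrees with it in `Ṽ`, since a morphism from the
spectrum of a domain whose generic point lies off `B` is determined by its image in `ℙ⁸` (`IsTame`).
When `e = 1` the third row need not be exactly divisible, but then its three quotients are free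
coordinates. Conversely, `U` misses the excluded loci, and these are invariant under the lifted
action.

For the base locus, along a divisor with nonzero defect one term of a general point-condition
dominates. After the common factor is removed, the equation no longer vanishes there
(`notMem_baseSet_of_rows`). At a crossing of two divisors this works unless their defects have
opposite signs, and crossings of that kind are the ones blown up next. So the point-conditions meet
on none of the excluded loci over matrices with nonzero first row. -/

noncomputable section

/-! ### Inverse image ideals along affine charts -/

section

namespace AlgebraicGeometry.Scheme.IdealSheafData

/-- Both inclusions come from the adjunction between inverse and direct image of ideal sheaves,
tested on global sections. -/
lemma ideal_comap_top {X Y : Scheme.{u}} [IsAffine X] [IsAffine Y] (f : X ⟶ Y)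
    (J : Y.IdealSheafData) :
    (J.comap f).ideal ⟨⊤, isAffineOpen_top X⟩ =
      (J.ideal ⟨⊤, isAffineOpen_top Y⟩).map f.appTop.hom := by
  apply le_antisymm
  · have h : J.comap f ≤ ofIdealTop ((J.ideal ⟨⊤, isAffineOpen_top Y⟩).map f.appTop.hom) := by
      rw [← le_map_iff_comap_le]
      refine le_of_isAffine ?_
      rw [ideal_map_of_isAffineHom, ← Ideal.map_le_iff_le_comap]
      exact (equivOfIsAffine.apply_symm_apply _).ge
    refine (le_def.mp h _).trans ?_
    exact (equivOfIsAffine.apply_symm_apply _).le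
  · rw [Ideal.map_le_iff_le_comap]
    have h := le_def.mp (le_map_comap J f) ⟨⊤, isAffineOpen_top Y⟩
    rwa [ideal_map_of_isAffineHom] at h

/-- The inverse image ideal in `R` of an ideal sheaf along a morphism `Spec R ⟶ X`. -/
def pullIdeal {X : Scheme.{u}} (J : X.IdealSheafData) {R : CommRingCat.{u}} (j : Spec R ⟶ X) :
    Ideal R :=
  ((J.comap j).ideal ⟨⊤, isAffineOpen_top (Spec R)⟩).map (Scheme.ΓSpecIso R).hom.hom

lemma pullIdeal_map {X : Scheme.{u}} (J : X.IdealSheafData) {R S : CommRingCat.{u}} (φ : R ⟶ S)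
    (j : Spec R ⟶ X) :
    J.pullIdeal (Spec.map φ ≫ j) = (J.pullIdeal j).map φ.hom := by
  rw [pullIdeal, comap_comp, ideal_comap_top, pullIdeal, Ideal.map_map, Ideal.map_map,
    ← CommRingCat.hom_comp, ← CommRingCat.hom_comp, Scheme.ΓSpecIso_naturality]

lemma pullIdeal_comap {X Y : Scheme.{u}} (J : Y.IdealSheafData) (f : X ⟶ Y) {R : CommRingCat.{u}}
    (j : Spec R ⟶ X) : (J.comap f).pullIdeal j = J.pullIdeal (j ≫ f) := by
  rw [pullIdeal, pullIdeal, comap_comp]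

lemma pullIdeal_top {X : Scheme.{u}} {R : CommRingCat.{u}} (j : Spec R ⟶ X) :
    (⊤ : X.IdealSheafData).pullIdeal j = ⊤ := by
  rw [pullIdeal, comap_top]
  exact Ideal.map_top _

lemma le_pullIdeal_iff {X : Scheme.{u}} (J : X.IdealSheafData) {R : CommRingCat.{u}}
    (j : Spec R ⟶ X) (y : Spec R) :
    J.pullIdeal j ≤ y.asIdeal ↔ j y ∈ J.support := by
  have h : y ∈ (J.comap j).support ↔ j y ∈ J.support := by
    rw [support_comap]; rfl
  rw [← h, mem_support_iff_of_mem (U := ⟨⊤, isAffineOpen_top (Spec R)⟩) (by trivial), pullIdeal]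
  generalize (J.comap j).ideal ⟨⊤, isAffineOpen_top (Spec R)⟩ = I
  rw [Ideal.map_le_iff_le_comap, Scheme.mem_zeroLocus_iff]
  refine forall_congr' fun f => ?_
  refine forall_congr' fun _ => ?_
  change (Scheme.ΓSpecIso R).hom.hom f ∈ y.asIdeal ↔ _
  obtain ⟨r, rfl⟩ : ∃ r, (Scheme.ΓSpecIso R).inv.hom r = f :=
    ⟨(Scheme.ΓSpecIso R).hom.hom f, by simp⟩
  have hb : (Spec R).basicOpen ((Scheme.ΓSpecIso R).inv.hom r) = PrimeSpectrum.basicOpen r :=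
    basicOpen_eq_of_affine r
  rw [hb, ← RingHom.comp_apply, ← CommRingCat.hom_comp, Iso.inv_hom_id]
  exact not_not.symm

/-- Along an open immersion the inverse image ideal is the ideal of sections over the image. -/
lemma exists_pullIdeal_eq {X : Scheme.{u}} {R : CommRingCat.{u}} (j : Spec R ⟶ X)
    [IsOpenImmersion j] (U : X.affineOpens) (hU : j ''ᵁ ⊤ = U.1) :
    ∃ e : Γ(X, U.1) ≅ R, ∀ J : X.IdealSheafData,
      J.pullIdeal j = (J.ideal U).map e.hom.hom := by
  obtain ⟨U, hU'⟩ := U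
  obtain rfl : j ''ᵁ ⊤ = U := hU
  refine ⟨j.appIso ⊤ ≪≫ Scheme.ΓSpecIso R, fun J => ?_⟩
  rw [pullIdeal, ideal_comap_of_isOpenImmersion]
  have h (I : Ideal Γ(X, j ''ᵁ ⊤)) : I.comap (j.appIso ⊤).inv.hom = I.map (j.appIso ⊤).hom.hom :=
    (Ideal.map_comap_of_equiv (j.appIso ⊤).commRingCatIsoToRingEquiv).symm
  rw [h, Ideal.map_map]
  rfl

lemma isRadical_map_iso {A B : CommRingCat.{u}} (e : A ≅ B) {I : Ideal A} (hI : I.IsRadical) :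
    (I.map e.hom.hom).IsRadical := by
  have h : I.map e.hom.hom = I.comap e.inv.hom :=
    (Ideal.comap_symm (I := I) e.commRingCatIsoToRingEquiv).symm
  rw [h]
  exact hI.comap _

/-- Restriction to an open affine keeps the ideal radical, and a radical ideal is the intersection
of the primes containing it. These primes are the points that `j` sends into `Z`. -/
lemma mem_pullIdeal_vanishingIdeal {X : Scheme.{u}} {R : CommRingCat.{u}} (j : Spec R ⟶ X)
    [IsOpenImmersion j] (Z : Closeds X) (r : R) :
    r ∈ (vanishingIdeal Z).pullIdeal j ↔ ∀ y : Spec R, j y ∈ Z → r ∈ y.asIdeal := by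
  have hz (y : Spec R) : (vanishingIdeal Z).pullIdeal j ≤ y.asIdeal ↔ j y ∈ Z := by
    rw [le_pullIdeal_iff]
    change _ ∈ ((vanishingIdeal Z).support : Set X) ↔ _
    rw [coe_support_vanishingIdeal]
    rfl
  have hrad : ((vanishingIdeal Z).pullIdeal j).IsRadical := by
    obtain ⟨e, he⟩ := exists_pullIdeal_eq j
      ⟨j ''ᵁ ⊤, (isAffineOpen_top _).image_of_isOpenImmersion j⟩ rfl
    rw [he, vanishingIdeal_ideal]
    exact isRadical_map_iso e (PrimeSpectrum.isRadical_vanishingIdeal _)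
  rw [← hrad.radical, Ideal.radical_eq_sInf, Ideal.mem_sInf]
  constructor
  · intro h y hy
    exact h ⟨(hz y).mpr hy, y.isPrime⟩
  · rintro h J ⟨hJ, hJp⟩
    exact h ⟨J, hJp⟩ ((hz ⟨J, hJp⟩).mp hJ)

end AlgebraicGeometry.Scheme.IdealSheafData

open AlgebraicGeometry.Scheme.IdealSheafData

/-- Replaces affine open subsets by arbitrary open immersions from spectra, so that invertibility
can be checked in explicit charts. -/
lemma isInvertibleIdealSheaf_iff {X : Scheme.{u}} (J : X.IdealSheafData) :
    IsInvertibleIdealSheaf J ↔ ∀ x : X, ∃ (R : CommRingCat.{u}) (j : Spec R ⟶ X),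
      IsOpenImmersion j ∧ x ∈ Set.range j ∧
        ∃ a ∈ nonZeroDivisors R, J.pullIdeal j = Ideal.span {a} := by
  have hnz {A B : CommRingCat.{u}} (e : A ≅ B) (a : A) (ha : a ∈ nonZeroDivisors A) :
      e.hom.hom a ∈ nonZeroDivisors B :=
    by
    have := (nonZeroDivisors A).mem_map_of_mem e.commRingCatIsoToRingEquiv ha
    rwa [MulEquivClass.map_nonZeroDivisors] at this
  refine forall_congr' fun x => ⟨?_, ?_⟩
  · rintro ⟨U, hx, a, ha, h⟩
    have hU : IsAffineOpen U.1 := U.2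
    obtain ⟨e, he⟩ := exists_pullIdeal_eq hU.fromSpec U (by
      rw [Scheme.Hom.image_top_eq_opensRange, hU.opensRange_fromSpec])
    refine ⟨_, hU.fromSpec, inferInstance, by rw [hU.range_fromSpec]; exact hx,
      e.hom.hom a, hnz e a ha, ?_⟩
    rw [he, h, Ideal.map_span, Set.image_singleton]
  · rintro ⟨R, j, hj, hx, a, ha, h⟩
    obtain ⟨e, he⟩ := exists_pullIdeal_eq j
      ⟨j ''ᵁ ⊤, (isAffineOpen_top _).image_of_isOpenImmersion j⟩ rfl
    refine ⟨⟨j ''ᵁ ⊤, (isAffineOpen_top _).image_of_isOpenImmersion j⟩, ?_,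
      e.inv.hom a, hnz e.symm a ha, ?_⟩
    · change x ∈ j ''ᵁ ⊤
      rw [Scheme.Hom.image_top_eq_opensRange]; exact hx
    · rw [he] at h
      have := congrArg (Ideal.map e.inv.hom) h
      rw [Ideal.map_map, ← CommRingCat.hom_comp, Iso.hom_inv_id, Ideal.map_span,
        Set.image_singleton] at this
      exact (Ideal.map_id _).symm.trans this

end

/-! ### Blow-ups away from the center -/

section

open AlgebraicGeometry.Scheme.IdealSheafData

/-- Open immersions are flat, and flat base change preserves injectivity of multiplication by `a`.
-/
lemma mem_nonZeroDivisors_of_isOpenImmersion {A B : CommRingCat.{u}} (η : A ⟶ B)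
    [IsOpenImmersion (Spec.map η)] {a : A} (ha : a ∈ nonZeroDivisors A) :
    η.hom a ∈ nonZeroDivisors B := by
  have hflat : η.hom.Flat := Flat.SpecMap_iff.mp inferInstance
  algebraize [η.hom]
  have h := Module.Flat.isSMulRegular_of_nonZeroDivisors (M := B) ha
  rw [mem_nonZeroDivisors_iff_right]
  intro b hb
  refine h ?_
  change a • b = a • 0
  rw [smul_zero, Algebra.smul_def, mul_comm]
  exact hb

/-- A morphism is affine-locally, on arbitrarily small neighbourhoods of a point, induced by a ring
homomorphism. -/
lemma exists_affine_lift {T X : Scheme.{u}} (f : T ⟶ X) {A : CommRingCat.{u}} (k : Spec A ⟶ X)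
    [IsOpenImmersion k] (t : T) (ht : f t ∈ Set.range k) (O : T.Opens) (hO : t ∈ O) :
    ∃ (B : CommRingCat.{u}) (l : Spec B ⟶ T) (θ : A ⟶ B), IsOpenImmersion l ∧ t ∈ Set.range l ∧
      Set.range l ⊆ O ∧ l ≫ f = Spec.map θ ≫ k := by
  obtain ⟨_, ⟨U, hU, rfl⟩, htU, hUO⟩ := T.isBasis_affineOpens.exists_subset_of_mem_open
    (show t ∈ (f ⁻¹ᵁ k.opensRange ⊓ O : T.Opens) from ⟨ht, hO⟩) (f ⁻¹ᵁ k.opensRange ⊓ O).2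
  have hU : IsAffineOpen U := hU
  have hr : Set.range (hU.fromSpec ≫ f) ⊆ Set.range k := by
    rintro _ ⟨y, rfl⟩
    have hy : hU.fromSpec y ∈ (U : Set T) := by
      rw [← hU.range_fromSpec]; exact ⟨y, rfl⟩
    exact (hUO hy).1
  refine ⟨_, hU.fromSpec, Spec.preimage (IsOpenImmersion.lift k (hU.fromSpec ≫ f) hr),
    inferInstance, by rw [hU.range_fromSpec]; exact htU, ?_, ?_⟩
  · rw [hU.range_fromSpec]; exact fun x hx => (hUO hx).2
  · rw [Spec.map_preimage, IsOpenImmersion.lift_fac]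

lemma isInvertibleIdealSheaf_top (X : Scheme.{u}) :
    IsInvertibleIdealSheaf (⊤ : X.IdealSheafData) := by
  rw [isInvertibleIdealSheaf_iff]
  intro x
  obtain ⟨_, ⟨U, hU, rfl⟩, hxU, -⟩ :=
    X.isBasis_affineOpens.exists_subset_of_mem_open (Set.mem_univ x) isOpen_univ
  have hU : IsAffineOpen U := hU
  refine ⟨_, hU.fromSpec, inferInstance, by rw [hU.range_fromSpec]; exact hxU, 1, one_mem _, ?_⟩
  rw [pullIdeal_top, Ideal.span_singleton_one]

/-- Recognition of open immersions through a section over an open set containing the image. -/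
lemma isOpenImmersion_of_section {T X : Scheme.{u}} (j : T ⟶ X) (W : X.Opens)
    (hW : ∀ t, j t ∈ W) (k : W.toScheme ⟶ T) (h₁ : k ≫ j = W.ι)
    (h₂ : ∀ l : T ⟶ W.toScheme, l ≫ W.ι = j → l ≫ k = 𝟙 T) :
    IsOpenImmersion j ∧ Set.range j = W := by
  have hr : Set.range j ⊆ Set.range W.ι := by
    rintro _ ⟨t, rfl⟩
    rw [Scheme.Opens.range_ι]; exact hW t
  let l := IsOpenImmersion.lift W.ι j hr
  have hl : l ≫ W.ι = j := IsOpenImmersion.lift_fac _ _ _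
  have hlk := h₂ l hl
  have hkl : k ≫ l = 𝟙 _ := by
    rw [← cancel_mono W.ι, Category.assoc, hl, h₁, Category.id_comp]
  have : IsIso l := ⟨k, hlk, hkl⟩
  constructor
  · rw [← hl]; infer_instance
  · have hs : Function.Surjective l := fun w => ⟨k w, by
      rw [← Scheme.Hom.comp_apply, hkl]; rfl⟩
    rw [← hl, Scheme.Hom.comp_base, TopCat.coe_comp, Set.range_comp, hs.range_eq, Set.image_univ,
      Scheme.Opens.range_ι]

namespace IsBlowup

variable {V' V : Scheme.{u}} {β : V' ⟶ V} {Z : Closeds V}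

/-- The ideal of `Z` pulls back to the unit ideal, which is invertible. -/
lemma existsUnique_lift_of_notMem (hβ : IsBlowup β Z) {T : Scheme.{u}} (f : T ⟶ V)
    (h : ∀ t, f t ∉ Z) : ∃! f' : T ⟶ V', f' ≫ β = f := by
  apply hβ.existsUnique_lift
  have : (vanishingIdeal Z).comap f = ⊤ := by
    rw [← support_eq_bot_iff, support_comap]
    ext t
    refine ⟨fun ht => (h t ?_).elim, fun ht => ht.elim⟩
    have : f t ∈ ((vanishingIdeal Z).support : Set V) := ht
    rwa [coe_support_vanishingIdeal] at this
  rw [this]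
  exact isInvertibleIdealSheaf_top T

/-- Away from the center, a blow-up is an isomorphism. -/
lemma exists_isOpenImmersion_of_notMem (hβ : IsBlowup β Z) {T : Scheme.{u}} (j : T ⟶ V)
    [IsOpenImmersion j] (h : ∀ t, j t ∉ Z) :
    ∃ j' : T ⟶ V', j' ≫ β = j ∧ IsOpenImmersion j' ∧ Set.range j' = β ⁻¹' (Set.range j) := by
  obtain ⟨j', hj', -⟩ := hβ.existsUnique_lift_of_notMem j h
  let W : V'.Opens := β ⁻¹ᵁ j.opensRange
  have hr : Set.range (W.ι ≫ β) ⊆ Set.range j := by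
    rintro _ ⟨w, rfl⟩
    exact w.2
  refine ⟨j', hj', isOpenImmersion_of_section j' W (fun t => ?_)
    (IsOpenImmersion.lift j (W.ι ≫ β) hr) ?_ ?_⟩
  · change β (j' t) ∈ Set.range j
    rw [← Scheme.Hom.comp_apply, hj']
    exact ⟨t, rfl⟩
  -- Both the inclusion of `W` and the candidate section followed by `j'` lift the same morphism off
  -- the center.
  · refine (hβ.existsUnique_lift_of_notMem (W.ι ≫ β) fun t ht => ?_).unique ?_ rfl
    · obtain ⟨s, hs⟩ := hr ⟨t, rfl⟩
      exact h s (hs ▸ ht)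
    · rw [Category.assoc, hj', IsOpenImmersion.lift_fac]
  · intro l hl
    rw [← cancel_mono j, Category.assoc, IsOpenImmersion.lift_fac, ← Category.assoc, hl, hj',
      Category.id_comp]

/-- Morphisms from an arbitrary scheme that avoid the center lift through a given point. -/
lemma exists_lift_of_notMem (hβ : IsBlowup β Z) {T : Scheme.{u}} (f : T ⟶ V)
    (h : ∀ t, f t ∉ Z) (t : T) (x' : V') (hx : β x' = f t) :
    ∃ f' : T ⟶ V', f' ≫ β = f ∧ f' t = x' := by
  let O : V.Opens := ⟨(Z : Set V)ᶜ, Z.isClosed.isOpen_compl⟩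
  obtain ⟨o, ho, hoi, hor⟩ := hβ.exists_isOpenImmersion_of_notMem O.ι (fun t => t.2)
  have hr : Set.range f ⊆ Set.range O.ι := by
    rintro _ ⟨t, rfl⟩
    rw [Scheme.Opens.range_ι]; exact h t
  refine ⟨IsOpenImmersion.lift O.ι f hr ≫ o, ?_, ?_⟩
  · rw [Category.assoc, ho, IsOpenImmersion.lift_fac]
  · have hx' : x' ∈ Set.range o := by
      rw [hor]
      exact hr ⟨t, hx.symm⟩
    obtain ⟨y, rfl⟩ := hx'
    rw [Scheme.Hom.comp_apply]
    congr 1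
    apply O.ι.isOpenEmbedding.injective
    rw [← Scheme.Hom.comp_apply, IsOpenImmersion.lift_fac, ← hx, ← Scheme.Hom.comp_apply, ho]

end IsBlowup

end

/-! ### Affine charts of a blow-up from its universal property -/

section

open AlgebraicGeometry.Scheme.IdealSheafData

/-- `φ : R ⟶ R'` is the affine chart of the blow-up of the ideal `I` on which `f` generates the
inverse image of `I`. -/
structure IsAffineBlowup {R R' : CommRingCat.{u}} (I : Ideal R) (f : R) (φ : R ⟶ R') : Prop where
  mem : f ∈ I
  map_le : I.map φ.hom ≤ Ideal.span {φ.hom f}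
  nonZeroDivisor : φ.hom f ∈ nonZeroDivisors R'
  existsUnique_lift : ∀ (A : CommRingCat.{u}) (ψ : R ⟶ A), ψ.hom f ∈ nonZeroDivisors A →
    I.map ψ.hom ≤ Ideal.span {ψ.hom f} → ∃! ψ' : R' ⟶ A, φ ≫ ψ' = ψ

namespace IsAffineBlowup

variable {R R' : CommRingCat.{u}} {I : Ideal R} {f : R} {φ : R ⟶ R'}

lemma map_eq (h : IsAffineBlowup I f φ) {A : CommRingCat.{u}} (ψ : R ⟶ A)
    (hψ : I.map ψ.hom ≤ Ideal.span {ψ.hom f}) : I.map ψ.hom = Ideal.span {ψ.hom f} :=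
  hψ.antisymm ((Ideal.span_singleton_le_iff_mem _).mpr (Ideal.mem_map_of_mem _ h.mem))

/-- Extends uniqueness of lifts from affine schemes to open subschemes of them, which need not be
affine, such as the overlaps met when gluing. On affine pieces `f` stays a nonzerodivisor by
flatness. -/
lemma hom_ext (h : IsAffineBlowup I f φ) {P : Scheme.{u}} {A : CommRingCat.{u}} (q : P ⟶ Spec A)
    [IsOpenImmersion q] (ω : R ⟶ A) (hω : ω.hom f ∈ nonZeroDivisors A)
    (hω' : I.map ω.hom ≤ Ideal.span {ω.hom f}) (u v : P ⟶ Spec R')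
    (hu : u ≫ Spec.map φ = q ≫ Spec.map ω) (hv : v ≫ Spec.map φ = q ≫ Spec.map ω) : u = v := by
  have key (B : CommRingCat.{u}) (l : Spec B ⟶ P) [IsOpenImmersion l] : l ≫ u = l ≫ v := by
    have hη : Spec.map (Spec.preimage (l ≫ q)) = l ≫ q := Spec.map_preimage _
    generalize Spec.preimage (l ≫ q) = η at hη
    have : IsOpenImmersion (Spec.map η) := by rw [hη]; infer_instance
    have hB : (ω ≫ η).hom f ∈ nonZeroDivisors B := by
      rw [CommRingCat.comp_apply]
      exact mem_nonZeroDivisors_of_isOpenImmersion η hω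
    have hB' : I.map (ω ≫ η).hom ≤ Ideal.span {(ω ≫ η).hom f} := by
      rw [CommRingCat.hom_comp, ← Ideal.map_map]
      refine (Ideal.map_mono hω').trans ?_
      rw [Ideal.map_span, Set.image_singleton]
      rfl
    have huq := (h.existsUnique_lift B (ω ≫ η) hB hB').unique
      (y₁ := Spec.preimage (l ≫ u)) (y₂ := Spec.preimage (l ≫ v))
      (Spec.map_injective (by
        rw [Spec.map_comp, Spec.map_preimage, Category.assoc, hu, Spec.map_comp, hη,
          Category.assoc]))
      (Spec.map_injective (by
        rw [Spec.map_comp, Spec.map_preimage, Category.assoc, hv, Spec.map_comp, hη,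
          Category.assoc]))
    rw [← Spec.map_preimage (l ≫ u), huq, Spec.map_preimage]
  refine P.affineOpenCover.openCover.hom_ext _ _ fun i => ?_
  have : IsOpenImmersion (P.affineOpenCover.f i) := P.affineOpenCover.openCover.map_prop i
  exact key _ (P.affineOpenCover.f i)

end IsAffineBlowup

/-- An affine open of the blow-up, lying over the affine `j : Spec R ⟶ V`, on which the function
`f` on `Spec R` generates the ideal `I`. -/
structure IsGeneratingNhd {V' V : Scheme.{u}} (β : V' ⟶ V) {R : CommRingCat.{u}} (j : Spec R ⟶ V)
    (I : Ideal R) (f : R) {A : CommRingCat.{u}} (k : Spec A ⟶ V') (θ : R ⟶ A) : Prop where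
  isOpenImmersion : IsOpenImmersion k
  comp_eq : k ≫ β = Spec.map θ ≫ j
  nonZeroDivisor : θ.hom f ∈ nonZeroDivisors A
  map_le : I.map θ.hom ≤ Ideal.span {θ.hom f}

namespace IsBlowup

variable {V' V : Scheme.{u}} {β : V' ⟶ V} {Z : Closeds V} {R R' : CommRingCat.{u}}
  {f : R} {φ : R ⟶ R'}

lemma existsUnique_lift_of_pullIdeal (hβ : IsBlowup β Z) {A : CommRingCat.{u}} (g : Spec A ⟶ V)
    (a : A) (ha : a ∈ nonZeroDivisors A)
    (h : (vanishingIdeal Z).pullIdeal g = Ideal.span {a}) : ∃! g' : Spec A ⟶ V', g' ≫ β = g := by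
  apply hβ.existsUnique_lift
  rw [isInvertibleIdealSheaf_iff]
  intro x
  refine ⟨A, 𝟙 _, inferInstance, ⟨x, rfl⟩, a, ha, ?_⟩
  rw [pullIdeal_comap, Category.id_comp, h]

/-- Locally, the inverse image of the center is generated by a nonzerodivisor. -/
lemma exists_principal_nhd (hβ : IsBlowup β Z) (j : Spec R ⟶ V) [IsOpenImmersion j] (x' : V')
    (hx : β x' ∈ Set.range j) :
    ∃ (A : CommRingCat.{u}) (k : Spec A ⟶ V') (θ : R ⟶ A), IsOpenImmersion k ∧ x' ∈ Set.range k ∧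
      k ≫ β = Spec.map θ ≫ j ∧ ∃ a ∈ nonZeroDivisors A,
        ((vanishingIdeal Z).pullIdeal j).map θ.hom = Ideal.span {a} := by
  obtain ⟨A₀, k₀, hk₀, ⟨y, rfl⟩, a, ha, hI⟩ :=
    (isInvertibleIdealSheaf_iff _).mp hβ.invertible x'
  obtain ⟨A, l, θ, hl, ⟨z, rfl⟩, -, hlθ⟩ := exists_affine_lift (k₀ ≫ β) j y
    (by rwa [Scheme.Hom.comp_apply]) ⊤ trivial
  have hη : Spec.map (Spec.preimage l) = l := Spec.map_preimage _
  generalize Spec.preimage l = η at hη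
  subst hη
  refine ⟨A, Spec.map η ≫ k₀, θ, inferInstance, ⟨z, by rw [Scheme.Hom.comp_apply]⟩,
    by rw [Category.assoc, hlθ], η.hom a, mem_nonZeroDivisors_of_isOpenImmersion η ha, ?_⟩
  rw [← pullIdeal_map, ← hlθ, pullIdeal_map, ← pullIdeal_comap, hI, Ideal.map_span,
    Set.image_singleton]

/-- If a function divides a generator of the ideal at a point of the blow-up up to a unit, then it
generates the ideal near that point. -/
lemma exists_generating_nhd {j : Spec R ⟶ V} {I : Ideal R} (f : R)
    {A : CommRingCat.{u}} (k : Spec A ⟶ V') (θ : R ⟶ A) [IsOpenImmersion k]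
    (hk : k ≫ β = Spec.map θ ≫ j) (a b : A) (ha : a ∈ nonZeroDivisors A)
    (hI : I.map θ.hom = Ideal.span {a}) (hb : θ.hom f = a * b) (y : Spec A) (hy : b ∉ y.asIdeal) :
    ∃ (A' : CommRingCat.{u}) (k' : Spec A' ⟶ V') (θ' : R ⟶ A'),
      IsGeneratingNhd β j I f k' θ' ∧ k y ∈ Set.range k' := by
  let η : A ⟶ CommRingCat.of (Localization.Away b) :=
    CommRingCat.ofHom (algebraMap A (Localization.Away b))
  have hη : IsOpenImmersion (Spec.map η) :=
    inferInstanceAs (IsOpenImmersion (Spec.map (CommRingCat.ofHom (algebraMap A _))))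
  have hu : IsUnit (η.hom b) := IsLocalization.Away.algebraMap_isUnit b
  have hf' : (θ ≫ η).hom f = η.hom a * η.hom b := by
    rw [CommRingCat.comp_apply, hb, map_mul]
  refine ⟨_, Spec.map η ≫ k, θ ≫ η, ⟨inferInstance, ?_, ?_, ?_⟩, ?_⟩
  · rw [Category.assoc, hk, Spec.map_comp, Category.assoc]
  · rw [hf']
    exact mul_mem (mem_nonZeroDivisors_of_isOpenImmersion η ha) hu.mem_nonZeroDivisors
  · rw [CommRingCat.hom_comp, ← Ideal.map_map, hI, Ideal.map_span, Set.image_singleton,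
      Ideal.span_singleton_le_span_singleton, ← CommRingCat.hom_comp, hf']
    exact (hu.dvd_mul_right).mp dvd_rfl |>.trans dvd_rfl
  · have : y ∈ Set.range (Spec.map η) := by
      have h := PrimeSpectrum.localization_away_comap_range (Localization.Away b) b
      exact h.symm ▸ hy
    obtain ⟨z, rfl⟩ := this
    exact ⟨z, by rw [Scheme.Hom.comp_apply]⟩

/-- An affine chart of the ideal of the center gives an open subscheme of the blow-up: the locus
where `f` generates the inverse image of the ideal. -/
theorem exists_chart (hβ : IsBlowup β Z) (j : Spec R ⟶ V) [IsOpenImmersion j]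
    (h : IsAffineBlowup ((vanishingIdeal Z).pullIdeal j) f φ) :
    ∃ j' : Spec R' ⟶ V', IsOpenImmersion j' ∧ j' ≫ β = Spec.map φ ≫ j ∧
      ∀ {A : CommRingCat.{u}} (k : Spec A ⟶ V') (θ : R ⟶ A),
        IsGeneratingNhd β j ((vanishingIdeal Z).pullIdeal j) f k θ →
          Set.range k ⊆ Set.range j' := by
  set I := (vanishingIdeal Z).pullIdeal j with hI
  have hlift {A : CommRingCat.{u}} (θ : R ⟶ A) (hθ : θ.hom f ∈ nonZeroDivisors A)
      (hθ' : I.map θ.hom ≤ Ideal.span {θ.hom f}) :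
      ∃! g' : Spec A ⟶ V', g' ≫ β = Spec.map θ ≫ j :=
    hβ.existsUnique_lift_of_pullIdeal _ _ hθ (by rw [pullIdeal_map, h.map_eq θ hθ'])
  obtain ⟨j', hj', -⟩ := hlift φ h.nonZeroDivisor h.map_le
  -- The expected image of the chart: the locus where `f` generates the inverse image of the ideal.
  -- A section of `j'` over it is glued from the affine universal property.
  let W : V'.Opens := ⟨{x | ∃ (A : CommRingCat.{u}) (k : Spec A ⟶ V') (θ : R ⟶ A),
      IsGeneratingNhd β j I f k θ ∧ x ∈ Set.range k}, by
    rw [isOpen_iff_forall_mem_open]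
    rintro x ⟨A, k, θ, hk, hx⟩
    have := hk.isOpenImmersion
    exact ⟨Set.range k, fun y hy => ⟨A, k, θ, hk, hy⟩, k.isOpenEmbedding.isOpen_range, hx⟩⟩
  have hex (x : W.toScheme) : ∃ (A : CommRingCat.{u}) (k : Spec A ⟶ V') (θ : R ⟶ A),
      IsGeneratingNhd β j I f k θ ∧ W.ι x ∈ Set.range k := x.2
  choose A k θ hk hkx using hex
  have hki (x : W.toScheme) : IsOpenImmersion (k x) := (hk x).isOpenImmersion
  have hkW (x : W.toScheme) : Set.range (k x) ⊆ Set.range W.ι := by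
    rw [Scheme.Opens.range_ι]
    exact fun y hy => ⟨_, k x, θ x, hk x, hy⟩
  let κ (x : W.toScheme) : Spec (A x) ⟶ W.toScheme := IsOpenImmersion.lift W.ι (k x) (hkW x)
  have hκ (x : W.toScheme) : κ x ≫ W.ι = k x := IsOpenImmersion.lift_fac _ _ _
  have hκi (x : W.toScheme) : IsOpenImmersion (κ x) := by
    have : IsOpenImmersion (κ x ≫ W.ι) := by rw [hκ]; infer_instance
    exact IsOpenImmersion.of_comp (κ x) W.ι
  let 𝒰 : W.toScheme.OpenCover := Scheme.Cover.mkOfCovers W.toScheme (fun x => Spec (A x)) κ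
    (fun x => by
      obtain ⟨y, hy⟩ := hkx x
      refine ⟨x, y, W.ι.isOpenEmbedding.injective ?_⟩
      rw [← Scheme.Hom.comp_apply, hκ, hy]) hκi
  choose ψ hψ hψ' using fun x : W.toScheme =>
    h.existsUnique_lift _ (θ x) (hk x).nonZeroDivisor (hk x).map_le
  have hcomp (x : W.toScheme) : Spec.map (ψ x) ≫ Spec.map φ = Spec.map (θ x) := by
    rw [← Spec.map_comp]; exact congrArg _ (hψ x)
  have hψj (x : W.toScheme) : Spec.map (ψ x) ≫ j' = k x := by
    refine (hlift (θ x) (hk x).nonZeroDivisor (hk x).map_le).unique ?_ (hk x).comp_eq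
    rw [Category.assoc, hj', ← Category.assoc, hcomp]
  let g : W.toScheme ⟶ Spec R' := 𝒰.glueMorphisms (fun x => Spec.map (ψ x)) (by
    intro (x : W.toScheme) (y : W.toScheme)
    have := hκi x
    have := hκi y
    change Limits.pullback.fst (κ x) (κ y) ≫ Spec.map (ψ x) =
      Limits.pullback.snd (κ x) (κ y) ≫ Spec.map (ψ y)
    refine h.hom_ext (Limits.pullback.fst (κ x) (κ y)) (θ x) (hk x).nonZeroDivisor (hk x).map_le
      _ _ (by rw [Category.assoc, hcomp]) ?_
    rw [Category.assoc, hcomp, ← cancel_mono j, Category.assoc, Category.assoc, ← (hk x).comp_eq,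
      ← (hk y).comp_eq, ← hκ x, ← hκ y, Category.assoc, Category.assoc,
      Limits.pullback.condition_assoc])
  have hg (x : W.toScheme) : κ x ≫ g = Spec.map (ψ x) := 𝒰.ι_glueMorphisms _ _ x
  -- Near `j' y` some nonzerodivisor `a` generates the ideal, and `f` is `b * a`. Pulled back to the
  -- chart, `f` generates too, so `b` becomes a unit there and cannot vanish at the point.
  have hW (y : Spec R') : j' y ∈ W := by
    have hy : β (j' y) ∈ Set.range j := by
      rw [← Scheme.Hom.comp_apply, hj', Scheme.Hom.comp_apply]
      exact ⟨_, rfl⟩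
    obtain ⟨A, k, θ, hki, hkr, hkβ, a, ha, hIa⟩ := hβ.exists_principal_nhd j (j' y) hy
    have hfI : θ.hom f ∈ Ideal.span {a} := by
      rw [← hIa]; exact Ideal.mem_map_of_mem _ h.mem
    obtain ⟨b, hb⟩ := Ideal.mem_span_singleton'.mp hfI
    obtain ⟨B, l, η, hl, ⟨z, rfl⟩, -, hlη⟩ := exists_affine_lift j' k y hkr ⊤ trivial
    have hlam : Spec.map (Spec.preimage l) = l := Spec.map_preimage _
    generalize Spec.preimage l = lam at hlam
    subst hlam
    have hcomm : φ ≫ lam = θ ≫ η := by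
      apply Spec.map_injective
      rw [Spec.map_comp, Spec.map_comp, ← cancel_mono j, Category.assoc, Category.assoc,
        ← hj', ← hkβ, ← Category.assoc, ← Category.assoc, hlη]
    have hnz : (φ ≫ lam).hom f ∈ nonZeroDivisors B := by
      rw [CommRingCat.comp_apply]
      exact mem_nonZeroDivisors_of_isOpenImmersion lam h.nonZeroDivisor
    have hspan : η.hom a ∈ Ideal.span {(φ ≫ lam).hom f} := by
      have h₁ : I.map (θ ≫ η).hom = Ideal.span {η.hom a} := by
        rw [CommRingCat.hom_comp, ← Ideal.map_map, hIa, Ideal.map_span, Set.image_singleton]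
      have h₂ : I.map (φ ≫ lam).hom ≤ Ideal.span {(φ ≫ lam).hom f} := by
        rw [CommRingCat.hom_comp, ← Ideal.map_map]
        refine (Ideal.map_mono h.map_le).trans ?_
        rw [Ideal.map_span, Set.image_singleton]
        rfl
      rw [← hcomm] at h₁
      exact h₂ (h₁ ▸ Ideal.mem_span_singleton_self _)
    obtain ⟨c, hc⟩ := Ideal.mem_span_singleton'.mp hspan
    have hunit : η.hom b * c = 1 := by
      have h₁ : (φ ≫ lam).hom f = η.hom b * η.hom a := by
        rw [hcomm, CommRingCat.comp_apply, ← hb, map_mul]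
      have h₂ : (η.hom b * c - 1) * (φ ≫ lam).hom f = 0 := by
        rw [sub_mul, mul_assoc, hc, ← h₁, one_mul, sub_self]
      exact sub_eq_zero.mp ((mem_nonZeroDivisors_iff_right.mp hnz) _ h₂)
    have hbz : b ∉ (Spec.map η z).asIdeal := by
      intro hb'
      have hb'' : η.hom b ∈ z.asIdeal := hb'
      exact z.isPrime.ne_top ((Ideal.eq_top_iff_one _).mpr
        (hunit ▸ z.asIdeal.mul_mem_right c hb''))
    obtain ⟨A', k', θ', hk', hr⟩ := exists_generating_nhd f k θ hkβ a b ha hIa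
      (by rw [← hb, mul_comm]) _ hbz
    refine ⟨A', k', θ', hk', ?_⟩
    rwa [← Scheme.Hom.comp_apply, ← hlη, Scheme.Hom.comp_apply] at hr
  have hκg (x : W.toScheme) : κ x ≫ g ≫ j' = κ x ≫ W.ι := by
    rw [← Category.assoc, hg, hψj, hκ]
  have hgj : g ≫ j' = W.ι := 𝒰.hom_ext _ _ hκg
  obtain ⟨hoi, hrange⟩ := isOpenImmersion_of_section j' W hW g hgj
    (fun l hl => h.hom_ext (𝟙 _) φ h.nonZeroDivisor h.map_le _ _ (by
        rw [Category.id_comp, ← cancel_mono j, Category.assoc, ← hj', Category.assoc,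
          ← Category.assoc g, hgj, ← Category.assoc, hl]) rfl)
  refine ⟨j', hoi, hj', fun {A} k θ hk => ?_⟩
  rw [hrange]
  exact fun y hy => ⟨A, k, θ, hk, hy⟩

/-- The affine charts belonging to generators of the ideal of the center cover the blow-up. -/
theorem exists_generating_nhd_of_span (hβ : IsBlowup β Z) (j : Spec R ⟶ V) [IsOpenImmersion j]
    {s : Set R} (hs : (vanishingIdeal Z).pullIdeal j = Ideal.span s) (x' : V')
    (hx : β x' ∈ Set.range j) :
    ∃ f ∈ s, ∃ (A : CommRingCat.{u}) (k : Spec A ⟶ V') (θ : R ⟶ A),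
      IsGeneratingNhd β j ((vanishingIdeal Z).pullIdeal j) f k θ ∧ x' ∈ Set.range k := by
  obtain ⟨A, k, θ, hki, ⟨y, rfl⟩, hkβ, a, ha, hIa⟩ := hβ.exists_principal_nhd j x' hx
  have hdiv (f : R) (hf : f ∈ s) : ∃ b, θ.hom f = a * b := by
    have : θ.hom f ∈ Ideal.span {a} := by
      rw [← hIa, hs]; exact Ideal.mem_map_of_mem _ (Ideal.subset_span hf)
    obtain ⟨b, hb⟩ := Ideal.mem_span_singleton'.mp this
    exact ⟨b, by rw [← hb, mul_comm]⟩
  by_contra hcon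
  push Not at hcon
  -- If no generator `f` worked, every cofactor `b` would vanish at `y`. Cancelling the
  -- nonzerodivisor `a` from the resulting inclusion then puts 1 into the prime of `y`.
  have hle : Ideal.span {a} ≤ Ideal.span {a} * y.asIdeal := by
    conv_lhs => rw [← hIa, hs, Ideal.map_span]
    rw [Ideal.span_le]
    rintro _ ⟨f, hf, rfl⟩
    obtain ⟨b, hb⟩ := hdiv f hf
    have hby : b ∈ y.asIdeal := by
      by_contra hby
      obtain ⟨A', k', θ', hk', hr⟩ := exists_generating_nhd f k θ hkβ a b ha hIa hb y hby
      exact hcon f hf A' k' θ' hk' hr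
    change θ.hom f ∈ _
    rw [hb]
    exact Ideal.mul_mem_mul (Ideal.mem_span_singleton_self a) hby
  obtain ⟨z, hz, hza⟩ := Ideal.mem_span_singleton_mul.mp (hle (Ideal.mem_span_singleton_self a))
  have : (z - 1) * a = 0 := by rw [sub_mul, one_mul, mul_comm, hza, sub_self]
  have hz1 : z = 1 := sub_eq_zero.mp ((mem_nonZeroDivisors_iff_right.mp ha) _ this)
  exact y.isPrime.ne_top ((Ideal.eq_top_iff_one _).mpr (hz1 ▸ hz))

end IsBlowup

end

/-! ### Blowing up coordinate subspaces of affine space -/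

section

open AlgebraicGeometry.Scheme.IdealSheafData

section CoordinateSubspaces

variable {σ : Type} {K : Type u} [Field K]

/-- The ideal of a coordinate subspace is prime. -/
lemma isPrime_span_X_image (S : Set σ) :
    (Ideal.span (X '' S : Set (MvPolynomial σ K))).IsPrime := by
  classical
  let θ : MvPolynomial σ K →ₐ[K] MvPolynomial σ K := aeval fun s => if s ∈ S then 0 else X s
  have h : Ideal.span (X '' S : Set (MvPolynomial σ K)) = RingHom.ker θ := by
    apply le_antisymm
    · rw [Ideal.span_le]
      rintro _ ⟨s, hs, rfl⟩
      simp [θ, hs]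
    · intro p hp
      -- Modulo the ideal, killing the coordinates in `S` changes nothing, so the kernel of `θ` lies
      -- in the ideal.
      have hq : (Ideal.Quotient.mkₐ K (Ideal.span (X '' S : Set (MvPolynomial σ K)))).comp θ =
          Ideal.Quotient.mkₐ K _ := by
        apply MvPolynomial.algHom_ext
        intro s
        by_cases hs : s ∈ S
        · simp only [θ, AlgHom.comp_apply, aeval_X, if_pos hs, map_zero]
          exact (Ideal.Quotient.eq_zero_iff_mem.mpr (Ideal.subset_span (Set.mem_image_of_mem X hs))).symm
        · simp [θ, hs]
      have := DFunLike.congr_fun hq p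
      rw [AlgHom.comp_apply, (RingHom.mem_ker).mp hp, map_zero] at this
      exact Ideal.Quotient.eq_zero_iff_mem.mp this.symm
  rw [h]
  exact RingHom.ker_isPrime _

lemma X_mem_span_X_image_iff (S : Set σ) (i : σ) :
    (X i : MvPolynomial σ K) ∈ Ideal.span (X '' S) ↔ i ∈ S := by
  constructor
  · intro h
    obtain ⟨s, hs, hs'⟩ := (mem_ideal_span_X_image.mp h) (Finsupp.single i 1) (by
      rw [support_X]; exact Finset.mem_singleton_self _)
    by_cases hsi : i = s
    · exact hsi ▸ hs
    · exact (hs' (Finsupp.single_eq_of_ne (Ne.symm hsi))).elim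
  · exact fun h => Ideal.subset_span ⟨i, h, rfl⟩

variable (K) in
/-- The points of affine space where all coordinates in `S` vanish. -/
def coordLocus (S : Set σ) : Set (Spec (CommRingCat.of (MvPolynomial σ K))) :=
  {y | ∀ s ∈ S, (X s : MvPolynomial σ K) ∈ y.asIdeal}

variable (K) in
/-- The generic point of a coordinate subspace. -/
def coordPoint (S : Set σ) : Spec (CommRingCat.of (MvPolynomial σ K)) :=
  ⟨Ideal.span (X '' S : Set (MvPolynomial σ K)), isPrime_span_X_image S⟩

lemma mem_coordLocus_iff (S : Set σ) (y : Spec (CommRingCat.of (MvPolynomial σ K))) :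
    y ∈ coordLocus K S ↔ (coordPoint K S).asIdeal ≤ y.asIdeal := by
  change _ ↔ Ideal.span (X '' S : Set (MvPolynomial σ K)) ≤ y.asIdeal
  rw [Ideal.span_le]
  exact Set.forall_mem_image.symm

lemma isClosed_coordLocus (S : Set σ) : IsClosed (coordLocus K S) := by
  have h : coordLocus K S = PrimeSpectrum.zeroLocus (X '' S : Set (MvPolynomial σ K)) := by
    ext y
    exact Set.forall_mem_image.symm
  rw [h]
  exact PrimeSpectrum.isClosed_zeroLocus _

/-- The generic point of the irreducible subspace given by `T` survives the removal. -/
lemma closure_coordLocus_diff {T S : Set σ} (h : ∃ s ∈ S, s ∉ T) :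
    closure (coordLocus K T \ coordLocus K S) = coordLocus K T := by
  obtain ⟨s, hs, hsT⟩ := h
  apply le_antisymm
  · exact closure_minimal Set.sdiff_subset (isClosed_coordLocus T)
  · intro y hy
    have hp : coordPoint K T ∈ coordLocus K T \ coordLocus K S :=
      ⟨(mem_coordLocus_iff T _).mpr le_rfl,
        fun h => hsT ((X_mem_span_X_image_iff T s).mp (h s hs))⟩
    have hc : y ∈ closure {coordPoint K T} :=
      (PrimeSpectrum.le_iff_mem_closure (coordPoint K T) y).mp ((mem_coordLocus_iff T y).mp hy)
    exact closure_mono (Set.singleton_subset_iff.mpr hp) hc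

open Classical in
variable (K) in
/-- The `i`-th chart of the blow-up of affine space along the subspace where the coordinates in
`S` vanish. -/
def blowupHom (S : Set σ) (i : σ) : MvPolynomial σ K →ₐ[K] MvPolynomial σ K :=
  aeval fun s => if s ∈ S ∧ s ≠ i then X s * X i else X s

lemma blowupHom_X_self (S : Set σ) (i : σ) : blowupHom K S i (X i) = X i := by
  simp [blowupHom]

lemma blowupHom_X_of_mem {S : Set σ} {i s : σ} (hs : s ∈ S) (hsi : s ≠ i) :
    blowupHom K S i (X s) = X s * X i := by
  simp [blowupHom, hs, hsi]

lemma blowupHom_X_of_notMem {S : Set σ} {i s : σ} (hs : s ∉ S) :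
    blowupHom K S i (X s) = X s := by
  simp [blowupHom, hs]

/-- A lift of `ψ` must send the other coordinates in `S` to the quotients of their images by `ψ (X
i)`. These exist by the divisibility assumption and are unique because `ψ (X i)` is a
nonzerodivisor. -/
lemma isAffineBlowup_blowupHom {S : Set σ} {i : σ} (hi : i ∈ S) :
    IsAffineBlowup (R := CommRingCat.of (MvPolynomial σ K))
      (R' := CommRingCat.of (MvPolynomial σ K)) (Ideal.span (X '' S)) (X i)
      (CommRingCat.ofHom (blowupHom K S i).toRingHom) where
  mem := Ideal.subset_span ⟨i, hi, rfl⟩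
  map_le := by
    rw [Ideal.map_span, Ideal.span_le]
    rintro _ ⟨_, ⟨s, hs, rfl⟩, rfl⟩
    change blowupHom K S i (X s) ∈ Ideal.span {blowupHom K S i (X i)}
    rw [blowupHom_X_self, Ideal.mem_span_singleton]
    by_cases hsi : s = i
    · rw [hsi, blowupHom_X_self]
    · rw [blowupHom_X_of_mem hs hsi]
      exact dvd_mul_left _ _
  nonZeroDivisor := by
    change blowupHom K S i (X i) ∈ _
    rw [blowupHom_X_self]
    exact mem_nonZeroDivisors_of_ne_zero (X_ne_zero i)
  existsUnique_lift := by
    classical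
    intro A ψ hnz hle
    have hdiv (s : σ) : ∃ q : A, s ∈ S → ψ.hom (X s) = q * ψ.hom (X i) := by
      by_cases hs : s ∈ S
      · obtain ⟨q, hq⟩ := Ideal.mem_span_singleton'.mp
          (hle (Ideal.mem_map_of_mem ψ.hom (Ideal.subset_span ⟨s, hs, rfl⟩)))
        exact ⟨q, fun _ => hq.symm⟩
      · exact ⟨0, fun h => (hs h).elim⟩
    choose q hq using hdiv
    let ψ' : MvPolynomial σ K →+* A :=
      eval₂Hom (ψ.hom.comp C) fun s => if s ∈ S ∧ s ≠ i then q s else ψ.hom (X s)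
    refine ⟨CommRingCat.ofHom ψ', ?_, ?_⟩
    · refine CommRingCat.hom_ext ?_
      change ψ'.comp (blowupHom K S i).toRingHom = ψ.hom
      apply MvPolynomial.ringHom_ext
      · intro c
        change ψ' (blowupHom K S i (C c)) = _
        rw [MvPolynomial.algHom_C, MvPolynomial.algebraMap_eq]
        simp [ψ']
      · intro s
        change ψ' (blowupHom K S i (X s)) = _
        by_cases hs : s ∈ S ∧ s ≠ i
        · rw [blowupHom_X_of_mem hs.1 hs.2, map_mul]
          simp [ψ', hs, hq s hs.1]
        · have : blowupHom K S i (X s) = X s := by simp [blowupHom, hs]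
          rw [this]
          simp [ψ', hs]
    · intro χ hχ
      have hχ' (x : MvPolynomial σ K) : χ.hom (blowupHom K S i x) = ψ.hom x := by
        rw [← hχ]; rfl
      refine CommRingCat.hom_ext ?_
      change χ.hom = ψ'
      apply MvPolynomial.ringHom_ext
      · intro c
        have := hχ' (C c)
        rw [MvPolynomial.algHom_C, MvPolynomial.algebraMap_eq] at this
        rw [this]
        simp [ψ']
      · intro s
        by_cases hs : s ∈ S ∧ s ≠ i
        · have h₁ := hχ' (X s)
          have h₂ := hχ' (X i)
          rw [blowupHom_X_self] at h₂
          rw [blowupHom_X_of_mem hs.1 hs.2, map_mul, h₂, hq s hs.1] at h₁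
          have h₃ : (χ.hom (X s) - q s) * ψ.hom (X i) = 0 := by rw [sub_mul, h₁, sub_self]
          have h₄ := sub_eq_zero.mp ((mem_nonZeroDivisors_iff_right.mp hnz) _ h₃)
          rw [h₄]
          simp [ψ', hs]
        · have : blowupHom K S i (X s) = X s := by simp [blowupHom, hs]
          have h₁ := hχ' (X s)
          rw [this] at h₁
          rw [h₁]
          simp [ψ', hs]

end CoordinateSubspaces

section BlowupCharts

variable {σ : Type} {K : Type u} [Field K] {V' V : Scheme.{u}} {β : V' ⟶ V} {Z : Closeds V}

/-- The chart map `blowupHom` on spectra. -/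
abbrev blowupMap (K : Type u) [Field K] (S : Set σ) (i : σ) :
    Spec (CommRingCat.of (MvPolynomial σ K)) ⟶ Spec (CommRingCat.of (MvPolynomial σ K)) :=
  Spec.map (CommRingCat.ofHom (blowupHom K S i).toRingHom)

/-- The coordinate ideal is prime, so a function vanishes on the subspace as soon as it vanishes at
its generic point. -/
lemma pullIdeal_eq_span_X_image (j : Spec (CommRingCat.of (MvPolynomial σ K)) ⟶ V)
    [IsOpenImmersion j] {S : Set σ} (hZ : ∀ y, j y ∈ Z ↔ y ∈ coordLocus K S) :
    (vanishingIdeal Z).pullIdeal j = Ideal.span (X '' S : Set (MvPolynomial σ K)) := by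
  ext r
  rw [mem_pullIdeal_vanishingIdeal]
  constructor
  · intro h
    exact h (coordPoint K S) ((hZ _).mpr ((mem_coordLocus_iff S _).mpr le_rfl))
  · intro h y hy
    exact (mem_coordLocus_iff S y).mp ((hZ y).mp hy) h

theorem IsBlowup.exists_coord_chart (hβ : IsBlowup β Z)
    (j : Spec (CommRingCat.of (MvPolynomial σ K)) ⟶ V) [IsOpenImmersion j] {S : Set σ}
    (hZ : ∀ y, j y ∈ Z ↔ y ∈ coordLocus K S) {i : σ} (hi : i ∈ S) :
    ∃ j' : Spec (CommRingCat.of (MvPolynomial σ K)) ⟶ V', IsOpenImmersion j' ∧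
      j' ≫ β = blowupMap K S i ≫ j := by
  obtain ⟨j', h₁, h₂, -⟩ := hβ.exists_chart j (f := X i)
    (pullIdeal_eq_span_X_image j hZ ▸ isAffineBlowup_blowupHom hi)
  exact ⟨j', h₁, h₂⟩

theorem IsBlowup.exists_coord_chart_mem (hβ : IsBlowup β Z)
    (j : Spec (CommRingCat.of (MvPolynomial σ K)) ⟶ V) [IsOpenImmersion j] {S : Set σ}
    (hZ : ∀ y, j y ∈ Z ↔ y ∈ coordLocus K S) (x' : V') (hx : β x' ∈ Set.range j) :
    ∃ i ∈ S, ∃ j' : Spec (CommRingCat.of (MvPolynomial σ K)) ⟶ V', IsOpenImmersion j' ∧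
      j' ≫ β = blowupMap K S i ≫ j ∧ x' ∈ Set.range j' := by
  obtain ⟨_, ⟨i, hi, rfl⟩, A, k, θ, hk, hx'⟩ :=
    hβ.exists_generating_nhd_of_span j (pullIdeal_eq_span_X_image j hZ) x' hx
  obtain ⟨j', h₁, h₂, h₃⟩ := hβ.exists_chart j (f := X i)
    (pullIdeal_eq_span_X_image j hZ ▸ isAffineBlowup_blowupHom hi)
  exact ⟨i, hi, j', h₁, h₂, h₃ k θ hk hx'⟩

variable {S : Set σ} {i : σ} {j : Spec (CommRingCat.of (MvPolynomial σ K)) ⟶ V}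
  {j' : Spec (CommRingCat.of (MvPolynomial σ K)) ⟶ V'}

lemma blowupMap_mem_iff (y : Spec (CommRingCat.of (MvPolynomial σ K))) (p : MvPolynomial σ K) :
    p ∈ (blowupMap K S i y).asIdeal ↔ blowupHom K S i p ∈ y.asIdeal := Iff.rfl

lemma mem_preimageClosed_chart (hi : i ∈ S) (hj' : j' ≫ β = blowupMap K S i ≫ j)
    (hZ : ∀ y, j y ∈ Z ↔ y ∈ coordLocus K S)
    (y : Spec (CommRingCat.of (MvPolynomial σ K))) :
    j' y ∈ preimageClosed β Z ↔ y ∈ coordLocus K {i} := by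
  change β (j' y) ∈ Z ↔ _
  rw [← Scheme.Hom.comp_apply, hj', Scheme.Hom.comp_apply, hZ]
  constructor
  · rintro h _ rfl
    have := h _ hi
    rwa [blowupMap_mem_iff, blowupHom_X_self] at this
  · intro h s hs
    rw [blowupMap_mem_iff]
    by_cases hsi : s = i
    · rw [hsi, blowupHom_X_self]; exact h i rfl
    · rw [blowupHom_X_of_mem hs hsi]
      exact Ideal.mul_mem_left _ _ (h i rfl)

lemma mem_properTransform_chart [IsOpenImmersion j'] {W : Closeds V}
    (y : Spec (CommRingCat.of (MvPolynomial σ K))) :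
    j' y ∈ properTransform β Z W ↔ y ∈ closure {y | β (j' y) ∈ W ∧ β (j' y) ∉ Z} := by
  have h := j'.isOpenEmbedding.isOpenMap.preimage_closure_eq_closure_preimage j'.continuous
    (β ⁻¹' ((W : Set V) \ Z))
  exact Set.ext_iff.mp h y

/-- Where `X i` is invertible the chart map only rescales coordinates by units, so the subspace
given by `T` pulls back to itself. If `i ∈ T` nothing is left there; otherwise its closure is taken.
No relation between `S` and `T` is needed. -/
lemma mem_properTransform_chart_of_coordLocus [IsOpenImmersion j'] (hi : i ∈ S)
    (hj' : j' ≫ β = blowupMap K S i ≫ j) (hZ : ∀ y, j y ∈ Z ↔ y ∈ coordLocus K S)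
    {W : Closeds V} {T : Set σ} (hW : ∀ y, j y ∈ W ↔ y ∈ coordLocus K T)
    (y : Spec (CommRingCat.of (MvPolynomial σ K))) :
    j' y ∈ properTransform β Z W ↔ i ∉ T ∧ y ∈ coordLocus K T := by
  have hset : {y | β (j' y) ∈ W ∧ β (j' y) ∉ Z} = coordLocus K T \ coordLocus K {i} := by
    ext z
    have h₁ := mem_preimageClosed_chart hi hj' hZ z
    change β (j' z) ∈ Z ↔ _ at h₁
    rw [Set.mem_ofPred_eq, h₁, Set.mem_sdiff]
    refine and_congr_left fun hz => ?_
    rw [← Scheme.Hom.comp_apply, hj', Scheme.Hom.comp_apply, hW]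
    have hzi : (X i : MvPolynomial σ K) ∉ z.asIdeal := fun h => hz (by rintro _ rfl; exact h)
    refine forall₂_congr fun s _ => ?_
    rw [blowupMap_mem_iff]
    by_cases hs : s ∈ S ∧ s ≠ i
    · rw [blowupHom_X_of_mem hs.1 hs.2]
      exact ⟨fun h => (z.isPrime.mem_or_mem h).resolve_right hzi, Ideal.mul_mem_right _ _⟩
    · have : blowupHom K S i (X s) = X s := by simp [blowupHom, hs]
      rw [this]
  rw [mem_properTransform_chart, hset]
  by_cases hiT : i ∈ T
  · have : coordLocus K T \ coordLocus K {i} = ∅ := by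
      rw [Set.sdiff_eq_empty]
      rintro z hz _ rfl
      exact hz _ hiT
    rw [this, closure_empty]
    simp [hiT]
  · rw [closure_coordLocus_diff ⟨i, Set.mem_singleton i, hiT⟩]
    simp [hiT]

lemma notMem_properTransform_chart [IsOpenImmersion j']
    (hj' : j' ≫ β = blowupMap K S i ≫ j) {W : Closeds V} (hW : ∀ y, j y ∉ W)
    (y : Spec (CommRingCat.of (MvPolynomial σ K))) : j' y ∉ properTransform β Z W := by
  have hset : {y | β (j' y) ∈ W ∧ β (j' y) ∉ Z} = ∅ := by
    ext z
    simp only [Set.mem_ofPred_eq, Set.mem_empty_iff_false, iff_false, not_and]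
    intro h
    rw [← Scheme.Hom.comp_apply, hj', Scheme.Hom.comp_apply] at h
    exact (hW _ h).elim
  rw [mem_properTransform_chart, hset, closure_empty]
  exact id

end BlowupCharts

end

/-! ### Points of `ℙ⁸` in homogeneous coordinates -/

section

open HomogeneousLocalization

section Points

variable {K : Type u} [Field K] {R S : Type u} [CommRing R] [CommRing S]

/-- The extension of a ring homomorphism to degree zero fractions with denominators powers of `t`. -/
def awayLift (φ : MatrixCoordRing K →+* R) {t : MatrixCoordRing K} (ht : IsUnit (φ t)) :
    Away (matrixGrading K) t →+* R :=
  (IsLocalization.Away.lift (S := Localization.Away t) t ht).comp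
    (algebraMap (Away (matrixGrading K) t) (Localization.Away t))

lemma awayLift_mk (φ : MatrixCoordRing K →+* R) {t : MatrixCoordRing K} (ht : IsUnit (φ t))
    {d : ℕ} (hd : t ∈ matrixGrading K d) (k : ℕ) (a : MatrixCoordRing K)
    (ha : a ∈ matrixGrading K (k • d)) :
    awayLift φ ht (Away.mk (matrixGrading K) hd k a ha) * φ t ^ k = φ a := by
  have h : algebraMap (Away (matrixGrading K) t) (Localization.Away t)
      (Away.mk (matrixGrading K) hd k a ha) * algebraMap _ _ (t ^ k) = algebraMap _ _ a := by
    rw [HomogeneousLocalization.algebraMap_apply, Away.val_mk, Localization.mk_eq_mk']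
    exact IsLocalization.mk'_spec _ a (⟨t ^ k, k, rfl⟩ : Submonoid.powers t)
  have := congrArg (IsLocalization.Away.lift (S := Localization.Away t) t ht) h
  rw [map_mul, IsLocalization.Away.lift_eq, IsLocalization.Away.lift_eq, map_pow] at this
  exact this

/-- The morphism is glued over basic opens; when `φ t` is a unit the piece belonging to `t` is
already everything. -/
lemma fromOfGlobalSections_eq (φ : MatrixCoordRing K →+* R) (hφ) {t : MatrixCoordRing K}
    (ht : IsUnit (φ t)) {d : ℕ} (hd : 0 < d) (htd : t ∈ matrixGrading K d) :
    Proj.fromOfGlobalSections (matrixGrading K)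
      ((Scheme.ΓSpecIso (CommRingCat.of R)).inv.hom.comp φ) hφ =
      Spec.map (CommRingCat.ofHom (awayLift φ ht)) ≫ Proj.awayι (matrixGrading K) t htd hd := by
  set F := (Scheme.ΓSpecIso (CommRingCat.of R)).inv.hom.comp φ with hF
  have hFt : IsUnit (F t) := ht.map (Scheme.ΓSpecIso (CommRingCat.of R)).inv.hom
  have hι : IsIso ((Spec (CommRingCat.of R)).basicOpen (F t)).ι := by
    have h : (Spec (CommRingCat.of R)).basicOpen (F t) = ⊤ := Scheme.basicOpen_of_isUnit _ hFt
    rw [h]; exact (Scheme.topIso _).isIso_hom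
  rw [← cancel_epi ((Spec (CommRingCat.of R)).basicOpen (F t)).ι]
  have h₁ : ((Spec (CommRingCat.of R)).basicOpen (F t)).ι ≫
      Proj.fromOfGlobalSections (matrixGrading K) F hφ =
      Proj.toBasicOpenOfGlobalSections (matrixGrading K) F rfl hd htd ≫ Scheme.Opens.ι _ :=
    (Proj.openCoverOfMapIrrelevantEqTop (matrixGrading K) F hφ).ι_glueMorphisms _ _
      ⟨_, _, hd, htd⟩
  rw [h₁]
  have h₂ : ∀ (M : Submonoid.powers t ≤ (Submonoid.powers (F t)).comap F),
      IsLocalization.map (M := .powers t) (S := Localization.Away t)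
        (T := .powers (F t)) (Localization.Away (F t)) F M =
      (algebraMap _ (Localization.Away (F t))).comp
        (IsLocalization.Away.lift (S := Localization.Away t) t hFt) := by
    intro M
    apply IsLocalization.ringHom_ext (M := .powers t)
    ext x <;> simp
  simp only [Proj.toBasicOpenOfGlobalSections, Category.assoc, h₂, Proj.basicOpenIsoSpec_inv_ι]
  simp only [Scheme.isoOfEq_inv, CommRingCat.ofHom_comp, Spec.map_comp, Category.assoc,
    basicOpenIsoSpecAway_hom_SpecMap_assoc, awayLift]
  refine (congrArg (_ ≫ ·) (morphismRestrict_ι_assoc _ _ _)).trans ?_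
  refine (Scheme.homOfLE_ι_assoc _ _ _).trans ?_
  refine congrArg (_ ≫ ·) ?_
  rw [← SpecMap_ΓSpecIso_hom]
  simp only [← Category.assoc]
  congr 2
  rw [← Spec.map_comp]
  congr 1
  ext x
  have : (Scheme.ΓSpecIso (CommRingCat.of R)).hom.hom.comp
      (IsLocalization.Away.lift (S := Localization.Away t) t hFt) =
      IsLocalization.Away.lift (S := Localization.Away t) t ht := by
    apply IsLocalization.ringHom_ext (M := .powers t)
    ext x <;> simp [hF]
  exact RingHom.congr_fun this x

lemma X_mem_matrixGrading (p : Fin 3 × Fin 3) : (X p : MatrixCoordRing K) ∈ matrixGrading K 1 := isHomogeneous_X K p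

/-- `u` is the point of `ℙ⁸` with homogeneous coordinates `φ (X p)`, one of the entries of the
first row being a unit. -/
def IsPt (φ : MatrixCoordRing K →+* R) (u : Spec (CommRingCat.of R) ⟶ P8 K) : Prop :=
  ∃ (k : Fin 3) (h : IsUnit (φ (X (0, k)))),
    u = Spec.map (CommRingCat.ofHom (awayLift φ h)) ≫
      Proj.awayι (matrixGrading K) (X (0, k)) (X_mem_matrixGrading _) one_pos

lemma X_mem_irrelevant (p : Fin 3 × Fin 3) :
    (X p : MatrixCoordRing K) ∈ (HomogeneousIdeal.irrelevant (matrixGrading K)).toIdeal := by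
  rw [HomogeneousIdeal.mem_iff]
  exact HomogeneousIdeal.mem_irrelevant_of_mem _ one_pos (isHomogeneous_X K p)

lemma map_irrelevant_of_isUnit (φ : MatrixCoordRing K →+* R) {k : Fin 3}
    (h : IsUnit (φ (X (0, k)))) :
    (HomogeneousIdeal.irrelevant (matrixGrading K)).toIdeal.map
      ((Scheme.ΓSpecIso (CommRingCat.of R)).inv.hom.comp φ) = ⊤ := by
  refine Ideal.eq_top_of_isUnit_mem _ (Ideal.mem_map_of_mem _ (X_mem_irrelevant (0, k))) ?_
  exact h.map (Scheme.ΓSpecIso (CommRingCat.of R)).inv.hom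

lemma map_eq_pow_mul_of_homogeneous {φ φ' : MatrixCoordRing K →+* R} {c : R}
    (hC : ∀ a, φ' (C a) = φ (C a)) (hX : ∀ p, φ' (X p) = c * φ (X p)) {d : ℕ}
    {a : MatrixCoordRing K} (ha : a ∈ matrixGrading K d) : φ' a = c ^ d * φ a := by
  rw [a.as_sum, map_sum, map_sum, Finset.mul_sum]
  refine Finset.sum_congr rfl fun v hv => ?_
  have hd : v.degree = d := by
    rw [← ha (mem_support_iff.1 hv), Finsupp.degree_eq_weight_one]
    rfl
  rw [monomial_eq, map_mul, map_mul, hC, Finsupp.prod, map_prod, map_prod]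
  simp only [map_pow, hX, mul_pow, Finset.prod_mul_distrib, Finset.prod_pow_eq_pow_sum]
  rw [← hd, Finsupp.degree_apply]
  ring

namespace IsPt

variable {φ : MatrixCoordRing K →+* R} {u v : Spec (CommRingCat.of R) ⟶ P8 K}

lemma exists_eq_fromOfGlobalSections (h : IsPt φ u) : ∃ hφ, u =
    Proj.fromOfGlobalSections (matrixGrading K)
      ((Scheme.ΓSpecIso (CommRingCat.of R)).inv.hom.comp φ) hφ := by
  obtain ⟨k, hk, rfl⟩ := h
  exact ⟨map_irrelevant_of_isUnit φ hk, (fromOfGlobalSections_eq φ _ hk _ _).symm⟩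

/-- Every such chart description equals the same glued morphism, so the column chosen in `IsPt` is
immaterial. This gives uniqueness and compatibility with linear substitutions. -/
lemma eq_awayι (h : IsPt φ u) {t : MatrixCoordRing K} (ht : IsUnit (φ t)) {d : ℕ} (hd : 0 < d)
    (htd : t ∈ matrixGrading K d) :
    u = Spec.map (CommRingCat.ofHom (awayLift φ ht)) ≫
      Proj.awayι (matrixGrading K) t htd hd := by
  obtain ⟨hφ, rfl⟩ := h.exists_eq_fromOfGlobalSections
  exact fromOfGlobalSections_eq φ hφ ht hd htd

lemma unique (h : IsPt φ u) (h' : IsPt φ v) : u = v := by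
  obtain ⟨k, hk, rfl⟩ := h
  exact (h'.eq_awayι hk _ _).symm

lemma comp (h : IsPt φ u) (ψ : R →+* S) :
    IsPt (ψ.comp φ) (Spec.map (CommRingCat.ofHom ψ) ≫ u) := by
  obtain ⟨k, hk, rfl⟩ := h
  refine ⟨k, hk.map ψ, ?_⟩
  rw [← Category.assoc, ← Spec.map_comp, ← CommRingCat.ofHom_comp]
  congr 3
  rw [awayLift, awayLift, ← RingHom.comp_assoc]
  congr 1
  apply IsLocalization.ringHom_ext (M := .powers (X (0, k) : MatrixCoordRing K))
  ext x <;> simp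

lemma rightMul (h : IsPt φ u) (g : GL (Fin 3) K) {k : Fin 3}
    (hk : IsUnit (φ (rightMulAlgHom (g : Matrix (Fin 3) (Fin 3) K) (X (0, k))))) :
    IsPt (φ.comp (rightMulAlgHom (g : Matrix (Fin 3) (Fin 3) K) :
      MatrixCoordRing K →+* MatrixCoordRing K)) (u ≫ _root_.rightMul g) := by
  refine ⟨k, hk, ?_⟩
  have hk' : IsUnit (φ (rightMulGraded (g : Matrix (Fin 3) (Fin 3) K) (X (0, k)))) := hk
  rw [h.eq_awayι hk' one_pos (rightMulAlgHom_mem _ (X_mem_matrixGrading _)), Category.assoc]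
  refine (congrArg (_ ≫ ·) (Proj.awayι_comp_map
    (rightMulGraded (g : Matrix (Fin 3) (Fin 3) K))
    (rightMulGraded_irrelevant g) one_pos (X (0, k)) (X_mem_matrixGrading _))).trans ?_
  rw [← Category.assoc, ← Spec.map_comp, ← CommRingCat.ofHom_comp]
  congr 3
  ext x
  obtain ⟨n, a, ha, rfl⟩ := x.mk_surjective _ (X_mem_matrixGrading _)
  rw [RingHom.comp_apply]
  have := awayLift_mk φ hk' (rightMulAlgHom_mem _ (X_mem_matrixGrading _)) n
    (rightMulAlgHom (g : Matrix (Fin 3) (Fin 3) K) a) (rightMulAlgHom_mem _ ha)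
  have h2 := awayLift_mk (φ.comp (rightMulAlgHom (g : Matrix (Fin 3) (Fin 3) K) :
      MatrixCoordRing K →+* MatrixCoordRing K)) hk (X_mem_matrixGrading _) n a ha
  refine (hk.pow n).mul_right_cancel (Eq.trans ?_ h2.symm)
  refine Eq.trans ?_ this
  congr 2
  exact Away.map_mk (rightMulGraded (g : Matrix (Fin 3) (Fin 3) K)) (X (0, k))
    (X_mem_matrixGrading _) n a ha

lemma scale (h : IsPt φ u) {φ' : MatrixCoordRing K →+* R} {c : R} (hc : IsUnit c)
    (hC : ∀ a, φ' (C a) = φ (C a)) (hX : ∀ p, φ' (X p) = c * φ (X p)) : IsPt φ' u := by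
  obtain ⟨k, hk, rfl⟩ := h
  have hk' : IsUnit (φ' (X (0, k))) := by rw [hX]; exact hc.mul hk
  refine ⟨k, hk', ?_⟩
  congr 3
  ext x
  obtain ⟨n, a, ha, rfl⟩ := x.mk_surjective _ (X_mem_matrixGrading _)
  have h₁ := awayLift_mk φ hk (X_mem_matrixGrading _) n a ha
  have h₂ := awayLift_mk φ' hk' (X_mem_matrixGrading _) n a ha
  refine (hk'.pow n).mul_right_cancel (Eq.trans ?_ h₂.symm)
  rw [map_eq_pow_mul_of_homogeneous hC hX ha, hX, mul_pow, ← h₁]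
  simp only [smul_eq_mul, mul_one]
  ring

lemma apply_mem_zeroSet_iff (h : IsPt φ u) {s : Set (MatrixCoordRing K)}
    (hs : ∀ f ∈ s, ∃ d, 0 < d ∧ f ∈ matrixGrading K d) (y : Spec (CommRingCat.of R)) :
    u y ∈ zeroSet K s ↔ ∀ f ∈ s, φ f ∈ y.asIdeal := by
  have key : ∀ f ∈ s, f ∈ (u y).asHomogeneousIdeal ↔ φ f ∈ y.asIdeal := by
    intro f hf
    obtain ⟨d, hd, hfd⟩ := hs f hf
    obtain ⟨hφ, rfl⟩ := h.exists_eq_fromOfGlobalSections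
    have := Proj.fromOfGlobalSections_preimage_basicOpen (matrixGrading K)
      ((Scheme.ΓSpecIso (CommRingCat.of R)).inv.hom.comp φ) hφ hd hfd
    have h' : y ∈ _ ↔ y ∈ _ := iff_of_eq (congrArg (y ∈ ·) this)
    rw [← not_iff_not]
    refine h'.trans ?_
    rw [RingHom.comp_apply, basicOpen_eq_of_affine]
    exact PrimeSpectrum.mem_basicOpen _ _
  exact ⟨fun hy f hf => (key f hf).1 (hy hf), fun hy f hf => (key f hf).2 (hy f hf)⟩

end IsPt

lemma rightMul_comp_rightMul (g h : GL (Fin 3) K) :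
    rightMul g ≫ rightMul h = rightMul (g * h) := by
  refine (Proj.map_comp _ _ (rightMulGraded_irrelevant h) (rightMulGraded_irrelevant g)).symm.trans ?_
  have : (rightMulGraded (g : Matrix (Fin 3) (Fin 3) K)).comp (rightMulGraded h) =
      rightMulGraded ((g * h : GL (Fin 3) K) : Matrix (Fin 3) (Fin 3) K) := by
    refine DFunLike.ext _ _ fun a => ?_
    rw [Units.val_mul]
    exact AlgHom.congr_fun (rightMulAlgHom_comp (K := K) g h) a
  simp only [rightMul, this]

lemma rightMul_one : rightMul (1 : GL (Fin 3) K) = 𝟙 (P8 K) := by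
  refine Eq.trans ?_ (Proj.map_id (𝒜 := matrixGrading K))
  have : rightMulGraded ((1 : GL (Fin 3) K) : Matrix (Fin 3) (Fin 3) K) =
      GradedRingHom.id (matrixGrading K) := by
    refine DFunLike.ext _ _ fun a => ?_
    rw [Units.val_one]
    exact AlgHom.congr_fun (rightMulAlgHom_one (K := K)) a
  simp only [rightMul, this]

instance isIso_rightMul (g : GL (Fin 3) K) : IsIso (rightMul g) :=
  ⟨rightMul g⁻¹, by rw [rightMul_comp_rightMul, mul_inv_cancel, rightMul_one],
    by rw [rightMul_comp_rightMul, inv_mul_cancel, rightMul_one]⟩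

/-- The affine charts of `ℙ⁸`. -/
lemma isOpenImmersion_of_coordinates {σ : Type} (φ : MatrixCoordRing K →ₐ[K] MvPolynomial σ K)
    {k : Fin 3} (hk : φ (X (0, k)) = 1) (q : σ → Fin 3 × Fin 3) (hq : ∀ i, φ (X (q i)) = X i)
    (hq' : ∀ p, p ≠ (0, k) → ∃ i, q i = p)
    {u : Spec (CommRingCat.of (MvPolynomial σ K)) ⟶ P8 K} (hu : IsPt φ.toRingHom u) :
    IsOpenImmersion u ∧ ∀ x : P8 K, X (0, k) ∉ x.asHomogeneousIdeal → x ∈ Set.range u := by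
  have h1 : IsUnit (φ.toRingHom (X (0, k))) := by
    change IsUnit (φ (X (0, k)))
    rw [hk]; exact isUnit_one
  rw [hu.eq_awayι h1 one_pos (X_mem_matrixGrading _)]
  have hinj : Function.Injective (awayLift φ.toRingHom h1) := by
    rw [injective_iff_map_eq_zero]
    intro x hx
    obtain ⟨n, a, ha, rfl⟩ := x.mk_surjective _ (X_mem_matrixGrading _)
    have h := awayLift_mk φ.toRingHom h1 (X_mem_matrixGrading _) n a ha
    rw [hx, zero_mul] at h
    let A := Localization.Away (X (0, k) : MatrixCoordRing K)
    -- Sends each affine coordinate to the corresponding quotient by `X (0, k)`. A form of degree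
    -- `d` is then `X (0, k) ^ d` times the image of its dehomogenization, so a form with zero
    -- dehomogenization vanishes.
    let ρ : MvPolynomial σ K →+* A := eval₂Hom ((algebraMap (MatrixCoordRing K) A).comp C)
      fun i => IsLocalization.mk' A (X (q i) : MatrixCoordRing K) (⟨X (0, k), 1, pow_one _⟩ : Submonoid.powers (X (0, k) : MatrixCoordRing K))
    have h0 : ∀ p, algebraMap (MatrixCoordRing K) A (X p) =
        algebraMap (MatrixCoordRing K) A (X (0, k)) * (ρ.comp φ.toRingHom) (X p) := by
      intro p
      by_cases hp : p = (0, k)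
      · subst hp
        change _ = _ * ρ (φ _)
        rw [hk, map_one, mul_one]
      · obtain ⟨i, rfl⟩ := hq' p hp
        change _ = _ * ρ (φ _)
        rw [hq]
        simp only [ρ, coe_eval₂Hom, eval₂_X]
        exact (IsLocalization.mk'_spec' A (X (q i)) (⟨X (0, k), 1, pow_one _⟩ : Submonoid.powers (X (0, k) : MatrixCoordRing K))).symm
    have h2 := map_eq_pow_mul_of_homogeneous (φ := ρ.comp φ.toRingHom)
      (φ' := algebraMap (MatrixCoordRing K) A) (c := algebraMap (MatrixCoordRing K) A (X (0, k)))
      (fun a => by simp [ρ]) h0 ha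
    rw [RingHom.comp_apply, ← h, map_zero, mul_zero, ← map_zero (algebraMap (MatrixCoordRing K) A)] at h2
    have h3 : a = 0 := IsLocalization.injective A (M := .powers (X (0, k) : MatrixCoordRing K))
      (powers_le_nonZeroDivisors_of_noZeroDivisors (X_ne_zero _)) h2
    subst h3
    apply HomogeneousLocalization.val_injective
    rw [Away.val_mk, Localization.mk_zero, HomogeneousLocalization.val_zero]
  have hsurj : Function.Surjective (awayLift φ.toRingHom h1) := by
    intro f
    induction f using MvPolynomial.induction_on with
    | C a =>
      refine ⟨Away.mk (matrixGrading K) (X_mem_matrixGrading _) 0 (C a) ?_, ?_⟩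
      · exact isHomogeneous_C _ a
      · have := awayLift_mk φ.toRingHom h1 (X_mem_matrixGrading _) 0 (C a) (isHomogeneous_C _ a)
        rw [pow_zero, mul_one] at this
        rw [this]
        exact φ.commutes a
    | add f g hf hg =>
      obtain ⟨a, rfl⟩ := hf
      obtain ⟨b, rfl⟩ := hg
      exact ⟨a + b, map_add _ _ _⟩
    | mul_X f i hf =>
      obtain ⟨a, rfl⟩ := hf
      refine ⟨a * Away.mk (matrixGrading K) (X_mem_matrixGrading _) 1 (X (q i))
        (X_mem_matrixGrading _), ?_⟩
      have := awayLift_mk φ.toRingHom h1 (X_mem_matrixGrading _) 1 (X (q i)) (X_mem_matrixGrading _)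
      rw [pow_one] at this
      rw [map_mul]
      congr 1
      refine Eq.trans (Eq.trans ?_ this) (hq i)
      change _ = _ * φ _
      rw [hk, mul_one]
  have hiso : IsIso (CommRingCat.ofHom (awayLift φ.toRingHom h1)) :=
    (ConcreteCategory.isIso_iff_bijective _).2 ⟨hinj, hsurj⟩
  refine ⟨inferInstance, fun x hx => ?_⟩
  have hx' : x ∈ (Proj.awayι (matrixGrading K) (X (0, k)) (X_mem_matrixGrading _)
    one_pos).opensRange := by
    rw [Proj.opensRange_awayι]; exact hx
  obtain ⟨y, rfl⟩ := hx'
  obtain ⟨z, rfl⟩ := (Spec.map (CommRingCat.ofHom (awayLift φ.toRingHom h1))).surjective y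
  exact ⟨z, rfl⟩

end Points

end

/-! ### Morphisms from spectra of domains, and lifts of automorphisms -/

section

open AlgebraicGeometry.Scheme.IdealSheafData

/-- The generic point of the spectrum of a domain. -/
def genPt (R : CommRingCat.{u}) [IsDomain R] : Spec R := ⟨⊥, Ideal.isPrime_bot⟩

lemma genPt_specializes {R : CommRingCat.{u}} [IsDomain R] (y : Spec R) : genPt R ⤳ y :=
  (PrimeSpectrum.le_iff_specializes (R := R) (genPt R) y).1 (bot_le : (⊥ : Ideal R) ≤ y.asIdeal)

lemma isDomain_of_isOpenImmersion {R A : CommRingCat.{u}} [IsDomain R] (l : Spec A ⟶ Spec R)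
    [IsOpenImmersion l] [Nonempty (Spec A)] : IsDomain A := by
  have := (affine_isIntegral_iff R).2 inferInstance
  have := isIntegral_of_isOpenImmersion l
  exact (affine_isIntegral_iff A).1 this

lemma map_genPt {R A : CommRingCat.{u}} [IsDomain R] [IsDomain A] (l : Spec A ⟶ Spec R)
    [IsOpenImmersion l] : l (genPt A) = genPt R := by
  have h : genPt R ∈ l.opensRange :=
    (genPt_specializes (l (genPt A))).mem_open l.opensRange.2 ⟨_, rfl⟩
  obtain ⟨z, hz⟩ := h
  have h2 : l (genPt A) ⤳ genPt R := hz ▸ (genPt_specializes z).map l.continuous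
  exact (h2.antisymm (genPt_specializes _)).eq

/-- `π : V ⟶ X` has domains as charts, whose generic points lie off `B`, and morphisms to `V` from
such schemes are determined by their composition with `π`. -/
structure IsTame {V X : Scheme.{u}} (π : V ⟶ X) (B : Closeds X) : Prop where
  exists_chart : ∀ x : V, ∃ (R : CommRingCat.{u}) (_ : IsDomain R) (j : Spec R ⟶ V),
    IsOpenImmersion j ∧ x ∈ Set.range j ∧ π (j (genPt R)) ∉ B
  hom_ext : ∀ (R : CommRingCat.{u}) [IsDomain R] (f₁ f₂ : Spec R ⟶ V), f₁ ≫ π = f₂ ≫ π →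
    π (f₁ (genPt R)) ∉ B → f₁ = f₂

variable {V V' X : Scheme.{u}} {π : V ⟶ X} {β : V' ⟶ V} {Z : Closeds V} {B : Closeds X}

lemma hom_ext_of_locally {W : Scheme.{u}} {f₁ f₂ : V ⟶ W}
    (h : ∀ x : V, ∃ (T : Scheme.{u}) (j : T ⟶ V), IsOpenImmersion j ∧ x ∈ Set.range j ∧
      j ≫ f₁ = j ≫ f₂) : f₁ = f₂ := by
  choose T j hj hx h using h
  exact (Scheme.Cover.mkOfCovers V T j (fun x => ⟨x, hx x⟩) hj : V.OpenCover).hom_ext _ _ h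

lemma IsTame.lift_unique (h : IsTame π B) {g : X ⟶ X} (hg : ∀ p, g p ∈ B → p ∈ B)
    {τ₁ τ₂ : V ⟶ V} (h₁ : τ₁ ≫ π = π ≫ g) (h₂ : τ₂ ≫ π = π ≫ g) : τ₁ = τ₂ := by
  refine hom_ext_of_locally fun x => ?_
  obtain ⟨R, hR, j, hj, hx, hB⟩ := h.exists_chart x
  refine ⟨_, j, hj, hx, h.hom_ext R _ _ ?_ ?_⟩
  · rw [Category.assoc, h₁, Category.assoc, h₂]
  · rw [← Scheme.Hom.comp_apply, Category.assoc, h₁]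
    exact fun h' => hB (hg _ h')

/-- A local generator pulls back to a function that does not vanish at the generic point; in a
domain, nonzero means nonzerodivisor. -/
lemma IsInvertibleIdealSheaf.comap_of_domain {J : V.IdealSheafData} (hJ : IsInvertibleIdealSheaf J)
    {R : CommRingCat.{u}} [IsDomain R] (f : Spec R ⟶ V) (hf : f (genPt R) ∉ J.support) :
    IsInvertibleIdealSheaf (J.comap f) := by
  rw [isInvertibleIdealSheaf_iff] at hJ ⊢
  intro t
  obtain ⟨A, k, hk, hx, a, ha, hak⟩ := hJ (f t)
  obtain ⟨A', l, θ, hl, htl, -, hlf⟩ := exists_affine_lift f k t hx ⊤ trivial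
  have : Nonempty (Spec A') := ⟨htl.choose⟩
  have := isDomain_of_isOpenImmersion l
  refine ⟨A', l, hl, htl, θ.hom a, ?_, ?_⟩
  · apply mem_nonZeroDivisors_of_ne_zero
    intro h0
    refine hf ?_
    rw [← map_genPt l, ← Scheme.Hom.comp_apply, ← le_pullIdeal_iff, hlf, pullIdeal_map, hak,
      Ideal.map_span, Set.image_singleton, h0]
    simp
  · rw [pullIdeal_comap, hlf, pullIdeal_map, hak, Ideal.map_span, Set.image_singleton]

/-- Two morphisms that agree in `X` agree in `V` by tameness. The ideal of `Z` pulls back to an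
invertible one because the generic point lies off `B`, hence off `Z`, so the universal property
makes the lifts equal. Charts away from `Z` are inherited; those over `Z` are supplied by `hc`. -/
lemma IsTame.blowup (h : IsTame π B) (hβ : IsBlowup β Z) (hZ : ∀ x ∈ Z, π x ∈ B)
    (hc : ∀ x' : V', β x' ∈ Z → ∃ (R : CommRingCat.{u}) (_ : IsDomain R) (j : Spec R ⟶ V'),
      IsOpenImmersion j ∧ x' ∈ Set.range j ∧ π (β (j (genPt R))) ∉ B) :
    IsTame (β ≫ π) B where
  exists_chart x' := by
    by_cases hx : β x' ∈ Z
    · exact hc x' hx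
    · obtain ⟨R, hR, j, hj, ⟨t, ht⟩, hB⟩ := h.exists_chart (β x')
      -- Shrinks the chart until it avoids `Z`. An open subscheme of an integral one has the same
      -- generic point, so the condition on `B` persists.
      obtain ⟨A, l, θ, hl, htl, hlO, -⟩ := exists_affine_lift (𝟙 (Spec R)) (𝟙 (Spec R)) t ⟨t, rfl⟩
        (j ⁻¹ᵁ ⟨(Z : Set V)ᶜ, Z.2.isOpen_compl⟩) (by change j t ∉ Z; rwa [ht])
      have : Nonempty (Spec A) := ⟨htl.choose⟩
      have := isDomain_of_isOpenImmersion l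
      have hav : ∀ y, (l ≫ j) y ∉ Z := fun y => hlO ⟨y, rfl⟩
      obtain ⟨j', hj', hio, hr⟩ := hβ.exists_isOpenImmersion_of_notMem (l ≫ j) hav
      refine ⟨A, this, j', hio, ?_, ?_⟩
      · rw [hr]
        obtain ⟨z, rfl⟩ := htl
        exact ⟨z, ht⟩
      · rw [← Scheme.Hom.comp_apply, ← Category.assoc, hj']
        rwa [Category.assoc, Scheme.Hom.comp_apply, map_genPt]
  hom_ext R _ f₁ f₂ hf hB := by
    have e : f₁ ≫ β = f₂ ≫ β := h.hom_ext R _ _ (by simpa using hf) hB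
    have hinv : IsInvertibleIdealSheaf ((vanishingIdeal Z).comap (f₁ ≫ β)) := by
      rw [Scheme.IdealSheafData.comap_comp]
      refine hβ.invertible.comap_of_domain f₁ fun hs => hB (hZ _ ?_)
      rw [support_comap] at hs
      have hs' : β (f₁ (genPt R)) ∈ ((vanishingIdeal Z).support : Set V) := hs
      rwa [coe_support_vanishingIdeal] at hs'
    exact (hβ.existsUnique_lift _ _ hinv).unique rfl e.symm

lemma ext_of_pullIdeal {I J : V.IdealSheafData}
    (h : ∀ (R : CommRingCat.{u}) (j : Spec R ⟶ V), IsOpenImmersion j →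
      I.pullIdeal j = J.pullIdeal j) : I = J := by
  refine Scheme.IdealSheafData.ext (funext fun U => ?_)
  have hU : IsAffineOpen U.1 := U.2
  obtain ⟨e, he⟩ := exists_pullIdeal_eq hU.fromSpec U (by
    rw [Scheme.Hom.image_top_eq_opensRange, hU.opensRange_fromSpec])
  have h1 := h _ hU.fromSpec inferInstance
  rw [he, he] at h1
  have h2 := congrArg (Ideal.map e.inv.hom) h1
  simpa only [Ideal.map_map, ← CommRingCat.hom_comp, Iso.hom_inv_id, CommRingCat.hom_id,
    Ideal.map_id] using h2

lemma comap_vanishingIdeal_of_isIso (τ : V ⟶ V) [IsIso τ] (hτ : ∀ x, τ x ∈ Z ↔ x ∈ Z) :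
    (vanishingIdeal Z).comap τ = vanishingIdeal Z := by
  refine ext_of_pullIdeal fun R j _ => ?_
  ext r
  rw [pullIdeal_comap, mem_pullIdeal_vanishingIdeal, mem_pullIdeal_vanishingIdeal]
  simp only [Scheme.Hom.comp_apply, hτ]

/-- Automorphisms that preserve the center of a blow-up lift. -/
lemma IsBlowup.exists_lift_iso (hβ : IsBlowup β Z) (τ : V ⟶ V) [IsIso τ]
    (hτ : ∀ x, τ x ∈ Z ↔ x ∈ Z) : ∃ τ' : V' ⟶ V', IsIso τ' ∧ τ' ≫ β = β ≫ τ := by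
  have key : ∀ (τ : V ⟶ V) [IsIso τ], (∀ x, τ x ∈ Z ↔ x ∈ Z) →
      ∃ τ' : V' ⟶ V', τ' ≫ β = β ≫ τ := by
    intro τ _ hτ
    refine (hβ.existsUnique_lift _ (β ≫ τ) ?_).exists
    rw [Scheme.IdealSheafData.comap_comp, comap_vanishingIdeal_of_isIso τ hτ]
    exact hβ.invertible
  obtain ⟨τ', h₁⟩ := key τ hτ
  obtain ⟨σ', h₂⟩ := key (inv τ) fun x => by
    rw [← hτ, ← Scheme.Hom.comp_apply, IsIso.inv_hom_id]; rfl
  have hid : ∀ f : V' ⟶ V', f ≫ β = β → f = 𝟙 V' := fun f hf =>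
    (hβ.existsUnique_lift _ β hβ.invertible).unique hf (Category.id_comp _)
  refine ⟨τ', ⟨σ', hid _ ?_, hid _ ?_⟩, h₁⟩
  · rw [Category.assoc, h₂, ← Category.assoc, h₁, Category.assoc, IsIso.hom_inv_id, Category.comp_id]
  · rw [Category.assoc, h₁, ← Category.assoc, h₂, Category.assoc, IsIso.inv_hom_id, Category.comp_id]

lemma mem_properTransform_iff_of_isIso {W : Closeds V} {τ : V ⟶ V} {τ' : V' ⟶ V'} [IsIso τ']
    (h : τ' ≫ β = β ≫ τ) (hZ : ∀ x, τ x ∈ Z ↔ x ∈ Z) (hW : ∀ x, τ x ∈ W ↔ x ∈ W) (x' : V') :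
    τ' x' ∈ properTransform β Z W ↔ x' ∈ properTransform β Z W := by
  have h1 := τ'.isOpenEmbedding.isOpenMap.preimage_closure_eq_closure_preimage τ'.continuous
    (β ⁻¹' ((W : Set V) \ Z))
  have h2 : τ' ⁻¹' (β ⁻¹' ((W : Set V) \ Z)) = β ⁻¹' ((W : Set V) \ Z) := by
    ext y
    have : β (τ' y) = τ (β y) := by rw [← Scheme.Hom.comp_apply, h]; rfl
    simp only [Set.mem_preimage, this]
    exact and_congr (hW _) (not_congr (hZ _))
  rw [h2] at h1
  exact Set.ext_iff.mp h1 x'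

lemma IsBlowup.mem_properTransform_iff (x' : V') (hx : β x' ∉ Z) (W : Closeds V) :
    x' ∈ properTransform β Z W ↔ β x' ∈ W := by
  refine ⟨fun h => ?_, fun h => subset_closure ⟨h, hx⟩⟩
  have : (properTransform β Z W : Set V') ⊆ β ⁻¹' W :=
    closure_minimal (fun y hy => hy.1) (W.2.preimage β.continuous)
  exact this h

lemma properTransform_comp_le (W : Closeds X) (x' : V')
    (h : x' ∈ properTransform (β ≫ π) B W) : β x' ∈ properTransform π B W :=
  β.continuous.closure_preimage_subset (π ⁻¹' ((W : Set X) \ B)) h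

/-- Over the complement of `Z` the map `β` is an isomorphism, and closures can be computed on open
subsets. -/
lemma IsBlowup.mem_properTransform_comp (hβ : IsBlowup β Z) (x' : V') (hx : β x' ∉ Z)
    (W : Closeds X) (h : β x' ∈ properTransform π B W) :
    x' ∈ properTransform (β ≫ π) B W := by
  let O : V.Opens := ⟨(Z : Set V)ᶜ, Z.2.isOpen_compl⟩
  obtain ⟨j', hj', hio, hr⟩ := hβ.exists_isOpenImmersion_of_notMem O.ι fun y => y.2
  obtain ⟨y, rfl⟩ : x' ∈ Set.range j' := by
    rw [hr]; exact ⟨⟨β x', hx⟩, rfl⟩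
  have h1 := j'.isOpenEmbedding.isOpenMap.preimage_closure_eq_closure_preimage j'.continuous
    ((β ≫ π) ⁻¹' ((W : Set X) \ B))
  have h2 := O.ι.isOpenEmbedding.isOpenMap.preimage_closure_eq_closure_preimage O.ι.continuous
    (π ⁻¹' ((W : Set X) \ B))
  have h3 : O.ι y ∈ closure (π ⁻¹' ((W : Set X) \ B)) := by
    rw [← hj']; exact h
  have h4 : y ∈ O.ι ⁻¹' closure (π ⁻¹' ((W : Set X) \ B)) := h3
  rw [h2] at h4
  have h5 : y ∈ j' ⁻¹' closure ((β ≫ π) ⁻¹' ((W : Set X) \ B)) := by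
    rw [h1]
    rw [← hj'] at h4
    exact h4
  exact h5

end

/-! ### The action of `GL(3)` and the coordinate-free properties of a stage -/

section

variable {K : Type u} [Field K]

lemma rightMul_mem_rowZero_of_mem (g : GL (Fin 3) K) (i : Fin 3) (x : P8 K)
    (hx : x ∈ rowZero K i) : rightMul g x ∈ rowZero K i := by
  rintro _ ⟨k, rfl⟩
  change rightMulAlgHom (g : Matrix (Fin 3) (Fin 3) K) (X (i, k)) ∈ x.asHomogeneousIdeal.toIdeal
  rw [rightMulAlgHom, aeval_X]
  exact Ideal.sum_mem _ fun l _ => Ideal.mul_mem_right _ _ (hx ⟨l, rfl⟩)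

lemma rightMul_mem_rowZero (g : GL (Fin 3) K) (i : Fin 3) (x : P8 K) :
    rightMul g x ∈ rowZero K i ↔ x ∈ rowZero K i := by
  refine ⟨fun h => ?_, rightMul_mem_rowZero_of_mem g i x⟩
  have h2 := rightMul_mem_rowZero_of_mem g⁻¹ i _ h
  rwa [← Scheme.Hom.comp_apply, rightMul_comp_rightMul, mul_inv_cancel, rightMul_one] at h2

lemma rightMul_mem_cuspLocus (g : GL (Fin 3) K) (x : P8 K) :
    rightMul g x ∈ cuspLocus K ↔ x ∈ cuspLocus K :=
  and_congr (rightMul_mem_rowZero g 1 x) (rightMul_mem_rowZero g 2 x)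

namespace BlowupStage

/-- The lift of `g` to the stage `c` by an isomorphism which preserves all subsets that are
followed. -/
structure IsGoodLift (c : BlowupStage K) (g : GL (Fin 3) K) (τ : c.V ⟶ c.V) : Prop where
  isIso : IsIso τ
  isLift : c.IsLift g τ
  center : ∀ x, τ x ∈ c.center ↔ x ∈ c.center
  dir : ∀ x, τ x ∈ c.dir ↔ x ∈ c.dir
  exc : ∀ x, τ x ∈ c.exc ↔ x ∈ c.exc
  rest : ∀ x, τ x ∈ c.rest ↔ x ∈ c.rest

/-- The properties of a stage which do not depend on coordinates. -/
structure IsGood (c : BlowupStage K) : Prop where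
  center_le : ∀ x ∈ c.center, c.π x ∈ cuspLocus K
  tame : IsTame c.π (cuspLocus K)
  exists_lift : ∀ g : GL (Fin 3) K, ∃ τ, c.IsGoodLift g τ

variable {c : BlowupStage K}

lemma IsGood.turn (h : c.IsGood) : c.turn.IsGood where
  center_le := h.center_le
  tame := h.tame
  exists_lift g := by
    obtain ⟨τ, hτ⟩ := h.exists_lift g
    exact ⟨τ, hτ.isIso, hτ.isLift, hτ.center, hτ.exc, fun _ => Iff.rfl,
      fun x => or_congr (hτ.rest x) (hτ.dir x)⟩

/-- The lifts preserve the center, so they lift once more by the universal property. The sets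
followed afterwards are inverse images and proper transforms of invariant sets. -/
lemma IsGood.blowup (h : c.IsGood) {V' : Scheme.{u}} {β : V' ⟶ c.V} (hβ : IsBlowup β c.center)
    (hc : ∀ x' : V', β x' ∈ c.center → ∃ (R : CommRingCat.{u}) (_ : IsDomain R) (j : Spec R ⟶ V'),
      IsOpenImmersion j ∧ x' ∈ Set.range j ∧ c.π (β (j (genPt R))) ∉ cuspLocus K) :
    (c.blowup β).IsGood where
  center_le x hx := h.center_le _ hx.1
  tame := h.tame.blowup hβ h.center_le hc
  exists_lift g := by
    obtain ⟨τ, hτ⟩ := h.exists_lift g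
    have := hτ.isIso
    obtain ⟨τ', hiso, hτ'⟩ := hβ.exists_lift_iso τ hτ.center
    have hd : ∀ x' : V', τ' x' ∈ properTransform β c.center c.dir ↔
        x' ∈ properTransform β c.center c.dir :=
      mem_properTransform_iff_of_isIso hτ' hτ.center hτ.dir
    have hr : ∀ x' : V', τ' x' ∈ properTransform β c.center (c.rest ⊔ c.exc) ↔
        x' ∈ properTransform β c.center (c.rest ⊔ c.exc) :=
      mem_properTransform_iff_of_isIso hτ' hτ.center fun x => or_congr (hτ.rest x) (hτ.exc x)
    have he : ∀ x', τ' x' ∈ (c.blowup β).exc ↔ x' ∈ (c.blowup β).exc := by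
      intro x'
      change β (τ' x') ∈ c.center ↔ β x' ∈ c.center
      rw [← Scheme.Hom.comp_apply, hτ', Scheme.Hom.comp_apply, hτ.center]
    refine ⟨τ', hiso, ?_, fun x' => and_congr (he x') (hd x'), hd, he, hr⟩
    change τ' ≫ β ≫ c.π = (β ≫ c.π) ≫ rightMul g
    rw [← Category.assoc, hτ', Category.assoc, Category.assoc]
    exact congrArg (β ≫ ·) hτ.isLift

lemma IsGood.lift_unique (h : c.IsGood) {g : GL (Fin 3) K} {τ₁ τ₂ : c.V ⟶ c.V}
    (h₁ : c.IsLift g τ₁) (h₂ : c.IsLift g τ₂) : τ₁ = τ₂ :=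
  h.tame.lift_unique (fun p => (rightMul_mem_cuspLocus g p).1) h₁ h₂

lemma IsGood.existsUnique_lift (h : c.IsGood) (g : GL (Fin 3) K) :
    ∃! τ : c.V ⟶ c.V, c.IsLift g τ := by
  obtain ⟨τ, hτ⟩ := h.exists_lift g
  exact ⟨τ, hτ.isLift, fun σ hσ => h.lift_unique hσ hτ.isLift⟩

lemma IsGood.isGoodLift (h : c.IsGood) {g : GL (Fin 3) K} {τ : c.V ⟶ c.V} (hτ : c.IsLift g τ) :
    c.IsGoodLift g τ := by
  obtain ⟨σ, hσ⟩ := h.exists_lift g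
  rwa [h.lift_unique hτ hσ.isLift]

lemma IsGoodLift.mem_transform {g : GL (Fin 3) K} {τ : c.V ⟶ c.V} (h : c.IsGoodLift g τ)
    (i : Fin 3) (x : c.V) : τ x ∈ c.transform (rowZero K i) ↔ x ∈ c.transform (rowZero K i) := by
  have := h.isIso
  exact mem_properTransform_iff_of_isIso h.isLift (rightMul_mem_cuspLocus g)
    (rightMul_mem_rowZero g i) x

lemma exists_X_notMem (x : P8 K) : ∃ p, (X p : MatrixCoordRing K) ∉ x.asHomogeneousIdeal := by
  by_contra! h
  refine x.not_irrelevant_le ((HomogeneousIdeal.toIdeal_irrelevant_le _).mpr fun d hd a ha => ?_)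
  have h1 : a ∈ Ideal.span (X '' Set.univ : Set (MatrixCoordRing K)) := by
    rw [mem_ideal_span_X_image]
    intro v hv
    by_contra! hv0
    have hv1 : v = 0 := Finsupp.ext fun p => hv0 p trivial
    have := ha (mem_support_iff.1 hv)
    rw [hv1, map_zero] at this
    exact hd.ne this
  refine (Ideal.span_le.2 ?_) h1
  rintro _ ⟨p, -, rfl⟩
  exact h p

lemma exists_chart_P8 (x : P8 K) : ∃ (R : CommRingCat.{u}) (_ : IsDomain R) (j : Spec R ⟶ P8 K),
    IsOpenImmersion j ∧ x ∈ Set.range j ∧ j (genPt R) ∉ cuspLocus K := by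
  obtain ⟨p, hp⟩ := exists_X_notMem x
  let R := HomogeneousLocalization.Away (matrixGrading K) (X p)
  have hdom : IsDomain R := by
    have : Function.Injective (algebraMap R (Localization.Away (X p : MatrixCoordRing K))) :=
      HomogeneousLocalization.val_injective _
    have := IsLocalization.isDomain_localization
      (powers_le_nonZeroDivisors_of_noZeroDivisors (X_ne_zero (R := K) p))
    exact Function.Injective.isDomain (algebraMap R (Localization.Away (X p : MatrixCoordRing K))) ‹_›
  let j := Proj.awayι (matrixGrading K) (X p) (X_mem_matrixGrading p) one_pos
  refine ⟨CommRingCat.of R, hdom, j, inferInstance, ?_, ?_⟩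
  · have hx' : x ∈ j.opensRange := by
      rw [Proj.opensRange_awayι]; exact hp
    exact hx'
  · intro h
    have h1 : (X (1, 0) : MatrixCoordRing K) ∈ (j (genPt (CommRingCat.of R))).asHomogeneousIdeal :=
      h.1 ⟨0, rfl⟩
    have h2 : genPt (CommRingCat.of R) ∈ j ⁻¹ᵁ Proj.basicOpen (matrixGrading K) (X (1, 0)) := by
      rw [Proj.awayι_preimage_basicOpen (matrixGrading K) (X_mem_matrixGrading p) one_pos
        (X_mem_matrixGrading (1, 0)) one_pos]
      change _ ∉ (⊥ : Ideal R)
      rw [Ideal.mem_bot]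
      intro h0
      have h3 := congrArg HomogeneousLocalization.val h0
      rw [HomogeneousLocalization.Away.val_mk, HomogeneousLocalization.val_zero,
        Localization.mk_eq_mk', IsLocalization.mk'_eq_zero_iff] at h3
      obtain ⟨⟨_, n, rfl⟩, h4⟩ := h3
      exact mul_ne_zero (pow_ne_zero n (X_ne_zero p)) (pow_ne_zero 1 (X_ne_zero _)) h4
    exact h2 h1

lemma isTame_id : IsTame (𝟙 (P8 K)) (cuspLocus K) where
  exists_chart := exists_chart_P8
  hom_ext R _ f₁ f₂ h _ := by rwa [Category.comp_id, Category.comp_id] at h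

lemma isGood_initial : (initial K).IsGood where
  center_le _ hx := hx
  tame := isTame_id
  exists_lift g := ⟨rightMul g, isIso_rightMul g, by simp [IsLift, initial],
    rightMul_mem_cuspLocus g, rightMul_mem_rowZero g 2, fun _ => Iff.rfl, fun _ => Iff.rfl⟩

end BlowupStage

end

/-! ### General vectors, and points missed by a point-condition -/

section

variable {K : Type u} [Field K]

/-- For each `a` the bad vectors form a proper subspace, and a vector space over an infinite field
is not a finite union of proper subspaces. -/
lemma exists_generic_vector [Infinite K] {R : Type u} [CommRing R] (f : K →+* R) (I : Ideal R)
    {κ : Type} [Finite κ] (w : κ → Fin 3 → R) (hw : ∀ a, ∃ k, w a k ∉ I) :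
    ∃ ξ : Fin 3 → K, ∀ a, ∑ k, f (ξ k) * w a k ∉ I := by
  let N : κ → Submodule K (Fin 3 → K) := fun a =>
    { carrier := {ξ | ∑ k, f (ξ k) * w a k ∈ I}
      add_mem' := fun {x y} hx hy => by
        have := I.add_mem hx hy
        simpa [← Finset.sum_add_distrib, ← add_mul] using this
      zero_mem' := by simp
      smul_mem' := fun b x hx => by
        have := I.mul_mem_left (f b) hx
        simpa [Finset.mul_sum, mul_assoc] using this }
  by_contra! h
  obtain ⟨a, ha⟩ := Subspace.exists_eq_top_of_iUnion_eq_univ (p := N)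
    (Set.eq_univ_of_forall fun ξ => Set.mem_iUnion.2 (h ξ))
  obtain ⟨k, hk⟩ := hw a
  have : Pi.single k 1 ∈ N a := ha ▸ Submodule.mem_top
  refine hk ?_
  have h2 : ∑ l, f ((Pi.single k 1 : Fin 3 → K) l) * w a l ∈ I := this
  rwa [Finset.sum_eq_single k (fun l _ hl => by simp [hl]) (by simp), Pi.single_eq_same, map_one,
    one_mul] at h2

lemma rowForm_mem_matrixGrading (i : Fin 3) (ξ : Fin 3 → K) : rowForm i ξ ∈ matrixGrading K 1 :=
  IsHomogeneous.sum _ _ _ fun l _ => by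
    simpa using (isHomogeneous_C _ (ξ l)).mul (isHomogeneous_X K (i, l))

lemma map_rowForm {R : Type u} [CommRing R] (φ : MatrixCoordRing K →+* R) (i : Fin 3)
    (ξ : Fin 3 → K) : φ (rowForm i ξ) = ∑ k, φ (C (ξ k)) * φ (X (i, k)) := by
  simp [rowForm]

lemma pointCondition_mem_matrixGrading {m n : ℕ} (hmn : m ≤ n) (ξ : Fin 3 → K) :
    rowForm 0 ξ ^ (n - m) * rowForm 2 ξ ^ m - rowForm 1 ξ ^ n ∈ matrixGrading K n := by
  have h := fun i => rowForm_mem_matrixGrading i ξ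
  refine Submodule.sub_mem _ ?_ ?_
  · have h1 : rowForm 0 ξ ^ (n - m) * rowForm 2 ξ ^ m ∈ matrixGrading K ((n - m) • 1 + m • 1) :=
      SetLike.mul_mem_graded (SetLike.pow_mem_graded _ (h 0)) (SetLike.pow_mem_graded _ (h 2))
    rwa [smul_eq_mul, smul_eq_mul, mul_one, mul_one, Nat.sub_add_cancel hmn] at h1
  · have h1 := SetLike.pow_mem_graded n (h 1)
    rwa [smul_eq_mul, mul_one] at h1

lemma IsPt.apply_mem_rowZero_iff {R : Type u} [CommRing R] {φ : MatrixCoordRing K →+* R}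
    {u : Spec (CommRingCat.of R) ⟶ P8 K} (h : IsPt φ u) (i : Fin 3)
    (y : Spec (CommRingCat.of R)) : u y ∈ rowZero K i ↔ ∀ k, φ (X (i, k)) ∈ y.asIdeal := by
  rw [rowZero, h.apply_mem_zeroSet_iff
    (by rintro _ ⟨k, rfl⟩; exact ⟨1, one_pos, X_mem_matrixGrading _⟩)]
  exact Set.forall_mem_range

lemma IsPt.apply_mem_cuspLocus_iff {R : Type u} [CommRing R] {φ : MatrixCoordRing K →+* R}
    {u : Spec (CommRingCat.of R) ⟶ P8 K} (h : IsPt φ u)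
    (y : Spec (CommRingCat.of R)) : u y ∈ cuspLocus K ↔
      (∀ k, φ (X (1, k)) ∈ y.asIdeal) ∧ ∀ k, φ (X (2, k)) ∈ y.asIdeal :=
  and_congr (h.apply_mem_rowZero_iff 1 y) (h.apply_mem_rowZero_iff 2 y)

namespace BlowupStage

variable {c : BlowupStage K} {R : Type u} [CommRing R]
  {j : Spec (CommRingCat.of R) ⟶ c.V} {φ : MatrixCoordRing K →+* R}

/-- The set whose closure is the proper transform has no points in the open neighbourhood of `y`
where `g` does not vanish. -/
lemma notMem_transform_of_forall [IsOpenImmersion j]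
    (W : Closeds (P8 K)) (y : Spec (CommRingCat.of R)) (g : R) (hg : g ∉ y.asIdeal)
    (h : ∀ z : Spec (CommRingCat.of R), g ∉ z.asIdeal → c.π (j z) ∈ W → c.π (j z) ∈ cuspLocus K) :
    j y ∉ c.transform W := by
  intro hy
  have h1 := j.isOpenEmbedding.isOpenMap.preimage_closure_eq_closure_preimage j.continuous
    (c.π ⁻¹' ((W : Set (P8 K)) \ cuspLocus K))
  have h2 : y ∈ j ⁻¹' closure (c.π ⁻¹' ((W : Set (P8 K)) \ cuspLocus K)) := hy
  rw [h1] at h2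
  have h3 : closure (j ⁻¹' (c.π ⁻¹' ((W : Set (P8 K)) \ cuspLocus K))) ⊆
      PrimeSpectrum.zeroLocus (R := R) {g} := by
    refine closure_minimal (fun z hz => ?_) (PrimeSpectrum.isClosed_zeroLocus _)
    by_contra hgz
    exact hz.2 (h z (fun hz' => hgz (Set.singleton_subset_iff.2 hz')) hz.1)
  exact hg (h3 h2 rfl)

variable {m n : ℕ} {c₀ c₁ c₂ : Fin 3 → R} {r t α d : R} {y : Spec (CommRingCat.of R)}

/-- Here `t ^ m` divides `r ^ n` up to the factor `α`, so it splits off the equation of the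
point-condition. For general `ξ` the remaining factor is nonzero at `y`, since only its first term
survives there. Near `y` the point-condition thus lies in `t = 0`, where `r` vanishes as well, that
is, over `B`. -/
lemma notMem_baseSet_of_pow_eq [Infinite K] [IsOpenImmersion j] (hφ : IsPt φ (j ≫ c.π))
    (hm : 1 ≤ m) (hmn : m < n)
    (h₀ : ∀ k, φ (X (0, k)) = c₀ k) (h₁ : ∀ k, φ (X (1, k)) = r * c₁ k)
    (h₂ : ∀ k, φ (X (2, k)) = t * c₂ k) (hc₀ : ∃ k, c₀ k ∉ y.asIdeal)
    (hc₂ : ∃ k, c₂ k ∉ y.asIdeal) (hα : α ∉ y.asIdeal) (h : α * r ^ n = t ^ m * d)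
    (hd : d ∈ y.asIdeal ∨ ∀ k, c₁ k ∈ y.asIdeal) : j y ∉ c.baseSet m n := by
  obtain ⟨ξ, hξ⟩ := exists_generic_vector (φ.comp C) y.asIdeal ![c₀, c₂] (by
    intro a; fin_cases a <;> assumption)
  have hξ₀ := hξ 0
  have hξ₂ := hξ 1
  simp only [Matrix.cons_val_zero, Matrix.cons_val_one, RingHom.comp_apply] at hξ₀ hξ₂
  set a₀ := ∑ k, φ (C (ξ k)) * c₀ k with ha₀
  set a₂ := ∑ k, φ (C (ξ k)) * c₂ k with ha₂
  set a₁ := ∑ k, φ (C (ξ k)) * c₁ k with ha₁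
  have ha₁' : d ∈ y.asIdeal ∨ a₁ ∈ y.asIdeal :=
    hd.imp_right fun h => Ideal.sum_mem _ fun k _ => Ideal.mul_mem_left _ _ (h k)
  have hr₀ : φ (rowForm 0 ξ) = a₀ := by simp only [map_rowForm, h₀, ha₀]
  have hr₁ : φ (rowForm 1 ξ) = r * a₁ := by
    simp only [map_rowForm, h₁, ha₁, Finset.mul_sum]
    exact Finset.sum_congr rfl fun k _ => by ring
  have hr₂ : φ (rowForm 2 ξ) = t * a₂ := by
    simp only [map_rowForm, h₂, ha₂, Finset.mul_sum]
    exact Finset.sum_congr rfl fun k _ => by ring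
  have hξ0 : ξ ≠ 0 := by
    rintro rfl
    exact hξ₀ (by simp [ha₀])
  intro hbase
  -- The extra factor `α` keeps `α` invertible on the neighbourhood; multiplied by `α`, the equation
  -- of the point-condition is `t ^ m` times the second factor.
  refine notMem_transform_of_forall (pointCondition m n ξ) y
    (α * (α * a₀ ^ (n - m) * a₂ ^ m - d * a₁ ^ n)) ?_ ?_ (hbase ξ hξ0)
  · have hp := y.isPrime
    intro hmem
    rcases hp.mem_or_mem hmem with h' | h'
    · exact hα h'
    · have h3 : d * a₁ ^ n ∈ y.asIdeal := by
        rcases ha₁' with h4 | h4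
        · exact Ideal.mul_mem_right _ _ h4
        · exact Ideal.mul_mem_left _ _ (Ideal.pow_mem_of_mem _ h4 _ (by lia))
      have h4 : α * a₀ ^ (n - m) * a₂ ^ m ∈ y.asIdeal := by
        simpa using Ideal.add_mem _ h' h3
      rcases hp.mem_or_mem h4 with h5 | h5
      · rcases hp.mem_or_mem h5 with h6 | h6
        · exact hα h6
        · exact hξ₀ (hp.mem_of_pow_mem _ h6)
      · exact hξ₂ (hp.mem_of_pow_mem _ h5)
  · intro z hz hF
    have hp := z.isPrime
    have hF' : (j ≫ c.π) z ∈ pointCondition m n ξ := hF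
    rw [pointCondition, hφ.apply_mem_zeroSet_iff (by
      rintro _ rfl
      exact ⟨n, by lia, pointCondition_mem_matrixGrading hmn.le ξ⟩)] at hF'
    have hF'' := hF' _ rfl
    rw [map_sub, map_mul, map_pow, map_pow, map_pow, hr₀, hr₁, hr₂] at hF''
    have hα' : α ∉ z.asIdeal := fun h' => hz (Ideal.mul_mem_right _ _ h')
    have h5 : t ^ m * (α * a₀ ^ (n - m) * a₂ ^ m - d * a₁ ^ n) ∈ z.asIdeal := by
      have h6 := Ideal.mul_mem_left _ α hF''
      convert h6 using 1
      linear_combination (a₁ ^ n) * h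
    have ht : t ∈ z.asIdeal := by
      rcases hp.mem_or_mem h5 with h6 | h6
      · exact hp.mem_of_pow_mem _ h6
      · exact (hz (Ideal.mul_mem_left _ _ h6)).elim
    have hr : r ∈ z.asIdeal := by
      have h6 : α * r ^ n ∈ z.asIdeal := by
        rw [h]
        exact Ideal.mul_mem_right _ _ (Ideal.pow_mem_of_mem _ ht _ (by lia))
      rcases hp.mem_or_mem h6 with h7 | h7
      · exact (hα' h7).elim
      · exact hp.mem_of_pow_mem _ h7
    refine (hφ.apply_mem_cuspLocus_iff z).2 ⟨fun k => ?_, fun k => ?_⟩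
    · rw [h₁]; exact Ideal.mul_mem_right _ _ hr
    · rw [h₂]; exact Ideal.mul_mem_right _ _ ht

/-- The mirror case: `r ^ n` splits off and the term from the second row survives. Nothing is
required of the first row, since it enters only the vanishing term. -/
lemma notMem_baseSet_of_pow_eq' [Infinite K] [IsOpenImmersion j] (hφ : IsPt φ (j ≫ c.π))
    (hm : 1 ≤ m) (hmn : m < n) (h₁ : ∀ k, φ (X (1, k)) = r * c₁ k)
    (h₂ : ∀ k, φ (X (2, k)) = t * c₂ k) (hc₁ : ∃ k, c₁ k ∉ y.asIdeal)
    (hα : α ∉ y.asIdeal) (h : α * t ^ m = r ^ n * d)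
    (hd : d ∈ y.asIdeal ∨ ∀ k, c₂ k ∈ y.asIdeal) : j y ∉ c.baseSet m n := by
  obtain ⟨ξ, hξ⟩ := exists_generic_vector (φ.comp C) y.asIdeal ![c₁] (by
    intro a; fin_cases a; assumption)
  have hξ₁ := hξ 0
  simp only [Matrix.cons_val_fin_one, RingHom.comp_apply] at hξ₁
  set a₀ := φ (rowForm 0 ξ) with ha₀
  set a₂ := ∑ k, φ (C (ξ k)) * c₂ k with ha₂
  set a₁ := ∑ k, φ (C (ξ k)) * c₁ k with ha₁
  have ha₂' : d ∈ y.asIdeal ∨ a₂ ∈ y.asIdeal :=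
    hd.imp_right fun h => Ideal.sum_mem _ fun k _ => Ideal.mul_mem_left _ _ (h k)
  have hr₁ : φ (rowForm 1 ξ) = r * a₁ := by
    simp only [map_rowForm, h₁, ha₁, Finset.mul_sum]
    exact Finset.sum_congr rfl fun k _ => by ring
  have hr₂ : φ (rowForm 2 ξ) = t * a₂ := by
    simp only [map_rowForm, h₂, ha₂, Finset.mul_sum]
    exact Finset.sum_congr rfl fun k _ => by ring
  have hξ0 : ξ ≠ 0 := by
    rintro rfl
    exact hξ₁ (by simp [ha₁])
  intro hbase
  refine notMem_transform_of_forall (pointCondition m n ξ) y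
    (α * (a₀ ^ (n - m) * d * a₂ ^ m - α * a₁ ^ n)) ?_ ?_ (hbase ξ hξ0)
  · have hp := y.isPrime
    intro hmem
    rcases hp.mem_or_mem hmem with h' | h'
    · exact hα h'
    · have h3 : a₀ ^ (n - m) * d * a₂ ^ m ∈ y.asIdeal := by
        rcases ha₂' with h4 | h4
        · exact Ideal.mul_mem_right _ _ (Ideal.mul_mem_left _ _ h4)
        · exact Ideal.mul_mem_left _ _ (Ideal.pow_mem_of_mem _ h4 _ (by lia))
      have h4 : α * a₁ ^ n ∈ y.asIdeal := by
        simpa using Ideal.sub_mem _ h3 h'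
      rcases hp.mem_or_mem h4 with h5 | h5
      · exact hα h5
      · exact hξ₁ (hp.mem_of_pow_mem _ h5)
  · intro z hz hF
    have hp := z.isPrime
    have hF' : (j ≫ c.π) z ∈ pointCondition m n ξ := hF
    rw [pointCondition, hφ.apply_mem_zeroSet_iff (by
      rintro _ rfl
      exact ⟨n, by lia, pointCondition_mem_matrixGrading hmn.le ξ⟩)] at hF'
    have hF'' := hF' _ rfl
    rw [map_sub, map_mul, map_pow, map_pow, map_pow, hr₁, hr₂] at hF''
    have hα' : α ∉ z.asIdeal := fun h' => hz (Ideal.mul_mem_right _ _ h')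
    have h5 : r ^ n * (a₀ ^ (n - m) * d * a₂ ^ m - α * a₁ ^ n) ∈ z.asIdeal := by
      have h6 := Ideal.mul_mem_left _ α hF''
      convert h6 using 1
      linear_combination (-a₀ ^ (n - m) * a₂ ^ m) * h
    have hr : r ∈ z.asIdeal := by
      rcases hp.mem_or_mem h5 with h6 | h6
      · exact hp.mem_of_pow_mem _ h6
      · exact (hz (Ideal.mul_mem_left _ _ h6)).elim
    have ht : t ∈ z.asIdeal := by
      have h6 : α * t ^ m ∈ z.asIdeal := by
        rw [h]
        exact Ideal.mul_mem_right _ _ (Ideal.pow_mem_of_mem _ hr _ (by lia))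
      rcases hp.mem_or_mem h6 with h7 | h7
      · exact (hα' h7).elim
      · exact hp.mem_of_pow_mem _ h7
    refine (hφ.apply_mem_cuspLocus_iff z).2 ⟨fun k => ?_, fun k => ?_⟩
    · rw [h₁]; exact Ideal.mul_mem_right _ _ hr
    · rw [h₂]; exact Ideal.mul_mem_right _ _ ht

lemma notMem_baseSet_blowup {V' : Scheme.{u}} {β : V' ⟶ c.V} {x' : V'}
    (h : β x' ∉ c.baseSet m n) : x' ∉ (c.blowup β).baseSet m n :=
  fun h' => h fun ξ hξ => properTransform_comp_le _ _ (h' ξ hξ)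

end BlowupStage

end

/-! ### Germs at points and affine-space charts of a stage -/

section

variable {K : Type u} [Field K]

/-- The closed point of the spectrum of a local ring. -/
def closedPt (R : Type u) [CommRing R] [IsLocalRing R] : Spec (CommRingCat.of R) :=
  IsLocalRing.closedPoint R

lemma specializes_closedPt {R : Type u} [CommRing R] [IsLocalRing R]
    (y : Spec (CommRingCat.of R)) : y ⤳ closedPt R :=
  IsLocalRing.specializes_closedPoint (R := R) y

section CoordRing

variable {σ : Type}

/-- The substitution is birational: dividing by `X i` inverts it over the fraction field. -/
lemma blowupHom_injective {S : Set σ} {i : σ} : Function.Injective (blowupHom K S i) := by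
  classical
  let F := FractionRing (MvPolynomial σ K)
  let ρ : MvPolynomial σ K →ₐ[K] F := aeval fun s =>
    if s ∈ S ∧ s ≠ i then algebraMap (MvPolynomial σ K) F (X s) / algebraMap (MvPolynomial σ K) F (X i)
    else algebraMap (MvPolynomial σ K) F (X s)
  have hi : algebraMap (MvPolynomial σ K) F (X i) ≠ 0 := by
    rw [Ne, IsFractionRing.to_map_eq_zero_iff]; exact X_ne_zero i
  have h : ρ.comp (blowupHom K S i) = IsScalarTower.toAlgHom K (MvPolynomial σ K) F := by
    apply MvPolynomial.algHom_ext
    intro s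
    by_cases hs : s ∈ S ∧ s ≠ i
    · rw [AlgHom.comp_apply, blowupHom_X_of_mem hs.1 hs.2, map_mul]
      simp only [ρ, aeval_X, hs, ne_eq, not_false_eq_true, and_self, if_true, not_true,
        and_false, if_false]
      exact div_mul_cancel₀ _ hi
    · have : blowupHom K S i (X s) = X s := by simp [blowupHom, hs]
      rw [AlgHom.comp_apply, this]
      simp only [ρ, aeval_X, hs, if_false]
      rfl
  intro a b hab
  apply IsFractionRing.injective (MvPolynomial σ K) F
  have h1 := AlgHom.congr_fun h a
  have h2 := AlgHom.congr_fun h b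
  rw [AlgHom.comp_apply, hab] at h1
  exact h1.symm.trans h2

end CoordRing

namespace BlowupStage

variable {c : BlowupStage K}

/-- A morphism from the spectrum of a local domain which hits `x` and has the property `P` in
coordinates. -/
def HasGerm (c : BlowupStage K) (x : c.V)
    (P : ∀ (R : Type u) [CommRing R], (MatrixCoordRing K →+* R) → Prop) : Prop :=
  ∃ (R : Type u) (_ : CommRing R) (_ : IsDomain R) (_ : IsLocalRing R)
    (j : Spec (CommRingCat.of R) ⟶ c.V) (φ : MatrixCoordRing K →+* R),
    j (closedPt R) = x ∧ IsPt φ (j ≫ c.π) ∧ P R φ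

lemma HasGerm.imp {x : c.V}
    {P Q : ∀ (R : Type u) [CommRing R], (MatrixCoordRing K →+* R) → Prop} (h : c.HasGerm x P)
    (hPQ : ∀ (R : Type u) [CommRing R] (φ : MatrixCoordRing K →+* R), P R φ → Q R φ) :
    c.HasGerm x Q := by
  obtain ⟨R, i₁, i₂, i₃, j, φ, h₁, h₂, h₃⟩ := h
  exact ⟨R, i₁, i₂, i₃, j, φ, h₁, h₂, hPQ R φ h₃⟩

/-- Every point of a local spectrum specializes to the closed point. If the closed point avoids the
closed center, the whole germ does, and it lifts. -/
lemma HasGerm.blowup {V' : Scheme.{u}} {β : V' ⟶ c.V} (hβ : IsBlowup β c.center) {x' : V'}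
    (hx : β x' ∉ c.center)
    {P : ∀ (R : Type u) [CommRing R], (MatrixCoordRing K →+* R) → Prop}
    (h : c.HasGerm (β x') P) : (c.blowup β).HasGerm x' P := by
  obtain ⟨R, i₁, i₂, i₃, j, φ, h₁, h₂, h₃⟩ := h
  have hav : ∀ y, j y ∉ c.center := fun y hy => hx <| by
    rw [← h₁]
    exact ((specializes_closedPt y).map j.continuous).mem_closed c.center.2 hy
  obtain ⟨j', hj', hx'⟩ := hβ.exists_lift_of_notMem j hav (closedPt R) x' h₁.symm
  refine ⟨R, i₁, i₂, i₃, j', φ, hx', ?_, h₃⟩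
  change IsPt φ (j' ≫ β ≫ c.π)
  rwa [← Category.assoc, hj']

/-- The germ is the localization of the chart at `y`; `hP` keeps the two facts about it that are
used. -/
lemma hasGerm_of_chart {A : Type u} [CommRing A] [IsDomain A]
    {j : Spec (CommRingCat.of A) ⟶ c.V} {φ : MatrixCoordRing K →+* A} (h : IsPt φ (j ≫ c.π))
    (y : Spec (CommRingCat.of A))
    (P : ∀ (R : Type u) [CommRing R], (MatrixCoordRing K →+* R) → Prop)
    (hP : ∀ (R : Type u) [CommRing R] (ψ : A →+* R), Function.Injective ψ →
      (∀ a, IsUnit (ψ a) ↔ a ∉ y.asIdeal) → P R (ψ.comp φ)) : c.HasGerm (j y) P := by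
  have hy : y.asIdeal.IsPrime := y.isPrime
  let R := Localization.AtPrime y.asIdeal
  have hle : y.asIdeal.primeCompl ≤ nonZeroDivisors A :=
    le_nonZeroDivisors_of_noZeroDivisors fun h => h (zero_mem _)
  have hdom : IsDomain R := IsLocalization.isDomain_localization hle
  refine ⟨R, inferInstance, hdom, inferInstance, Spec.map (CommRingCat.ofHom (algebraMap A R)) ≫ j,
    (algebraMap A R).comp φ, ?_, ?_, hP R _ (IsLocalization.injective R hle) fun a => ?_⟩
  · rw [Scheme.Hom.comp_apply]
    congr 1
    exact PrimeSpectrum.ext (IsLocalization.AtPrime.under_maximalIdeal R y.asIdeal)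
  · rw [Category.assoc]
    exact h.comp _
  · exact IsLocalization.AtPrime.isUnit_to_map_iff R y.asIdeal a

/-- The last two rows are divisible by exactly `p ^ v.1`, `p ^ v.2`, and `Z` holds if `p` is not a
unit. -/
def PowerRows (v : ℕ × ℕ) (Z : Prop) (R : Type u) [CommRing R] (φ : MatrixCoordRing K →+* R) :
    Prop :=
  ∃ (p : R) (w₁ w₂ : Fin 3 → R), p ≠ 0 ∧ (¬ IsUnit p → Z) ∧
    (∀ k, φ (X (1, k)) = p ^ v.1 * w₁ k) ∧ (∀ k, φ (X (2, k)) = p ^ v.2 * w₂ k) ∧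
    (∃ k, IsUnit (w₁ k)) ∧ ∃ k, IsUnit (w₂ k)

/-- If `Z` fails, `p` is a unit and is absorbed into the rows, which are then exactly divisible by
every power of 1. So a point off one divisor may be treated as a point off any other. -/
lemma PowerRows.or {v v' : ℕ × ℕ} {Z Z' : Prop} {x : c.V} (h : c.HasGerm x (PowerRows v Z)) :
    Z ∨ c.HasGerm x (PowerRows v' Z') := by
  by_cases hZ : Z
  · exact Or.inl hZ
  · refine Or.inr (h.imp fun R _ φ => ?_)
    rintro ⟨p, w₁, w₂, h₀, hp, h₁, h₂, hw₁, hw₂⟩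
    have hp : IsUnit p := by
      by_contra h'
      exact hZ (hp h')
    have : Nontrivial R := ⟨p, 0, h₀⟩
    refine ⟨1, fun k => p ^ v.1 * w₁ k, fun k => p ^ v.2 * w₂ k, one_ne_zero,
      fun h => (h isUnit_one).elim, fun k => by rw [h₁, one_pow, one_mul],
      fun k => by rw [h₂, one_pow, one_mul], ?_, ?_⟩
    · exact hw₁.imp fun k hk => (hp.pow _).mul hk
    · exact hw₂.imp fun k hk => (hp.pow _).mul hk

lemma PowerRows.mono {v : ℕ × ℕ} {Z Z' : Prop} {x : c.V} (h : c.HasGerm x (PowerRows v Z))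
    (hZ : Z → Z') : c.HasGerm x (PowerRows v Z') := by
  rcases PowerRows.or (v' := v) (Z' := Z') h with h' | h'
  · exact h.imp fun R _ φ ⟨p, w₁, w₂, h₀, hp, h⟩ => ⟨p, w₁, w₂, h₀, fun _ => hZ h', h⟩
  · exact h'

/-- A chart of a stage by an affine space. -/
structure IsCoordChart (c : BlowupStage K) {σ : Type}
    (j : Spec (CommRingCat.of (MvPolynomial σ K)) ⟶ c.V)
    (φ : MatrixCoordRing K →ₐ[K] MvPolynomial σ K) : Prop where
  isOpenImmersion : IsOpenImmersion j
  isPt : IsPt φ.toRingHom (j ≫ c.π)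
  row_zero : ∃ k, φ (X (0, k)) = 1
  row_one : ∃ k, φ (X (1, k)) ≠ 0

section

variable {σ : Type} {j : Spec (CommRingCat.of (MvPolynomial σ K)) ⟶ c.V}
  {φ : MatrixCoordRing K →ₐ[K] MvPolynomial σ K}

lemma IsCoordChart.genPt_notMem (h : c.IsCoordChart j φ) :
    c.π (j (genPt (CommRingCat.of (MvPolynomial σ K)))) ∉ cuspLocus K := by
  intro hc
  rw [← Scheme.Hom.comp_apply, h.isPt.apply_mem_cuspLocus_iff] at hc
  obtain ⟨k, hk⟩ := h.row_one
  exact hk (hc.1 k)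

lemma IsCoordChart.notMem_rowZero (h : c.IsCoordChart j φ)
    (y : Spec (CommRingCat.of (MvPolynomial σ K))) : c.π (j y) ∉ rowZero K 0 := by
  intro hc
  rw [← Scheme.Hom.comp_apply, h.isPt.apply_mem_rowZero_iff] at hc
  obtain ⟨k, hk⟩ := h.row_zero
  have h1 : φ (X (0, k)) ∈ y.asIdeal := hc k
  rw [hk] at h1
  exact y.isPrime.one_notMem h1

lemma IsCoordChart.comp (h : c.IsCoordChart j φ) {V' : Scheme.{u}} {β : V' ⟶ c.V} {S : Set σ}
    {i : σ} {j' : Spec (CommRingCat.of (MvPolynomial σ K)) ⟶ V'} (hj : IsOpenImmersion j')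
    (hj' : j' ≫ β = blowupMap K S i ≫ j) :
    (c.blowup β).IsCoordChart j' ((blowupHom K S i).comp φ) where
  isOpenImmersion := hj
  isPt := by
    change IsPt _ (j' ≫ β ≫ c.π)
    rw [← Category.assoc, hj', Category.assoc]
    exact h.isPt.comp (blowupHom K S i).toRingHom
  row_zero := h.row_zero.imp fun k hk => by rw [AlgHom.comp_apply, hk, map_one]
  row_one := h.row_one.imp fun k hk => by
    rw [AlgHom.comp_apply]
    exact (map_ne_zero_iff _ blowupHom_injective).2 hk

lemma IsCoordChart.exists_blowup (h : c.IsCoordChart j φ) {V' : Scheme.{u}} {β : V' ⟶ c.V}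
    (hβ : IsBlowup β c.center) {S : Set σ} (hZ : ∀ y, j y ∈ c.center ↔ y ∈ coordLocus K S) {i : σ}
    (hi : i ∈ S) : ∃ j' : Spec (CommRingCat.of (MvPolynomial σ K)) ⟶ V',
      j' ≫ β = blowupMap K S i ≫ j ∧
      (c.blowup β).IsCoordChart j' ((blowupHom K S i).comp φ) := by
  have := h.isOpenImmersion
  obtain ⟨j', h₁, h₂⟩ := hβ.exists_coord_chart j hZ hi
  exact ⟨j', h₂, h.comp h₁ h₂⟩

lemma IsCoordChart.exists_blowup_mem (h : c.IsCoordChart j φ) {V' : Scheme.{u}} {β : V' ⟶ c.V}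
    (hβ : IsBlowup β c.center) {S : Set σ} (hZ : ∀ y, j y ∈ c.center ↔ y ∈ coordLocus K S)
    {x' : V'} {y : Spec (CommRingCat.of (MvPolynomial σ K))} (hx' : j y = β x') :
    ∃ i ∈ S, ∃ j' : Spec (CommRingCat.of (MvPolynomial σ K)) ⟶ V', ∃ y',
      j' ≫ β = blowupMap K S i ≫ j ∧ j' y' = x' ∧
      (c.blowup β).IsCoordChart j' ((blowupHom K S i).comp φ) := by
  have := h.isOpenImmersion
  obtain ⟨i, hi, j', h₁, h₂, y', h₃⟩ := hβ.exists_coord_chart_mem j hZ x' ⟨y, hx'⟩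
  exact ⟨i, hi, j', y', h₂, h₃, h.comp h₁ h₂⟩

lemma IsGood.blowup_of_charts (h : c.IsGood) {V' : Scheme.{u}} {β : V' ⟶ c.V}
    (hβ : IsBlowup β c.center)
    (hc : ∀ x ∈ c.center, ∃ (σ : Type) (j : Spec (CommRingCat.of (MvPolynomial σ K)) ⟶ c.V)
      (φ : MatrixCoordRing K →ₐ[K] MvPolynomial σ K) (S : Set σ) (y : _),
      c.IsCoordChart j φ ∧ (∀ y, j y ∈ c.center ↔ y ∈ coordLocus K S) ∧ j y = x) :
    (c.blowup β).IsGood := by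
  refine h.blowup hβ fun x' hx' => ?_
  obtain ⟨σ, j, φ, S, y, h₁, h₂, h₃⟩ := hc _ hx'
  obtain ⟨i, hi, j', y', h₄, h₅, h₆⟩ := h₁.exists_blowup_mem hβ h₂ h₃
  refine ⟨CommRingCat.of (MvPolynomial σ K), inferInstance, j', h₆.isOpenImmersion, ⟨y', h₅⟩, ?_⟩
  exact h₆.genPt_notMem

end

end BlowupStage

end

/-! ### Orders of vanishing and charts with two distinguished coordinates -/

section

variable {K : Type u} [Field K]

/-- The order of vanishing of `x ^ n` minus that of `y ^ m`, where `x` and `y` vanish to the orders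
`v.1` and `v.2`. -/
def orderDefect (m n : ℕ) (v : ℕ × ℕ) : ℤ := n * v.1 - m * v.2

lemma orderDefect_add (m n : ℕ) (v w : ℕ × ℕ) :
    orderDefect m n (v + w) = orderDefect m n v + orderDefect m n w := by
  simp only [orderDefect, Prod.fst_add, Prod.snd_add, Nat.cast_add]
  ring

/-- The second row is exactly divisible by `r`, and the third one by `t`. -/
def HasMonomialRows {A : Type u} [CommRing A] (φ : MatrixCoordRing K →+* A) (r t : A) : Prop :=
  ∃ w₁ w₂ : Fin 3 → A, (∀ k, φ (X (1, k)) = r * w₁ k) ∧ (∀ k, φ (X (2, k)) = t * w₂ k) ∧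
    (∃ k, w₁ k = 1) ∧ ∃ k, w₂ k = 1

lemma HasMonomialRows.map {A A' : Type u} [CommRing A] [CommRing A'] {φ : MatrixCoordRing K →+* A}
    {r t : A} (h : HasMonomialRows φ r t) (ψ : A →+* A') :
    HasMonomialRows (ψ.comp φ) (ψ r) (ψ t) := by
  obtain ⟨w₁, w₂, h₁, h₂, ⟨k₁, hk₁⟩, ⟨k₂, hk₂⟩⟩ := h
  exact ⟨fun k => ψ (w₁ k), fun k => ψ (w₂ k), fun k => by rw [RingHom.comp_apply, h₁, map_mul],
    fun k => by rw [RingHom.comp_apply, h₂, map_mul], ⟨k₁, by simp only [hk₁, map_one]⟩,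
    ⟨k₂, by simp only [hk₂, map_one]⟩⟩

namespace BlowupStage

variable {c : BlowupStage K} {m n : ℕ}

section

variable {σ : Type} {j : Spec (CommRingCat.of (MvPolynomial σ K)) ⟶ c.V}
  {φ : MatrixCoordRing K →ₐ[K] MvPolynomial σ K} {a b : ℕ × ℕ} {e d : σ}
  {y : Spec (CommRingCat.of (MvPolynomial σ K))}

/-- In the local ring at `y` the coordinate `X d` is a unit and moves into the rows, leaving powers
of `X e`. -/
lemma IsCoordChart.hasGerm_of_rows (h : c.IsCoordChart j φ)
    (hr : HasMonomialRows φ.toRingHom (X e ^ a.1 * X d ^ b.1) (X e ^ a.2 * X d ^ b.2))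
    (hd : (X d : MvPolynomial σ K) ∉ y.asIdeal) {Z : Prop}
    (hZ : (X e : MvPolynomial σ K) ∈ y.asIdeal → Z) : c.HasGerm (j y) (PowerRows a Z) := by
  refine hasGerm_of_chart h.isPt y _ fun R _ ψ hψ hu => ?_
  obtain ⟨w₁, w₂, h₁, h₂, ⟨k₁, hk₁⟩, ⟨k₂, hk₂⟩⟩ := hr
  have hud : IsUnit (ψ (X d)) := (hu _).2 hd
  refine ⟨ψ (X e), fun k => ψ (X d) ^ b.1 * ψ (w₁ k), fun k => ψ (X d) ^ b.2 * ψ (w₂ k),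
    (map_ne_zero_iff ψ hψ).2 (X_ne_zero e), fun he => hZ ?_, fun k => ?_, fun k => ?_,
    ⟨k₁, ?_⟩, ⟨k₂, ?_⟩⟩
  · by_contra h'; exact he ((hu _).2 h')
  · rw [RingHom.comp_apply, h₁, map_mul, map_mul, map_pow, map_pow, mul_assoc]
  · rw [RingHom.comp_apply, h₂, map_mul, map_mul, map_pow, map_pow, mul_assoc]
  · simp only [hk₁, map_one, mul_one]; exact hud.pow _
  · simp only [hk₂, map_one, mul_one]; exact hud.pow _

/-- A nonzero defect along `X e = 0` makes one term of the point-condition vanish there to higher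
order than the other. The powers of `X d` do no harm if `X d` is invertible at `y`, or if its defect
does not have the opposite sign, so that one whole monomial divides the other. -/
lemma IsCoordChart.notMem_baseSet_of_rows [Infinite K] (h : c.IsCoordChart j φ) (hm : 1 ≤ m)
    (hmn : m < n)
    (hr : HasMonomialRows φ.toRingHom (X e ^ a.1 * X d ^ b.1) (X e ^ a.2 * X d ^ b.2))
    (he : (X e : MvPolynomial σ K) ∈ y.asIdeal) (ha : orderDefect m n a ≠ 0)
    (hab : (X d : MvPolynomial σ K) ∉ y.asIdeal ∨ 0 ≤ orderDefect m n a * orderDefect m n b) :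
    j y ∉ c.baseSet m n := by
  have := h.isOpenImmersion
  obtain ⟨w₁, w₂, h₁, h₂, ⟨k₁, hk₁⟩, ⟨k₂, hk₂⟩⟩ := hr
  have h1 : ∀ w : MvPolynomial σ K, w = 1 → w ∉ y.asIdeal := by
    rintro _ rfl; exact y.isPrime.one_notMem
  have hpow : ∀ k : ℕ, (X d : MvPolynomial σ K) ∉ y.asIdeal →
      (X d ^ k : MvPolynomial σ K) ∉ y.asIdeal := fun k hd h' => hd (y.isPrime.mem_of_pow_mem _ h')
  have h₀ : ∃ k, φ.toRingHom (X (0, k)) ∉ y.asIdeal := h.row_zero.imp fun k hk => h1 _ hk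
  have hw₁ : ∃ k, w₁ k ∉ y.asIdeal := ⟨k₁, h1 _ hk₁⟩
  have hw₂ : ∃ k, w₂ k ∉ y.asIdeal := ⟨k₂, h1 _ hk₂⟩
  rcases lt_or_gt_of_ne ha with hneg | hpos
  · obtain ⟨k, hk, hk'⟩ : ∃ k, 0 < k ∧ m * a.2 = n * a.1 + k := by
      refine ⟨m * a.2 - n * a.1, ?_, ?_⟩ <;> simp only [orderDefect] at hneg <;> zify at * <;> lia
    have hmem : ∀ l : ℕ, X e ^ k * X d ^ l ∈ y.asIdeal := fun l =>
      Ideal.mul_mem_right _ _ (Ideal.pow_mem_of_mem _ he _ hk)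
    rcases hab with hd | hab
    · refine notMem_baseSet_of_pow_eq' h.isPt hm hmn h₁ h₂ hw₁ (hpow (n * b.1) hd) ?_
        (Or.inl (hmem (m * b.2)))
      rw [mul_pow, mul_pow, ← pow_mul, ← pow_mul, ← pow_mul, ← pow_mul, mul_comm a.2, mul_comm a.1,
        hk', pow_add]
      ring
    · obtain ⟨l, hl⟩ : ∃ l, m * b.2 = n * b.1 + l := by
        have : orderDefect m n b ≤ 0 := by by_contra! h'; nlinarith
        refine ⟨m * b.2 - n * b.1, ?_⟩
        simp only [orderDefect] at this; zify at *; lia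
      refine notMem_baseSet_of_pow_eq' (α := 1) h.isPt hm hmn h₁ h₂ hw₁ (h1 _ rfl) ?_
        (Or.inl (hmem l))
      rw [mul_pow, mul_pow, ← pow_mul, ← pow_mul, ← pow_mul, ← pow_mul, mul_comm a.2, mul_comm a.1,
        mul_comm b.2, hk', hl, pow_add, pow_add]
      ring
  · obtain ⟨k, hk, hk'⟩ : ∃ k, 0 < k ∧ n * a.1 = m * a.2 + k := by
      refine ⟨n * a.1 - m * a.2, ?_, ?_⟩ <;> simp only [orderDefect] at hpos <;> zify at * <;> lia
    have hmem : ∀ l : ℕ, X e ^ k * X d ^ l ∈ y.asIdeal := fun l =>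
      Ideal.mul_mem_right _ _ (Ideal.pow_mem_of_mem _ he _ hk)
    rcases hab with hd | hab
    · refine notMem_baseSet_of_pow_eq h.isPt hm hmn (fun _ => rfl) h₁ h₂ h₀ hw₂
        (hpow (m * b.2) hd) ?_ (Or.inl (hmem (n * b.1)))
      rw [mul_pow, mul_pow, ← pow_mul, ← pow_mul, ← pow_mul, ← pow_mul, mul_comm a.2, mul_comm a.1,
        hk', pow_add]
      ring
    · obtain ⟨l, hl⟩ : ∃ l, n * b.1 = m * b.2 + l := by
        have : 0 ≤ orderDefect m n b := by by_contra! h'; nlinarith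
        refine ⟨n * b.1 - m * b.2, ?_⟩
        simp only [orderDefect] at this; zify at *; lia
      refine notMem_baseSet_of_pow_eq (α := 1) h.isPt hm hmn (fun _ => rfl) h₁ h₂ h₀ hw₂ (h1 _ rfl)
        ?_ (Or.inl (hmem l))
      rw [mul_pow, mul_pow, ← pow_mul, ← pow_mul, ← pow_mul, ← pow_mul, mul_comm a.2, mul_comm a.1,
        mul_comm b.1, hk', hl, pow_add, pow_add]
      ring

/-- Where the second row vanishes so does `r`, hence `t` and the third row. Such points lie over `B`
and contribute nothing to the proper transform. -/
lemma IsCoordChart.notMem_transform_rowZero_one (h : c.IsCoordChart j φ)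
    (hr : ∃ r t : MvPolynomial σ K, (∃ k, φ (X (1, k)) = r) ∧
      (∀ k, r ∣ φ (X (1, k))) ∧ (∀ k, t ∣ φ (X (2, k))) ∧
      ∀ I : Ideal (MvPolynomial σ K), I.IsPrime → r ∈ I → t ∈ I)
    (y : Spec (CommRingCat.of (MvPolynomial σ K))) :
    j y ∉ c.transform (rowZero K 1) := by
  have := h.isOpenImmersion
  obtain ⟨r, t, ⟨k, hk⟩, h₁, h₂, hrt⟩ := hr
  refine notMem_transform_of_forall _ y 1 y.isPrime.one_notMem fun z _ hz => ?_
  rw [← Scheme.Hom.comp_apply, h.isPt.apply_mem_rowZero_iff] at hz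
  rw [← Scheme.Hom.comp_apply, h.isPt.apply_mem_cuspLocus_iff]
  refine ⟨hz, fun l => Ideal.mem_of_dvd _ (h₂ l) (hrt _ z.isPrime ?_)⟩
  rw [← hk]
  exact hz k

lemma IsCoordChart.notMem_transform_rowZero_one_of_rows (h : c.IsCoordChart j φ)
    (hr : HasMonomialRows φ.toRingHom (X e ^ a.1 * X d ^ b.1) (X e ^ a.2 * X d ^ b.2))
    (ha : 0 < a.2) (hb : 0 < b.2) (y : Spec (CommRingCat.of (MvPolynomial σ K))) :
    j y ∉ c.transform (rowZero K 1) := by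
  obtain ⟨w₁, w₂, h₁, h₂, ⟨k₁, hk₁⟩, ⟨k₂, hk₂⟩⟩ := hr
  refine h.notMem_transform_rowZero_one ⟨_, _, ⟨k₁, (h₁ k₁).trans (by rw [hk₁, mul_one])⟩,
    fun k => ⟨_, h₁ k⟩, fun k => ⟨_, h₂ k⟩, fun I hI hmem => ?_⟩ y
  rcases hI.mem_or_mem hmem with h' | h'
  · exact Ideal.mul_mem_right _ _ (Ideal.pow_mem_of_mem _ (hI.mem_of_pow_mem _ h') _ ha)
  · exact Ideal.mul_mem_left _ _ (Ideal.pow_mem_of_mem _ (hI.mem_of_pow_mem _ h') _ hb)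

end

/-- A chart in which the last exceptional divisor has the equation `X e` and the direction the
equation `X d`. -/
structure IsPostChart (c : BlowupStage K) {σ : Type}
    (j : Spec (CommRingCat.of (MvPolynomial σ K)) ⟶ c.V)
    (φ : MatrixCoordRing K →ₐ[K] MvPolynomial σ K) (E D : ℕ × ℕ) (e d : σ) : Prop
    extends c.IsCoordChart j φ where
  ne : e ≠ d
  rows : HasMonomialRows φ.toRingHom (X e ^ E.1 * X d ^ D.1) (X e ^ E.2 * X d ^ D.2)
  center : ∀ y, j y ∈ c.center ↔ y ∈ coordLocus K {e, d}
  dir : ∀ y, j y ∈ c.dir ↔ y ∈ coordLocus K {d}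
  exc : ∀ y, j y ∈ c.exc ↔ y ∈ coordLocus K {e}
  rest : ∀ y, j y ∉ c.rest

/-- As `IsPostChart`, but with the equation `X e` for all other exceptional divisors together. -/
structure IsPreChart (c : BlowupStage K) {σ : Type}
    (j : Spec (CommRingCat.of (MvPolynomial σ K)) ⟶ c.V)
    (φ : MatrixCoordRing K →ₐ[K] MvPolynomial σ K) (E D : ℕ × ℕ) (e d : σ) : Prop
    extends c.IsCoordChart j φ where
  ne : e ≠ d
  rows : HasMonomialRows φ.toRingHom (X e ^ E.1 * X d ^ D.1) (X e ^ E.2 * X d ^ D.2)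
  center : ∀ y, j y ∈ c.center ↔ y ∈ coordLocus K {e, d}
  dir : ∀ y, j y ∈ c.dir ↔ y ∈ coordLocus K {d}
  rest_sup_exc : ∀ y, j y ∈ c.rest ⊔ c.exc ↔ y ∈ coordLocus K {e}

/-- A chart which the direction and the next center do not meet. -/
structure IsDeadChart (c : BlowupStage K) {σ : Type}
    (j : Spec (CommRingCat.of (MvPolynomial σ K)) ⟶ c.V)
    (φ : MatrixCoordRing K →ₐ[K] MvPolynomial σ K) (F E : ℕ × ℕ) (p e : σ) : Prop
    extends c.IsCoordChart j φ where
  rows : HasMonomialRows φ.toRingHom (X p ^ F.1 * X e ^ E.1) (X p ^ F.2 * X e ^ E.2)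
  center : ∀ y, j y ∉ c.center
  dir : ∀ y, j y ∉ c.dir
  exc : ∀ y, j y ∈ c.exc ↔ y ∈ coordLocus K {e}
  rest : ∀ y, j y ∈ c.rest ↔ y ∈ coordLocus K {p}

section

variable {σ : Type} {j : Spec (CommRingCat.of (MvPolynomial σ K)) ⟶ c.V}
  {φ : MatrixCoordRing K →ₐ[K] MvPolynomial σ K} {E D F : ℕ × ℕ} {e d : σ}

lemma IsPostChart.isPreChart (h : c.IsPostChart j φ E D e d) : c.IsPreChart j φ E D e d where
  __ := h
  rest_sup_exc y := by
    rw [← h.exc y]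
    exact or_iff_right (h.rest y)

/-- The last exceptional divisor becomes the direction and the old direction joins the other
divisors, so the two coordinates and their vectors trade places. -/
lemma IsPostChart.turn (h : c.IsPostChart j φ E D e d) : c.turn.IsPreChart j φ D E d e where
  isOpenImmersion := h.isOpenImmersion
  isPt := h.isPt
  row_zero := h.row_zero
  row_one := h.row_one
  ne := h.ne.symm
  rows := by
    rw [mul_comm, mul_comm (X d ^ D.2)]
    exact h.rows
  center y := by
    rw [Set.pair_comm]
    exact h.center y
  dir := h.exc
  rest_sup_exc y := by
    rw [← h.dir y]
    exact ⟨fun h' => h'.elim (fun h'' => h''.elim (fun h3 => (h.rest y h3).elim) id)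
      fun h3 => h3.elim, fun h' => Or.inl (Or.inr h')⟩

lemma mem_coordLocus_singleton {y : Spec (CommRingCat.of (MvPolynomial σ K))} {i : σ} :
    y ∈ coordLocus K {i} ↔ (X i : MvPolynomial σ K) ∈ y.asIdeal :=
  ⟨fun h => h i rfl, by rintro h _ rfl; exact h⟩

lemma mem_coordLocus_pair {y : Spec (CommRingCat.of (MvPolynomial σ K))} {i i' : σ} :
    y ∈ coordLocus K {i, i'} ↔
      (X i : MvPolynomial σ K) ∈ y.asIdeal ∧ (X i' : MvPolynomial σ K) ∈ y.asIdeal :=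
  ⟨fun h => ⟨h i (Or.inl rfl), h i' (Or.inr rfl)⟩, by rintro ⟨h, h'⟩ _ (rfl | rfl) <;> assumption⟩

variable {V' : Scheme.{u}} {β : V' ⟶ c.V} {j' : Spec (CommRingCat.of (MvPolynomial σ K)) ⟶ V'}

/-- Under `X d ↦ X d * X e` the exponents of `X e` become `E + D` and those of `X d` stay `D`. The
older divisors lie in `X e = 0`, so their proper transforms leave this chart. -/
lemma IsPreChart.isPostChart_blowup (h : c.IsPreChart j φ E D e d)
    (hj' : j' ≫ β = blowupMap K {e, d} e ≫ j)
    (hc : (c.blowup β).IsCoordChart j' ((blowupHom K {e, d} e).comp φ)) :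
    (c.blowup β).IsPostChart j' ((blowupHom K {e, d} e).comp φ) (E + D) D e d := by
  have := h.isOpenImmersion
  have : IsOpenImmersion j' := hc.isOpenImmersion
  have hi : e ∈ ({e, d} : Set σ) := Or.inl rfl
  have hexc := mem_preimageClosed_chart hi hj' h.center
  have hdir : ∀ y, j' y ∈ properTransform β c.center c.dir ↔ y ∈ coordLocus K {d} := fun y => by
    rw [mem_properTransform_chart_of_coordLocus hi hj' h.center h.dir]
    exact and_iff_right h.ne
  refine { hc with
    ne := h.ne
    rows := ?_
    exc := hexc
    dir := hdir
    center := fun y => ?_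
    rest := fun y hy => ?_ }
  · have h1 := h.rows.map (blowupHom K {e, d} e).toRingHom
    have h2 : ∀ k l : ℕ, (blowupHom K {e, d} e).toRingHom (X e ^ k * X d ^ l) =
        X e ^ (k + l) * X d ^ l := fun k l => by
      change blowupHom K {e, d} e (X e ^ k * X d ^ l) = _
      rw [map_mul, map_pow, map_pow, blowupHom_X_self,
        blowupHom_X_of_mem (show d ∈ ({e, d} : Set σ) from Or.inr rfl) h.ne.symm]
      ring
    rw [h2, h2] at h1
    exact h1
  · refine (and_congr (hexc y) (hdir y)).trans ?_
    rw [mem_coordLocus_pair, mem_coordLocus_singleton, mem_coordLocus_singleton]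
  · exact ((mem_properTransform_chart_of_coordLocus hi hj' h.center h.rest_sup_exc y).1 hy).1 rfl

/-- In the other chart `X d` becomes the equation of the new divisor, the direction disappears, and
`X e` still cuts out the older divisors. -/
lemma IsPreChart.isDeadChart_blowup (h : c.IsPreChart j φ E D e d)
    (hj' : j' ≫ β = blowupMap K {e, d} d ≫ j)
    (hc : (c.blowup β).IsCoordChart j' ((blowupHom K {e, d} d).comp φ)) :
    (c.blowup β).IsDeadChart j' ((blowupHom K {e, d} d).comp φ) E (E + D) e d := by
  have := h.isOpenImmersion
  have : IsOpenImmersion j' := hc.isOpenImmersion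
  have hi : d ∈ ({e, d} : Set σ) := Or.inr rfl
  have hdir : ∀ y, j' y ∉ properTransform β c.center c.dir := fun y hy =>
    ((mem_properTransform_chart_of_coordLocus hi hj' h.center h.dir y).1 hy).1 rfl
  refine { hc with
    rows := ?_
    exc := mem_preimageClosed_chart hi hj' h.center
    dir := hdir
    center := fun y hy => hdir y hy.2
    rest := fun y => ?_ }
  · have h1 := h.rows.map (blowupHom K {e, d} d).toRingHom
    have h2 : ∀ k l : ℕ, (blowupHom K {e, d} d).toRingHom (X e ^ k * X d ^ l) =
        X e ^ k * X d ^ (k + l) := fun k l => by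
      change blowupHom K {e, d} d (X e ^ k * X d ^ l) = _
      rw [map_mul, map_pow, map_pow, blowupHom_X_self,
        blowupHom_X_of_mem (show e ∈ ({e, d} : Set σ) from Or.inl rfl) h.ne]
      ring
    rw [h2, h2] at h1
    exact h1
  · refine (mem_properTransform_chart_of_coordLocus hi hj' h.center h.rest_sup_exc y).trans ?_
    exact and_iff_right h.ne.symm

end

end BlowupStage

end

/-! ### One blow-up at a crossing of two divisors -/

section

variable {K : Type u} [Field K]

/-- The homomorphism that describes the chart with the matrix `chartMatrix K r t`. -/
def chartHom (r t : ChartRing K) : MatrixCoordRing K →ₐ[K] ChartRing K :=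
  aeval fun p : Fin 3 × Fin 3 => chartMatrix K r t p.1 p.2

lemma comp_chartHom (ψ : ChartRing K →ₐ[K] ChartRing K)
    (hψ : ∀ i, i ≠ 2 → i ≠ 5 → ψ (X i) = X i) (r t : ChartRing K) :
    ψ.comp (chartHom r t) = chartHom (ψ r) (ψ t) := by
  apply MvPolynomial.algHom_ext
  rintro ⟨i, k⟩
  fin_cases i <;> fin_cases k <;> simp [chartHom, chartMatrix, hψ]

namespace BlowupStage

variable {c : BlowupStage K} {m n : ℕ} {E D : ℕ × ℕ} {e d : Fin 8}

/-- The points off the next center, before a blow-up. -/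
structure IsPreOff (m n : ℕ) (c : BlowupStage K) (D : ℕ × ℕ) : Prop where
  status : ∀ x ∉ c.center, x ∈ c.rest ⊔ c.exc ∨ c.π x ∈ rowZero K 0 ∨
    x ∈ c.transform (rowZero K 1) ∨ c.HasGerm x (PowerRows D (x ∈ c.dir))
  base : ∀ x ∉ c.center, (x ∈ c.rest ⊔ c.exc ∨ x ∈ c.transform (rowZero K 1) ∨ x ∈ c.dir) →
    c.π x ∈ rowZero K 0 ∨ x ∉ c.baseSet m n

/-- The points off the next center, after a blow-up. -/
structure IsPostOff (m n : ℕ) (c : BlowupStage K) (E D : ℕ × ℕ) (x : c.V) : Prop where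
  status : x ∈ c.rest ∨ c.π x ∈ rowZero K 0 ∨ x ∈ c.transform (rowZero K 1) ∨
    c.HasGerm x (PowerRows E (x ∈ c.exc)) ∨ c.HasGerm x (PowerRows D (x ∈ c.dir))
  base : (x ∈ c.rest ∨ x ∈ c.transform (rowZero K 1) ∨ x ∈ c.dir ∨
    (x ∈ c.exc ∧ orderDefect m n E ≠ 0)) → c.π x ∈ rowZero K 0 ∨ x ∉ c.baseSet m n

/-- The local description of a stage that arises from a blow-up with two coordinates. The standard
chart has the exceptional coordinate `X e` and the direction `X d`. -/
structure IsPost (m n : ℕ) (c : BlowupStage K) (E D : ℕ × ℕ) (e d : Fin 8) : Prop where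
  good : c.IsGood
  pos : 0 < E.2 ∧ 0 < D.2
  chart : ∀ x ∈ c.center, ∃ (σ : Type) (j : Spec (CommRingCat.of (MvPolynomial σ K)) ⟶ c.V)
    (φ : MatrixCoordRing K →ₐ[K] MvPolynomial σ K) (e d : σ) (y : _),
      c.IsPostChart j φ E D e d ∧ j y = x
  tracked : ∃ j, c.IsPostChart j (chartHom (X e ^ E.1 * X d ^ D.1) (X e ^ E.2 * X d ^ D.2)) E D e d
  off : ∀ x ∉ c.center, IsPostOff m n c E D x

lemma IsPreOff.blowup (h : IsPreOff m n c D) {V' : Scheme.{u}} {β : V' ⟶ c.V}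
    (hβ : IsBlowup β c.center) {x' : V'} (hx : β x' ∉ c.center) (E : ℕ × ℕ) :
    IsPostOff m n (c.blowup β) E D x' where
  status := by
    have hmem := fun W => IsBlowup.mem_properTransform_iff (β := β) (Z := c.center) x' hx W
    rcases h.status _ hx with h' | h' | h' | h'
    · exact Or.inl ((hmem _).2 h')
    · exact Or.inr (Or.inl h')
    · exact Or.inr (Or.inr (Or.inl (hβ.mem_properTransform_comp x' hx _ h')))
    · exact Or.inr (Or.inr (Or.inr (Or.inr
        ((PowerRows.mono h' fun h'' => (hmem _).2 h'').blowup hβ hx))))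
  base h' := by
    have hmem := fun W => IsBlowup.mem_properTransform_iff (β := β) (Z := c.center) x' hx W
    have h'' : c.π (β x') ∈ rowZero K 0 ∨ β x' ∉ c.baseSet m n := by
      refine h.base _ hx ?_
      rcases h' with h' | h' | h' | ⟨h', -⟩
      · exact Or.inl ((hmem _).1 h')
      · exact Or.inr (Or.inl (properTransform_comp_le _ _ h'))
      · exact Or.inr (Or.inr ((hmem _).1 h'))
      · exact (hx h').elim
    exact h''.imp_right notMem_baseSet_blowup

section

variable {σ : Type} {j : Spec (CommRingCat.of (MvPolynomial σ K)) ⟶ c.V}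
  {φ : MatrixCoordRing K →ₐ[K] MvPolynomial σ K} {p q : σ}
  {y : Spec (CommRingCat.of (MvPolynomial σ K))}

/-- Such a chart is never blown up again, so its crossing of an old and the new divisor must already
be off the base set. This is why the two defects may not have opposite signs. -/
lemma IsDeadChart.isPostOff [Infinite K] (hm : 1 ≤ m) (hmn : m < n) {F : ℕ × ℕ}
    (h : c.IsDeadChart j φ F E p q) (hF : 0 < F.2) (hE : 0 < E.2) (hF' : orderDefect m n F ≠ 0)
    (hFE : 0 ≤ orderDefect m n F * orderDefect m n E) (D : ℕ × ℕ) :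
    IsPostOff m n c E D (j y) where
  status := by
    rw [h.rest, mem_coordLocus_singleton]
    by_cases hp : (X p : MvPolynomial σ K) ∈ y.asIdeal
    · exact Or.inl hp
    · refine Or.inr (Or.inr (Or.inr (Or.inl ?_)))
      refine h.toIsCoordChart.hasGerm_of_rows (b := F) (d := p) (e := q) ?_ hp
        fun hq => (h.exc y).2 (mem_coordLocus_singleton.2 hq)
      rw [mul_comm, mul_comm (X q ^ E.2)]
      exact h.rows
  base h' := by
    right
    rcases h' with h' | h' | h' | ⟨h', hE'⟩
    · exact h.toIsCoordChart.notMem_baseSet_of_rows hm hmn h.rows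
        (mem_coordLocus_singleton.1 ((h.rest y).1 h')) hF' (Or.inr hFE)
    · exact (h.toIsCoordChart.notMem_transform_rowZero_one_of_rows h.rows hF hE y h').elim
    · exact (h.dir y h').elim
    · refine h.toIsCoordChart.notMem_baseSet_of_rows hm hmn (e := q) (d := p) (a := E) (b := F) ?_
        (mem_coordLocus_singleton.1 ((h.exc y).1 h')) hE' (Or.inr (by rwa [mul_comm]))
      rw [mul_comm, mul_comm (X q ^ E.2)]
      exact h.rows

/-- Off the center one of the two coordinates is invertible, so only one divisor matters and no
comparison of signs is needed. -/
lemma IsPostChart.isPostOff [Infinite K] (hm : 1 ≤ m) (hmn : m < n)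
    (h : c.IsPostChart j φ E D p q) (hE : 0 < E.2) (hD : 0 < D.2) (hD' : orderDefect m n D ≠ 0)
    (hy : j y ∉ c.center) : IsPostOff m n c E D (j y) := by
  have hrows : HasMonomialRows φ.toRingHom (X q ^ D.1 * X p ^ E.1) (X q ^ D.2 * X p ^ E.2) := by
    rw [mul_comm, mul_comm (X q ^ D.2)]
    exact h.rows
  rw [h.center, mem_coordLocus_pair] at hy
  refine ⟨?_, fun h' => Or.inr ?_⟩
  · refine Or.inr (Or.inr (Or.inr ?_))
    by_cases hp : (X p : MvPolynomial σ K) ∈ y.asIdeal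
    · exact Or.inl (h.toIsCoordChart.hasGerm_of_rows h.rows (fun hq => hy ⟨hp, hq⟩)
        fun hp => (h.exc y).2 (mem_coordLocus_singleton.2 hp))
    · exact Or.inr (h.toIsCoordChart.hasGerm_of_rows hrows hp
        fun hq => (h.dir y).2 (mem_coordLocus_singleton.2 hq))
  · rcases h' with h' | h' | h' | ⟨h', hE'⟩
    · exact (h.rest y h').elim
    · exact (h.toIsCoordChart.notMem_transform_rowZero_one_of_rows h.rows hE hD y h').elim
    · rw [h.dir, mem_coordLocus_singleton] at h'
      exact h.toIsCoordChart.notMem_baseSet_of_rows hm hmn hrows h' hD'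
        (Or.inl fun hp => hy ⟨hp, h'⟩)
    · rw [h.exc, mem_coordLocus_singleton] at h'
      exact h.toIsCoordChart.notMem_baseSet_of_rows hm hmn h.rows h' hE'
        (Or.inl fun hq => hy ⟨h', hq⟩)

end

lemma chartHom_blowupHom {S : Set (Fin 8)} {i : Fin 8} (hS : S ⊆ {2, 5}) (r t : ChartRing K) :
    (blowupHom K S i).comp (chartHom r t) = chartHom (blowupHom K S i r) (blowupHom K S i t) := by
  refine comp_chartHom _ (fun l h2 h5 => blowupHom_X_of_notMem fun hl => ?_) r t
  rcases hS hl with h | h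
  exacts [h2 h, h5 h]

/-- One more blow-up. -/
lemma isPost_blowup_of_preChart [Infinite K] (hm : 1 ≤ m) (hmn : m < n) (hgood : c.IsGood)
    (hE : 0 < E.2) (hD : 0 < D.2) (hE' : orderDefect m n E ≠ 0) (hD' : orderDefect m n D ≠ 0)
    (hED : 0 ≤ orderDefect m n E * orderDefect m n (E + D))
    (hchart : ∀ x ∈ c.center, ∃ (σ : Type)
      (j : Spec (CommRingCat.of (MvPolynomial σ K)) ⟶ c.V)
      (φ : MatrixCoordRing K →ₐ[K] MvPolynomial σ K) (e d : σ) (y : _),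
        c.IsPreChart j φ E D e d ∧ j y = x)
    (hed : ({e, d} : Set (Fin 8)) ⊆ {2, 5})
    (htracked : ∃ j, c.IsPreChart j
      (chartHom (X e ^ E.1 * X d ^ D.1) (X e ^ E.2 * X d ^ D.2)) E D e d)
    (hoff : IsPreOff m n c D) {V' : Scheme.{u}} {β : V' ⟶ c.V} (hβ : IsBlowup β c.center) :
    IsPost m n (c.blowup β) (E + D) D e d := by
  have hED2 : 0 < (E + D).2 := Nat.add_pos_left hE _
  have key : ∀ x' : V', β x' ∈ c.center →
      (∃ (σ : Type) (j : Spec (CommRingCat.of (MvPolynomial σ K)) ⟶ V')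
        (φ : MatrixCoordRing K →ₐ[K] MvPolynomial σ K) (e d : σ) (y : _),
        (c.blowup β).IsPostChart j φ (E + D) D e d ∧ j y = x') ∨
      (∃ (σ : Type) (j : Spec (CommRingCat.of (MvPolynomial σ K)) ⟶ V')
        (φ : MatrixCoordRing K →ₐ[K] MvPolynomial σ K) (e d : σ) (y : _),
        (c.blowup β).IsDeadChart j φ E (E + D) e d ∧ j y = x') := by
    intro x' hx'
    obtain ⟨σ, j, φ, e, d, y, h, hy⟩ := hchart _ hx'
    obtain ⟨i, hi, j', y', hj', hy', hc⟩ := h.toIsCoordChart.exists_blowup_mem hβ h.center hy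
    rcases hi with rfl | rfl
    · exact Or.inl ⟨σ, j', _, _, _, y', h.isPostChart_blowup hj' hc, hy'⟩
    · exact Or.inr ⟨σ, j', _, _, _, y', h.isDeadChart_blowup hj' hc, hy'⟩
  refine ⟨?_, ⟨hED2, hD⟩, fun x' hx' => ?_, ?_, fun x' hx' => ?_⟩
  · refine hgood.blowup_of_charts hβ fun x hx => ?_
    obtain ⟨σ, j, φ, e, d, y, h, hy⟩ := hchart x hx
    exact ⟨σ, j, φ, _, y, h.toIsCoordChart, h.center, hy⟩
  · rcases key x' hx'.1 with h | ⟨σ, j, φ, e, d, y, h, rfl⟩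
    · exact h
    · exact (h.center y hx').elim
  · obtain ⟨j, h⟩ := htracked
    obtain ⟨j', hj', hc⟩ := h.toIsCoordChart.exists_blowup hβ h.center (i := e) (Or.inl rfl)
    have h' := h.isPostChart_blowup hj' hc
    have h2 : ∀ k l : ℕ, blowupHom K {e, d} e (X e ^ k * X d ^ l) =
        X e ^ (k + l) * X d ^ l := fun k l => by
      rw [map_mul, map_pow, map_pow, blowupHom_X_self,
        blowupHom_X_of_mem (show d ∈ ({e, d} : Set (Fin 8)) from Or.inr rfl) h.ne.symm]
      ring
    rw [chartHom_blowupHom hed, h2, h2] at h'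
    exact ⟨j', h'⟩
  · by_cases hx : β x' ∈ c.center
    · rcases key x' hx with ⟨σ, j, φ, e, d, y, h, rfl⟩ | ⟨σ, j, φ, e, d, y, h, rfl⟩
      · exact h.isPostOff hm hmn hED2 hD hD' hx'
      · exact h.isPostOff hm hmn hE hED2 hE' hED D
    · exact hoff.blowup hβ hx _

/-- The last exceptional divisor is about to join the excluded ones, so its points off the center
must avoid the base set. This holds because its defect is not yet 0. -/
lemma IsPost.isPreOff (h : IsPost m n c E D e d) (hE : orderDefect m n E ≠ 0) :
    IsPreOff m n c D where
  status x hx := by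
    rcases (h.off x hx).status with h' | h' | h' | h' | h'
    · exact Or.inl (Or.inl h')
    · exact Or.inr (Or.inl h')
    · exact Or.inr (Or.inr (Or.inl h'))
    · rcases PowerRows.or (v' := D) (Z' := x ∈ c.dir) h' with h'' | h''
      · exact Or.inl (Or.inr h'')
      · exact Or.inr (Or.inr (Or.inr h''))
    · exact Or.inr (Or.inr (Or.inr h'))
  base x hx h' := by
    refine (h.off x hx).base ?_
    rcases h' with (h' | h') | h' | h'
    · exact Or.inl h'
    · exact Or.inr (Or.inr (Or.inr ⟨h', hE⟩))
    · exact Or.inr (Or.inl h')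
    · exact Or.inr (Or.inr (Or.inl h'))

lemma IsPost.isPreOff_turn (h : IsPost m n c E D e d) (hE : orderDefect m n E ≠ 0) :
    IsPreOff m n c.turn E where
  status x hx := by
    rcases (h.off x hx).status with h' | h' | h' | h' | h'
    · exact Or.inl (Or.inl (Or.inl h'))
    · exact Or.inr (Or.inl h')
    · exact Or.inr (Or.inr (Or.inl h'))
    · exact Or.inr (Or.inr (Or.inr h'))
    · rcases PowerRows.or (v' := E) (Z' := x ∈ c.exc) h' with h'' | h''
      · exact Or.inl (Or.inl (Or.inr h''))
      · exact Or.inr (Or.inr (Or.inr h''))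
  base x hx h' := by
    refine (h.off x hx).base ?_
    rcases h' with ((h' | h') | h') | h' | h'
    · exact Or.inl h'
    · exact Or.inr (Or.inr (Or.inl h'))
    · exact h'.elim
    · exact Or.inr (Or.inl h')
    · exact Or.inr (Or.inr (Or.inr ⟨h', hE⟩))

lemma IsPost.blowup [Infinite K] (hm : 1 ≤ m) (hmn : m < n) (h : IsPost m n c E D e d)
    (hE : orderDefect m n E ≠ 0) (hD : orderDefect m n D ≠ 0)
    (hED : 0 ≤ orderDefect m n E * orderDefect m n (E + D))
    (hed : ({e, d} : Set (Fin 8)) ⊆ {2, 5}) {V' : Scheme.{u}} {β : V' ⟶ c.V}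
    (hβ : IsBlowup β c.center) : IsPost m n (c.blowup β) (E + D) D e d := by
  refine isPost_blowup_of_preChart hm hmn h.good h.pos.1 h.pos.2 hE hD hED (fun x hx => ?_) hed ?_
    (h.isPreOff hE) hβ
  · obtain ⟨σ, j, φ, e, d, y, h, hy⟩ := h.chart x hx
    exact ⟨σ, j, φ, e, d, y, h.isPreChart, hy⟩
  · obtain ⟨j, h⟩ := h.tracked
    exact ⟨j, h.isPreChart⟩

lemma IsPost.blowup_turn [Infinite K] (hm : 1 ≤ m) (hmn : m < n) (h : IsPost m n c E D e d)
    (hE : orderDefect m n E ≠ 0) (hD : orderDefect m n D ≠ 0)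
    (hED : 0 ≤ orderDefect m n D * orderDefect m n (D + E))
    (hed : ({d, e} : Set (Fin 8)) ⊆ {2, 5}) {V' : Scheme.{u}} {β : V' ⟶ c.turn.V}
    (hβ : IsBlowup β c.turn.center) : IsPost m n (c.turn.blowup β) (D + E) E d e := by
  refine isPost_blowup_of_preChart hm hmn h.good.turn h.pos.2 h.pos.1 hD hE hED (fun x hx => ?_)
    hed ?_ (h.isPreOff_turn hE) hβ
  · obtain ⟨σ, j, φ, e, d, y, h, hy⟩ := h.chart x hx
    exact ⟨σ, j, φ, d, e, y, h.turn, hy⟩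
  · obtain ⟨j, h⟩ := h.tracked
    refine ⟨j, ?_⟩
    rw [mul_comm, mul_comm (X d ^ D.2)]
    exact h.turn

end BlowupStage

end

/-! ### The first directed blow-up -/

section

variable {K : Type u} [Field K]

/-- The homomorphism that describes the chart with the matrix `chartMatrixOne K n`. -/
def chartOneHom (n : ℕ) : MatrixCoordRing K →ₐ[K] ChartRing K :=
  aeval fun p : Fin 3 × Fin 3 => chartMatrixOne K n p.1 p.2

namespace BlowupStage

variable {c : BlowupStage K} {m n a : ℕ}

/-- The second row is exactly divisible by `p`, and the third one is divisible by `p ^ a`. -/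
def DirectedRows (a : ℕ) (Z W : Prop) (R : Type u) [CommRing R] (φ : MatrixCoordRing K →+* R) :
    Prop :=
  ∃ (p : R) (w₁ w₂ : Fin 3 → R), p ≠ 0 ∧ (¬ IsUnit p → Z) ∧
    (∀ k, φ (X (1, k)) = p * w₁ k) ∧ (∀ k, φ (X (2, k)) = p ^ a * w₂ k) ∧
    (∃ k, IsUnit (w₁ k)) ∧ ((∀ k, ¬ IsUnit (w₂ k)) → W)

lemma DirectedRows.or {b : ℕ} {Z Z' W : Prop} {x : c.V} (h : c.HasGerm x (DirectedRows a Z W)) :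
    Z ∨ c.HasGerm x (DirectedRows b Z' W) := by
  by_cases hZ : Z
  · exact Or.inl hZ
  · refine Or.inr (h.imp fun R _ φ => ?_)
    rintro ⟨p, w₁, w₂, h₀, hp, h₁, h₂, hw₁, hw₂⟩
    have hp : IsUnit p := by
      by_contra h'
      exact hZ (hp h')
    have : Nontrivial R := ⟨p, 0, h₀⟩
    refine ⟨1, fun k => p * w₁ k, fun k => p ^ a * w₂ k, one_ne_zero,
      fun h => (h isUnit_one).elim, fun k => by rw [h₁, one_mul],
      fun k => by rw [h₂, one_pow, one_mul], ?_, fun h => hw₂ fun k hk => ?_⟩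
    · exact hw₁.imp fun k hk => hp.mul hk
    · exact h k ((hp.pow _).mul hk)

lemma DirectedRows.mono {Z Z' W W' : Prop} {x : c.V} (h : c.HasGerm x (DirectedRows a Z W))
    (hZ : Z → Z') (hW : W → W') : c.HasGerm x (DirectedRows a Z' W') :=
  h.imp fun _ _ _ ⟨p, w₁, w₂, h₀, hp, h₁, h₂, h₃, h₄⟩ =>
    ⟨p, w₁, w₂, h₀, fun h => hZ (hp h), h₁, h₂, h₃, fun h => hW (h₄ h)⟩

lemma PowerRows.directedRows {Z W : Prop} {x : c.V} (h : c.HasGerm x (PowerRows (1, a) Z)) :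
    c.HasGerm x (DirectedRows a Z W) :=
  h.imp fun _ _ _ ⟨p, w₁, w₂, h₀, hp, h₁, h₂, h₃, ⟨k, hk⟩⟩ =>
    ⟨p, w₁, w₂, h₀, hp, fun k => by rw [h₁, pow_one], h₂, h₃, fun h => (h k hk).elim⟩

/-- Exact divisibility of the third row can fail only on the direction `P`, which is an excluded
locus from the first turn on. -/
lemma DirectedRows.or_powerRows {Z W : Prop} {x : c.V} (h : c.HasGerm x (DirectedRows a Z W)) :
    W ∨ c.HasGerm x (PowerRows (1, a) Z) := by
  by_cases hW : W
  · exact Or.inl hW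
  · refine Or.inr (h.imp fun R _ φ => ?_)
    rintro ⟨p, w₁, w₂, h₀, hp, h₁, h₂, hw₁, hw₂⟩
    refine ⟨p, w₁, w₂, h₀, hp, fun k => by rw [h₁, pow_one], h₂, hw₁, ?_⟩
    by_contra! h'
    exact hW (hw₂ h')

/-- A chart of a stage in the first directed blow-up; the last exceptional divisor has the equation
`X u`, and the direction has the equations `X (T k)`. -/
structure IsDirectedChart (c : BlowupStage K) {σ : Type}
    (j : Spec (CommRingCat.of (MvPolynomial σ K)) ⟶ c.V)
    (φ : MatrixCoordRing K →ₐ[K] MvPolynomial σ K) (a : ℕ) (u : σ) (T : Fin 3 → σ) : Prop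
    extends c.IsCoordChart j φ where
  ne : ∀ k, T k ≠ u
  injective : Function.Injective T
  row₁ : ∃ w : Fin 3 → MvPolynomial σ K, (∀ k, φ (X (1, k)) = X u * w k) ∧ ∃ k, w k = 1
  row₂ : ∀ k, φ (X (2, k)) = X u ^ a * X (T k)
  center : ∀ y, j y ∈ c.center ↔ y ∈ coordLocus K (insert u (Set.range T))
  dir : ∀ y, j y ∈ c.dir ↔ y ∈ coordLocus K (Set.range T)
  exc : ∀ y, j y ∈ c.exc ↔ y ∈ coordLocus K {u}
  rest : ∀ y, j y ∉ c.rest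

section

variable {σ : Type} {j : Spec (CommRingCat.of (MvPolynomial σ K)) ⟶ c.V}
  {φ : MatrixCoordRing K →ₐ[K] MvPolynomial σ K} {u : σ} {T : Fin 3 → σ}
  {y : Spec (CommRingCat.of (MvPolynomial σ K))}

lemma mem_coordLocus_range :
    y ∈ coordLocus K (Set.range T) ↔ ∀ k, (X (T k) : MvPolynomial σ K) ∈ y.asIdeal :=
  Set.forall_mem_range

lemma mem_coordLocus_insert {S : Set σ} {i : σ} :
    y ∈ coordLocus K (insert i S) ↔ (X i : MvPolynomial σ K) ∈ y.asIdeal ∧ y ∈ coordLocus K S :=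
  Set.forall_mem_insert

lemma IsDirectedChart.hasGerm (h : c.IsDirectedChart j φ a u T)
    (y : Spec (CommRingCat.of (MvPolynomial σ K))) :
    c.HasGerm (j y) (DirectedRows a (j y ∈ c.exc) (j y ∈ c.dir)) := by
  refine hasGerm_of_chart h.isPt y _ fun R _ ψ hψ hu => ?_
  obtain ⟨w, h₁, ⟨k₁, hk₁⟩⟩ := h.row₁
  refine ⟨ψ (X u), fun k => ψ (w k), fun k => ψ (X (T k)), (map_ne_zero_iff ψ hψ).2 (X_ne_zero u),
    fun he => ?_, fun k => ?_, fun k => ?_, ⟨k₁, ?_⟩, fun hk => ?_⟩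
  · rw [h.exc, mem_coordLocus_singleton]
    by_contra h'; exact he ((hu _).2 h')
  · exact (congrArg ψ (h₁ k)).trans (map_mul _ _ _)
  · exact (congrArg ψ (h.row₂ k)).trans (by rw [map_mul, map_pow])
  · simp only [hk₁, map_one, isUnit_one]
  · rw [h.dir, mem_coordLocus_range]
    intro k
    by_contra h'; exact hk k ((hu _).2 h')

lemma IsDirectedChart.notMem_transform (h : c.IsDirectedChart j φ a u T) (ha : 1 ≤ a)
    (y : Spec (CommRingCat.of (MvPolynomial σ K))) : j y ∉ c.transform (rowZero K 1) := by
  obtain ⟨w, h₁, ⟨k₁, hk₁⟩⟩ := h.row₁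
  exact h.toIsCoordChart.notMem_transform_rowZero_one ⟨X u, X u,
    ⟨k₁, by rw [h₁, hk₁, mul_one]⟩, fun k => ⟨_, h₁ k⟩,
    fun k => by rw [h.row₂]; exact Dvd.dvd.mul_right (dvd_pow_self _ (by lia)) _,
    fun I _ h => h⟩ y

/-- The points off the next center, in the first directed blow-up. -/
structure IsDirectedOff (m n : ℕ) (c : BlowupStage K) (a : ℕ) (x : c.V) : Prop where
  status : x ∈ c.rest ∨ c.π x ∈ rowZero K 0 ∨ x ∈ c.transform (rowZero K 1) ∨
    c.HasGerm x (DirectedRows a (x ∈ c.exc) (x ∈ c.dir))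
  base : (x ∈ c.rest ∨ x ∈ c.transform (rowZero K 1) ∨ x ∈ c.dir ∨
    (x ∈ c.exc ∧ orderDefect m n (1, a) ≠ 0)) → c.π x ∈ rowZero K 0 ∨ x ∉ c.baseSet m n

/-- On the direction and off the center, `X u` is invertible and the third row dies. On the last
divisor and off the center, some entry of the third row survives, and `han` says that the defect is
nonnegative. -/
lemma IsDirectedChart.isDirectedOff [Infinite K] (hm : 1 ≤ m) (hmn : m < n)
    (h : c.IsDirectedChart j φ a u T) (ha : 1 ≤ a) (han : m * a ≤ n) (hy : j y ∉ c.center) :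
    IsDirectedOff m n c a (j y) where
  status := Or.inr (Or.inr (Or.inr (h.hasGerm y)))
  base h' := by
    right
    have := h.isOpenImmersion
    rw [h.center, mem_coordLocus_insert] at hy
    obtain ⟨w, h₁, ⟨k₁, hk₁⟩⟩ := h.row₁
    have h1 : ∀ w : MvPolynomial σ K, w = 1 → w ∉ y.asIdeal := by
      rintro _ rfl; exact y.isPrime.one_notMem
    rcases h' with h' | h' | h' | ⟨h', ha'⟩
    · exact (h.rest y h').elim
    · exact (h.notMem_transform ha y h').elim
    · rw [h.dir] at h'
      refine notMem_baseSet_of_pow_eq' (α := X u ^ n) h.isPt hm hmn h₁ h.row₂ ⟨k₁, h1 _ hk₁⟩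
        (fun hu => hy ⟨y.isPrime.mem_of_pow_mem _ hu, h'⟩) rfl
        (Or.inr (mem_coordLocus_range.1 h'))
    · rw [h.exc, mem_coordLocus_singleton] at h'
      have hT : ∃ k, (X (T k) : MvPolynomial σ K) ∉ y.asIdeal := by
        by_contra! hT
        exact hy ⟨h', mem_coordLocus_range.2 hT⟩
      obtain ⟨l, rfl⟩ := Nat.exists_eq_add_of_le han
      have hl : 0 < l := by
        rw [Nat.pos_iff_ne_zero]
        rintro rfl
        exact ha' (by simp [orderDefect])
      refine notMem_baseSet_of_pow_eq (α := 1) (d := X u ^ l) h.isPt hm hmn (fun _ => rfl) h₁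
        h.row₂ (h.row_zero.imp fun k hk => h1 _ hk) hT (h1 _ rfl) ?_
        (Or.inl (Ideal.pow_mem_of_mem _ h' _ hl))
      ring

end

/-- The local description of a stage in the first directed blow-up. -/
structure IsDirectedStage (m n : ℕ) (c : BlowupStage K) (a : ℕ) : Prop where
  good : c.IsGood
  pos : 1 ≤ a
  chart : ∀ x ∈ c.center, ∃ (σ : Type) (j : Spec (CommRingCat.of (MvPolynomial σ K)) ⟶ c.V)
    (φ : MatrixCoordRing K →ₐ[K] MvPolynomial σ K) (u : σ) (T : Fin 3 → σ) (y : _),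
      c.IsDirectedChart j φ a u T ∧ j y = x
  tracked : ∃ j, c.IsDirectedChart j (chartOneHom a) a (2 : Fin 8) ![5, 6, 7]
  off : ∀ x ∉ c.center, IsDirectedOff m n c a x

section

variable {σ : Type} {j : Spec (CommRingCat.of (MvPolynomial σ K)) ⟶ c.V}
  {φ : MatrixCoordRing K →ₐ[K] MvPolynomial σ K} {u : σ} {T : Fin 3 → σ}
  {V' : Scheme.{u}} {β : V' ⟶ c.V} {j' : Spec (CommRingCat.of (MvPolynomial σ K)) ⟶ V'}

lemma IsDirectedChart.rest_sup_exc (h : c.IsDirectedChart j φ a u T)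
    (y : Spec (CommRingCat.of (MvPolynomial σ K))) :
    j y ∈ c.rest ⊔ c.exc ↔ y ∈ coordLocus K {u} := by
  rw [← h.exc y]
  exact or_iff_right (h.rest y)

lemma IsDirectedChart.isDirectedChart_blowup (h : c.IsDirectedChart j φ a u T)
    (hj' : j' ≫ β = blowupMap K (insert u (Set.range T)) u ≫ j)
    (hc : (c.blowup β).IsCoordChart j' ((blowupHom K (insert u (Set.range T)) u).comp φ)) :
    (c.blowup β).IsDirectedChart j' ((blowupHom K (insert u (Set.range T)) u).comp φ)
      (a + 1) u T := by
  have := h.isOpenImmersion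
  have : IsOpenImmersion j' := hc.isOpenImmersion
  have hi : u ∈ insert u (Set.range T) := Or.inl rfl
  have hexc := mem_preimageClosed_chart hi hj' h.center
  have hdir : ∀ y, j' y ∈ properTransform β c.center c.dir ↔ y ∈ coordLocus K (Set.range T) :=
    fun y => by
      rw [mem_properTransform_chart_of_coordLocus hi hj' h.center h.dir]
      exact and_iff_right fun ⟨k, hk⟩ => h.ne k hk
  refine { hc with
    ne := h.ne
    injective := h.injective
    row₁ := ?_
    row₂ := fun k => ?_
    exc := hexc
    dir := hdir
    center := fun y => ?_
    rest := fun y hy => ?_ }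
  · obtain ⟨w, h₁, k₁, hk₁⟩ := h.row₁
    refine ⟨fun k => blowupHom K (insert u (Set.range T)) u (w k), fun k => ?_, k₁, by simp only [hk₁, map_one]⟩
    rw [AlgHom.comp_apply, h₁, map_mul, blowupHom_X_self]
  · rw [AlgHom.comp_apply, h.row₂, map_mul, map_pow, blowupHom_X_self,
      blowupHom_X_of_mem (show T k ∈ insert u (Set.range T) from Or.inr ⟨k, rfl⟩) (h.ne k)]
    ring
  · refine (and_congr (hexc y) (hdir y)).trans ?_
    rw [mem_coordLocus_insert, mem_coordLocus_singleton]
  · exact ((mem_properTransform_chart_of_coordLocus hi hj' h.center h.rest_sup_exc y).1 hy).1 rfl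

/-- All of `X u` and the `X (T k)` pick up the factor `X (T k₀)`, except `X (T k₀)` itself, which
provides the entry 1 of the third row. -/
lemma IsDirectedChart.rows_blowup (h : c.IsDirectedChart j φ a u T) (k₀ : Fin 3) :
    HasMonomialRows ((blowupHom K (insert u (Set.range T)) (T k₀)).comp φ).toRingHom
      (X u ^ 1 * X (T k₀) ^ 1) (X u ^ a * X (T k₀) ^ (a + 1)) := by
  obtain ⟨w, h₁, k₁, hk₁⟩ := h.row₁
  have hu : blowupHom K (insert u (Set.range T)) (T k₀) (X u) = X u * X (T k₀) :=
    blowupHom_X_of_mem (Or.inl rfl) (h.ne k₀).symm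
  refine ⟨fun k => blowupHom K (insert u (Set.range T)) (T k₀) (w k), fun k => if k = k₀ then 1 else X (T k),
    fun k => ?_, fun k => ?_, ⟨k₁, by simp only [hk₁, map_one]⟩, ⟨k₀, if_pos rfl⟩⟩
  · change blowupHom K _ (T k₀) (φ _) = _
    rw [h₁, map_mul, hu, pow_one, pow_one]
  · change blowupHom K _ (T k₀) (φ _) = _
    rw [h.row₂, map_mul, map_pow, hu]
    beta_reduce
    split_ifs with hk
    · subst hk
      rw [blowupHom_X_self]
      ring
    · rw [blowupHom_X_of_mem (show T k ∈ insert u (Set.range T) from Or.inr ⟨k, rfl⟩)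
        (h.injective.ne hk)]
      ring

lemma IsDirectedChart.isDeadChart_blowup (h : c.IsDirectedChart j φ a u T) (k₀ : Fin 3)
    (hj' : j' ≫ β = blowupMap K (insert u (Set.range T)) (T k₀) ≫ j)
    (hc : (c.blowup β).IsCoordChart j' ((blowupHom K (insert u (Set.range T)) (T k₀)).comp φ)) :
    (c.blowup β).IsDeadChart j' ((blowupHom K (insert u (Set.range T)) (T k₀)).comp φ)
      (1, a) (1, a + 1) u (T k₀) := by
  have := h.isOpenImmersion
  have : IsOpenImmersion j' := hc.isOpenImmersion
  have hi : T k₀ ∈ insert u (Set.range T) := Or.inr ⟨k₀, rfl⟩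
  have hdir : ∀ y, j' y ∉ properTransform β c.center c.dir := fun y hy =>
    ((mem_properTransform_chart_of_coordLocus hi hj' h.center h.dir y).1 hy).1 ⟨k₀, rfl⟩
  refine { hc with
    rows := h.rows_blowup k₀
    exc := mem_preimageClosed_chart hi hj' h.center
    dir := hdir
    center := fun y hy => hdir y hy.2
    rest := fun y => ?_ }
  refine (mem_properTransform_chart_of_coordLocus hi hj' h.center h.rest_sup_exc y).trans ?_
  exact and_iff_right (h.ne k₀)

end

lemma IsDirectedStage.blowup [Infinite K] (hm : 1 ≤ m) (hmn : m < n) (h : IsDirectedStage m n c a)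
    (han : m * (a + 1) ≤ n) {V' : Scheme.{u}} {β : V' ⟶ c.V} (hβ : IsBlowup β c.center) :
    IsDirectedStage m n (c.blowup β) (a + 1) := by
  -- The assumption `m * (a + 1) ≤ n` keeps the old defect positive and the new one nonnegative, so
  -- their crossing is harmless.
  have hd : 0 < orderDefect m n (1, a) := by
    simp only [orderDefect]; zify at *; nlinarith
  have hd' : 0 ≤ orderDefect m n (1, a + 1) := by
    simp only [orderDefect]; zify at *; nlinarith
  have key : ∀ x' : V', β x' ∈ c.center →
      (∃ (σ : Type) (j : Spec (CommRingCat.of (MvPolynomial σ K)) ⟶ V')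
        (φ : MatrixCoordRing K →ₐ[K] MvPolynomial σ K) (u : σ) (T : Fin 3 → σ) (y : _),
        (c.blowup β).IsDirectedChart j φ (a + 1) u T ∧ j y = x') ∨
      (∃ (σ : Type) (j : Spec (CommRingCat.of (MvPolynomial σ K)) ⟶ V')
        (φ : MatrixCoordRing K →ₐ[K] MvPolynomial σ K) (e d : σ) (y : _),
        (c.blowup β).IsDeadChart j φ (1, a) (1, a + 1) e d ∧ j y = x') := by
    intro x' hx'
    obtain ⟨σ, j, φ, u, T, y, h, hy⟩ := h.chart _ hx'
    obtain ⟨i, hi, j', y', hj', hy', hc⟩ := h.toIsCoordChart.exists_blowup_mem hβ h.center hy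
    rcases hi with rfl | ⟨k₀, rfl⟩
    · exact Or.inl ⟨σ, j', _, _, _, y', h.isDirectedChart_blowup hj' hc, hy'⟩
    · exact Or.inr ⟨σ, j', _, _, _, y', h.isDeadChart_blowup k₀ hj' hc, hy'⟩
  refine ⟨?_, by lia, fun x' hx' => ?_, ?_, fun x' hx' => ?_⟩
  · refine h.good.blowup_of_charts hβ fun x hx => ?_
    obtain ⟨σ, j, φ, u, T, y, h, hy⟩ := h.chart x hx
    exact ⟨σ, j, φ, _, y, h.toIsCoordChart, h.center, hy⟩
  · rcases key x' hx'.1 with h | ⟨σ, j, φ, e, d, y, h, rfl⟩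
    · exact h
    · exact (h.center y hx').elim
  · obtain ⟨j, h⟩ := h.tracked
    obtain ⟨j', hj', hc⟩ := h.toIsCoordChart.exists_blowup hβ h.center (i := 2) (Or.inl rfl)
    have h' := h.isDirectedChart_blowup hj' hc
    have hφ : (blowupHom K (insert 2 (Set.range ![5, 6, 7])) 2).comp (chartOneHom a) =
        chartOneHom (K := K) (a + 1) := by
      apply MvPolynomial.algHom_ext
      rintro ⟨i, k⟩
      fin_cases i <;> fin_cases k <;>
        simp [chartOneHom, chartMatrixOne, blowupHom] <;> ring
    rw [hφ] at h'
    exact ⟨j', h'⟩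
  · by_cases hx : β x' ∈ c.center
    · rcases key x' hx with ⟨σ, j, φ, u, T, y, h', rfl⟩ | ⟨σ, j, φ, e, d, y, h', rfl⟩
      · exact h'.isDirectedOff hm hmn (by lia) han hx'
      · have h2 := h'.isPostOff (y := y) hm hmn (show 0 < a from h.pos) (Nat.succ_pos a) hd.ne'
          (mul_nonneg hd.le hd') (1, a + 1)
        refine ⟨?_, h2.base⟩
        rcases h2.status with h3 | h3 | h3 | h3 | h3
        · exact Or.inl h3
        · exact Or.inr (Or.inl h3)
        · exact Or.inr (Or.inr (Or.inl h3))
        · exact Or.inr (Or.inr (Or.inr (PowerRows.directedRows h3)))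
        · exact Or.inr (Or.inr (Or.inr (PowerRows.directedRows
            (PowerRows.mono h3 fun h4 => (h'.dir y h4).elim))))
    · have hmem := fun W => IsBlowup.mem_properTransform_iff (β := β) (Z := c.center) x' hx W
      have hoff := h.off _ hx
      refine ⟨?_, fun h' => ?_⟩
      · rcases hoff.status with h' | h' | h' | h'
        · exact Or.inl ((hmem _).2 (Or.inl h'))
        · exact Or.inr (Or.inl h')
        · exact Or.inr (Or.inr (Or.inl (hβ.mem_properTransform_comp x' hx _ h')))
        · rcases DirectedRows.or (b := a + 1) (Z' := x' ∈ (c.blowup β).exc) h' with h'' | h''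
          · exact Or.inl ((hmem _).2 (Or.inr h''))
          · exact Or.inr (Or.inr (Or.inr
              ((DirectedRows.mono h'' id fun h3 => (hmem _).2 h3).blowup hβ hx)))
      · have h'' : c.π (β x') ∈ rowZero K 0 ∨ β x' ∉ c.baseSet m n := by
          refine hoff.base ?_
          rcases h' with h' | h' | h' | ⟨h', -⟩
          · rcases (hmem _).1 h' with h3 | h3
            · exact Or.inl h3
            · exact Or.inr (Or.inr (Or.inr ⟨h3, hd.ne'⟩))
          · exact Or.inr (Or.inl (properTransform_comp_le _ _ h'))
          · exact Or.inr (Or.inr (Or.inl ((hmem _).1 h')))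
          · exact (hx h').elim
        exact h''.imp_right notMem_baseSet_blowup

end BlowupStage

end

/-! ### From the first to the second directed blow-up -/

section

variable {K : Type u} [Field K]

namespace BlowupStage

variable {c : BlowupStage K} {m n a : ℕ}

section

variable {σ : Type} {j : Spec (CommRingCat.of (MvPolynomial σ K)) ⟶ c.V}
  {φ : MatrixCoordRing K →ₐ[K] MvPolynomial σ K} {u : σ} {T : Fin 3 → σ}
  {V' : Scheme.{u}} {β : V' ⟶ c.turn.V}
  {j' : Spec (CommRingCat.of (MvPolynomial σ K)) ⟶ V'}

lemma IsDirectedChart.rest_turn (h : c.IsDirectedChart j φ a u T)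
    (y : Spec (CommRingCat.of (MvPolynomial σ K))) :
    j y ∈ c.turn.rest ⊔ c.turn.exc ↔ y ∈ coordLocus K (Set.range T) := by
  rw [← h.dir y]
  exact ⟨fun h' => h'.elim (fun h'' => h''.elim (fun h3 => (h.rest y h3).elim) id)
    fun h3 => h3.elim, fun h' => Or.inl (Or.inr h')⟩

/-- The center has the same equations as when the first directed blow-up is continued, but the
direction is now `X u = 0`. Hence the charts of the `T k₀` contain the next center, while the chart
of `u` drops out. -/
lemma IsDirectedChart.isPostChart_blowup_turn (h : c.IsDirectedChart j φ a u T) (k₀ : Fin 3)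
    (hj' : j' ≫ β = blowupMap K (insert u (Set.range T)) (T k₀) ≫ j)
    (hc : (c.turn.blowup β).IsCoordChart j'
      ((blowupHom K (insert u (Set.range T)) (T k₀)).comp φ)) :
    (c.turn.blowup β).IsPostChart j' ((blowupHom K (insert u (Set.range T)) (T k₀)).comp φ)
      (1, a + 1) (1, a) (T k₀) u := by
  have : IsOpenImmersion j := h.isOpenImmersion
  have : IsOpenImmersion j' := hc.isOpenImmersion
  have hi : T k₀ ∈ insert u (Set.range T) := Or.inr ⟨k₀, rfl⟩
  have hexc := mem_preimageClosed_chart hi hj' h.center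
  have hdir : ∀ y, j' y ∈ properTransform β c.center c.exc ↔ y ∈ coordLocus K {u} := fun y => by
    rw [mem_properTransform_chart_of_coordLocus hi hj' h.center h.exc]
    exact and_iff_right (h.ne k₀)
  refine { hc with
    ne := h.ne k₀
    rows := ?_
    exc := hexc
    dir := hdir
    center := fun y => ?_
    rest := fun y hy => ?_ }
  · have := h.rows_blowup k₀
    rwa [mul_comm, mul_comm (X u ^ a)] at this
  · refine (and_congr (hexc y) (hdir y)).trans ?_
    rw [mem_coordLocus_pair, mem_coordLocus_singleton, mem_coordLocus_singleton]
  · exact ((mem_properTransform_chart_of_coordLocus hi hj' h.center h.rest_turn y).1 hy).1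
      ⟨k₀, rfl⟩

/-- The remaining chart of the first blow-up of the second directed blow-up. -/
lemma IsDirectedChart.isPostOff_blowup_turn [Infinite K] (hm : 1 ≤ m) (hmn : m < n)
    (h : c.IsDirectedChart j φ a u T) (han : n ≤ m * (a + 1))
    (hj' : j' ≫ β = blowupMap K (insert u (Set.range T)) u ≫ j)
    (hc : (c.turn.blowup β).IsCoordChart j' ((blowupHom K (insert u (Set.range T)) u).comp φ))
    (y : Spec (CommRingCat.of (MvPolynomial σ K))) :
    j' y ∉ (c.turn.blowup β).center ∧
      IsPostOff m n (c.turn.blowup β) (1, a + 1) (1, a) (j' y) := by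
  have : IsOpenImmersion j := h.isOpenImmersion
  have : IsOpenImmersion j' := hc.isOpenImmersion
  have hi : u ∈ insert u (Set.range T) := Or.inl rfl
  have hexc : ∀ y, j' y ∈ (c.turn.blowup β).exc ↔ _ := mem_preimageClosed_chart hi hj' h.center
  have hdir : ∀ y, j' y ∉ (c.turn.blowup β).dir := fun y hy =>
    ((mem_properTransform_chart_of_coordLocus hi hj' h.center h.exc y).1 hy).1 rfl
  have hrest : ∀ y, j' y ∈ (c.turn.blowup β).rest ↔ y ∈ coordLocus K (Set.range T) := fun y =>
    (mem_properTransform_chart_of_coordLocus hi hj' h.center h.rest_turn y).trans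
      (and_iff_right fun ⟨k, hk⟩ => h.ne k hk)
  obtain ⟨w, h₁, k₁, hk₁⟩ := h.row₁
  let ψ := blowupHom K (insert u (Set.range T)) u
  have hrow₁ : ∀ k, (ψ.comp φ).toRingHom (X (1, k)) = X u * ψ (w k) := fun k => by
    change ψ (φ _) = _
    rw [h₁, map_mul, blowupHom_X_self]
  have hrow₂ : ∀ k, (ψ.comp φ).toRingHom (X (2, k)) = X u ^ (a + 1) * X (T k) := fun k => by
    change ψ (φ _) = _
    rw [h.row₂, map_mul, map_pow, blowupHom_X_self,
      blowupHom_X_of_mem (show T k ∈ insert u (Set.range T) from Or.inr ⟨k, rfl⟩) (h.ne k)]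
    ring
  have h1 : ∀ w : MvPolynomial σ K, w = 1 → w ∉ y.asIdeal := by
    rintro _ rfl; exact y.isPrime.one_notMem
  have hw₁ : ψ (w k₁) = 1 := by rw [hk₁, map_one]
  refine ⟨fun hy => hdir y hy.2, ?_, fun h' => Or.inr ?_⟩
  · by_cases hT : ∀ k, (X (T k) : MvPolynomial σ K) ∈ y.asIdeal
    · exact Or.inl ((hrest y).2 (mem_coordLocus_range.2 hT))
    · push Not at hT
      obtain ⟨k₂, hk₂⟩ := hT
      refine Or.inr (Or.inr (Or.inr (Or.inl ?_)))
      refine hasGerm_of_chart hc.isPt y _ fun R _ θ hθ hu => ?_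
      refine ⟨θ (X u), fun k => θ (ψ (w k)), fun k => θ (X (T k)),
        (map_ne_zero_iff θ hθ).2 (X_ne_zero u), fun he => ?_, fun k => ?_, fun k => ?_,
        ⟨k₁, ?_⟩, ⟨k₂, (hu _).2 hk₂⟩⟩
      · refine (hexc y).2 (mem_coordLocus_singleton.2 ?_)
        by_contra h'; exact he ((hu _).2 h')
      · exact (congrArg θ (hrow₁ k)).trans (by rw [map_mul, pow_one])
      · exact (congrArg θ (hrow₂ k)).trans (by rw [map_mul, map_pow])
      · simp only [hw₁, map_one, isUnit_one]
  · obtain ⟨l, hl⟩ := Nat.exists_eq_add_of_le han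
    -- The defect of the new divisor is `-l`, which is nonpositive by `han`; hence the second row
    -- gives the dominant term, on the divisor and on `P` alike.
    have hpow : (1 : MvPolynomial σ K) * (X u ^ (a + 1)) ^ m = X u ^ n * X u ^ l := by
      rw [one_mul, ← pow_mul, ← pow_add, ← hl, mul_comm]
    have hio : @IsOpenImmersion _ (c.turn.blowup β).V j' := hc.isOpenImmersion
    have key := fun hd => notMem_baseSet_of_pow_eq' (c := c.turn.blowup β) (y := y) hc.isPt hm hmn hrow₁ hrow₂
      ⟨k₁, h1 _ hw₁⟩ (h1 _ rfl) hpow hd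
    rcases h' with h' | h' | h' | ⟨h', ha⟩
    · exact key (Or.inr (mem_coordLocus_range.1 ((hrest y).1 h')))
    · refine (hc.notMem_transform_rowZero_one ⟨X u, X u,
        ⟨k₁, (hrow₁ k₁).trans (by rw [hw₁, mul_one])⟩, fun k => ⟨_, hrow₁ k⟩,
        fun k => ?_, fun I _ h => h⟩ y h').elim
      exact (Dvd.dvd.mul_right (dvd_pow_self _ (by lia)) _).trans (hrow₂ k).symm.dvd
    · exact (hdir y h').elim
    · refine key (Or.inl (Ideal.pow_mem_of_mem _ (mem_coordLocus_singleton.1 ((hexc y).1 h')) _ ?_))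
      rw [Nat.pos_iff_ne_zero]
      rintro rfl
      refine ha ?_
      simp only [orderDefect]
      zify at hl
      push_cast
      linarith

end

lemma IsDirectedStage.isPreOff_turn (h : IsDirectedStage m n c a)
    (ha : orderDefect m n (1, a) ≠ 0) : IsPreOff m n c.turn (1, a) where
  status x hx := by
    rcases (h.off x hx).status with h' | h' | h' | h'
    · exact Or.inl (Or.inl (Or.inl h'))
    · exact Or.inr (Or.inl h')
    · exact Or.inr (Or.inr (Or.inl h'))
    · rcases DirectedRows.or_powerRows h' with h'' | h''
      · exact Or.inl (Or.inl (Or.inr h''))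
      · exact Or.inr (Or.inr (Or.inr h''))
  base x hx h' := by
    refine (h.off x hx).base ?_
    rcases h' with ((h' | h') | h') | h' | h'
    · exact Or.inl h'
    · exact Or.inr (Or.inr (Or.inl h'))
    · exact h'.elim
    · exact Or.inr (Or.inl h')
    · exact Or.inr (Or.inr (Or.inr ⟨h', ha⟩))

/-- The new vector `(1, a + 1)` is the sum of `(0, 1)`, belonging to `P`, and `(1, a)`, belonging to
the first exceptional divisor. From here on all charts have just two distinguished coordinates. -/
lemma IsDirectedStage.blowup_turn [Infinite K] (hm : 1 ≤ m) (hmn : m < n)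
    (h : IsDirectedStage m n c a) (han : m * a < n) (han' : n ≤ m * (a + 1)) {V' : Scheme.{u}}
    {β : V' ⟶ c.turn.V} (hβ : IsBlowup β c.turn.center) :
    IsPost m n (c.turn.blowup β) (1, a + 1) (1, a) 5 2 := by
  have hd : orderDefect m n (1, a) ≠ 0 := by
    simp only [orderDefect]; zify at *; nlinarith
  have key : ∀ x' : V', β x' ∈ c.center →
      (∃ (σ : Type) (j : Spec (CommRingCat.of (MvPolynomial σ K)) ⟶ V')
        (φ : MatrixCoordRing K →ₐ[K] MvPolynomial σ K) (e d : σ) (y : _),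
        (c.turn.blowup β).IsPostChart j φ (1, a + 1) (1, a) e d ∧ j y = x') ∨
      (x' ∉ (c.turn.blowup β).center ∧
        IsPostOff m n (c.turn.blowup β) (1, a + 1) (1, a) x') := by
    intro x' hx'
    obtain ⟨σ, j, φ, u, T, y, h, hy⟩ := h.chart _ hx'
    have hct : c.turn.IsCoordChart j φ := ⟨h.isOpenImmersion, h.isPt, h.row_zero, h.row_one⟩
    obtain ⟨i, hi, j', y', hj', hy', hc⟩ := hct.exists_blowup_mem hβ h.center hy
    rcases hi with rfl | ⟨k₀, rfl⟩
    · exact Or.inr (hy' ▸ h.isPostOff_blowup_turn hm hmn han' hj' hc y')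
    · exact Or.inl ⟨σ, j', _, _, _, y', h.isPostChart_blowup_turn k₀ hj' hc, hy'⟩
  have ha := h.pos
  refine ⟨?_, ⟨Nat.succ_pos a, ha⟩, fun x' hx' => ?_, ?_, fun x' hx' => ?_⟩
  · refine h.good.turn.blowup_of_charts hβ fun x hx => ?_
    obtain ⟨σ, j, φ, u, T, y, h, hy⟩ := h.chart x hx
    exact ⟨σ, j, φ, _, y, ⟨h.isOpenImmersion, h.isPt, h.row_zero, h.row_one⟩, h.center, hy⟩
  · exact (key x' hx'.1).resolve_right fun h' => h'.1 hx'
  · obtain ⟨j, h⟩ := h.tracked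
    have hct : c.turn.IsCoordChart j (chartOneHom a) :=
      ⟨h.isOpenImmersion, h.isPt, h.row_zero, h.row_one⟩
    obtain ⟨j', hj', hc⟩ := hct.exists_blowup hβ h.center (i := 5) (Or.inr ⟨0, rfl⟩)
    have h' := h.isPostChart_blowup_turn 0 hj' hc
    have hφ : (blowupHom K (insert 2 (Set.range ![5, 6, 7])) 5).comp (chartOneHom a) =
        chartHom (K := K) (X 5 ^ 1 * X 2 ^ 1) (X 5 ^ (a + 1) * X 2 ^ a) := by
      apply MvPolynomial.algHom_ext
      rintro ⟨i, k⟩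
      fin_cases i <;> fin_cases k <;>
        simp [chartOneHom, chartMatrixOne, chartHom, chartMatrix, blowupHom] <;> ring
    exact ⟨j', hφ ▸ h'⟩
  · by_cases hx : β x' ∈ c.turn.center
    · rcases key x' hx with ⟨σ, j, φ, e, d, y, h, rfl⟩ | h'
      · exact h.isPostOff hm hmn (Nat.succ_pos a) ha hd hx'
      · exact h'.2
    · exact (h.isPreOff_turn hd).blowup hβ hx _

end BlowupStage

end

/-! ### The first blow-up of `ℙ⁸` -/

section

variable {K : Type u} [Field K]

lemma exists_X_zero_notMem {x : P8 K} (hx : x ∉ rowZero K 0) :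
    ∃ k : Fin 3, (X (0, k) : MatrixCoordRing K) ∉ x.asHomogeneousIdeal := by
  by_contra! h
  refine hx ?_
  rintro _ ⟨k, rfl⟩
  exact h k

lemma notMem_rowZero_zero_of_mem_cuspLocus {x : P8 K} (hx : x ∈ cuspLocus K) :
    x ∉ rowZero K 0 := by
  intro h
  obtain ⟨⟨i, k⟩, hp⟩ := BlowupStage.exists_X_notMem x
  refine hp ?_
  fin_cases i
  exacts [h ⟨k, rfl⟩, hx.1 ⟨k, rfl⟩, hx.2 ⟨k, rfl⟩]

namespace BlowupStage

variable {m n : ℕ}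

/-- An affine chart of `ℙ⁸` in which the entries of the last two rows are coordinates. -/
structure IsInitialChart {σ : Type} (j : Spec (CommRingCat.of (MvPolynomial σ K)) ⟶ P8 K)
    (φ : MatrixCoordRing K →ₐ[K] MvPolynomial σ K) (r t : Fin 3 → σ) : Prop
    extends (initial K).IsCoordChart j φ where
  ne : ∀ k l, t k ≠ r l
  injective_r : Function.Injective r
  injective_t : Function.Injective t
  row₁ : ∀ k, φ (X (1, k)) = X (r k)
  row₂ : ∀ k, φ (X (2, k)) = X (t k)

section

variable {σ : Type}

lemma exists_isInitialChart (φ : MatrixCoordRing K →ₐ[K] MvPolynomial σ K) {k : Fin 3}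
    (hk : φ (X (0, k)) = 1) (q : σ → Fin 3 × Fin 3) (hq : ∀ i, φ (X (q i)) = X i)
    (hq' : ∀ p, p ≠ (0, k) → ∃ i, q i = p) {r t : Fin 3 → σ} (hr : ∀ l, q (r l) = (1, l))
    (ht : ∀ l, q (t l) = (2, l)) :
    ∃ j, IsInitialChart j φ r t ∧
      ∀ x : P8 K, X (0, k) ∉ x.asHomogeneousIdeal → x ∈ Set.range j := by
  have hu : IsUnit (φ.toRingHom (X (0, k))) := by
    change IsUnit (φ (X (0, k)))
    rw [hk]; exact isUnit_one
  have hpt : IsPt φ.toRingHom _ := ⟨k, hu, rfl⟩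
  obtain ⟨h₁, h₂⟩ := isOpenImmersion_of_coordinates φ hk q hq hq' hpt
  have hrow₁ : ∀ l, φ (X (1, l)) = X (r l) := fun l => by rw [← hr, hq]
  have hrow₂ : ∀ l, φ (X (2, l)) = X (t l) := fun l => by rw [← ht, hq]
  refine ⟨_, ⟨⟨h₁, ?_, ⟨k, hk⟩, ⟨0, by rw [hrow₁]; exact X_ne_zero _⟩⟩, fun l l' h => ?_,
    fun l l' h => ?_, fun l l' h => ?_, hrow₁, hrow₂⟩, h₂⟩
  · change IsPt φ.toRingHom (_ ≫ 𝟙 _)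
    rwa [Category.comp_id]
  · have := congrArg q h
    rw [hr, ht] at this
    simp at this
  · have := congrArg q h
    rw [hr, hr] at this
    exact congrArg Prod.snd this
  · have := congrArg q h
    rw [ht, ht] at this
    exact congrArg Prod.snd this

lemma exists_isInitialChart_mem {x : P8 K} (hx : x ∉ rowZero K 0) :
    ∃ (σ : Type) (j : Spec (CommRingCat.of (MvPolynomial σ K)) ⟶ P8 K)
      (φ : MatrixCoordRing K →ₐ[K] MvPolynomial σ K) (r t : Fin 3 → σ) (y : _),
      IsInitialChart j φ r t ∧ j y = x := by
  obtain ⟨k, hk⟩ := exists_X_zero_notMem hx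
  let σ := {p : Fin 3 × Fin 3 // p ≠ (0, k)}
  let φ : MatrixCoordRing K →ₐ[K] MvPolynomial σ K :=
    aeval fun p => if h : p = (0, k) then 1 else X ⟨p, h⟩
  obtain ⟨j, h₁, h₂⟩ := exists_isInitialChart φ (k := k) (by simp [φ]) Subtype.val
    (fun i => by simp [φ, i.2]) (fun p hp => ⟨⟨p, hp⟩, rfl⟩)
    (r := fun l => ⟨(1, l), by simp⟩) (t := fun l => ⟨(2, l), by simp⟩) (fun _ => rfl)
    fun _ => rfl
  obtain ⟨y, hy⟩ := h₂ x hk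
  exact ⟨σ, j, φ, _, _, y, h₁, hy⟩

variable (K) in
/-- The standard chart of the space of matrices. -/
def initialHom : MatrixCoordRing K →ₐ[K] ChartRing K :=
  aeval fun p : Fin 3 × Fin 3 =>
    (!![1, X 0, X 1; X 2, X 3, X 4; X 5, X 6, X 7] : Matrix (Fin 3) (Fin 3) (ChartRing K)) p.1 p.2

lemma exists_isInitialChart_initialHom :
    ∃ j, IsInitialChart j (initialHom K) ![2, 3, 4] ![5, 6, 7] := by
  obtain ⟨j, hj, -⟩ := exists_isInitialChart (initialHom K) (k := 0) (by simp [initialHom])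
    ![(0, 1), (0, 2), (1, 0), (1, 1), (1, 2), (2, 0), (2, 1), (2, 2)]
    (fun i => by fin_cases i <;> simp [initialHom]) (by decide)
    (r := ![2, 3, 4]) (t := ![5, 6, 7]) (fun l => by fin_cases l <;> rfl)
    (fun l => by fin_cases l <;> rfl)
  exact ⟨j, hj⟩

variable {j : Spec (CommRingCat.of (MvPolynomial σ K)) ⟶ P8 K}
  {φ : MatrixCoordRing K →ₐ[K] MvPolynomial σ K} {r t : Fin 3 → σ}
  {y : Spec (CommRingCat.of (MvPolynomial σ K))}

lemma IsInitialChart.mem_rowZero_one (h : IsInitialChart j φ r t)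
    (y : Spec (CommRingCat.of (MvPolynomial σ K))) :
    j y ∈ rowZero K 1 ↔ y ∈ coordLocus K (Set.range r) := by
  refine (h.isPt.apply_mem_rowZero_iff 1 y).trans ?_
  rw [mem_coordLocus_range]
  exact forall_congr' fun k => by rw [← h.row₁]; rfl

lemma IsInitialChart.mem_rowZero_two (h : IsInitialChart j φ r t)
    (y : Spec (CommRingCat.of (MvPolynomial σ K))) :
    j y ∈ rowZero K 2 ↔ y ∈ coordLocus K (Set.range t) := by
  refine (h.isPt.apply_mem_rowZero_iff 2 y).trans ?_
  rw [mem_coordLocus_range]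
  exact forall_congr' fun k => by rw [← h.row₂]; rfl

lemma IsInitialChart.mem_cuspLocus (h : IsInitialChart j φ r t)
    (y : Spec (CommRingCat.of (MvPolynomial σ K))) :
    j y ∈ cuspLocus K ↔ y ∈ coordLocus K (Set.range r ∪ Set.range t) := by
  refine (and_congr (h.mem_rowZero_one y) (h.mem_rowZero_two y)).trans ?_
  constructor
  · rintro ⟨h₁, h₂⟩ s (hs | hs)
    exacts [h₁ s hs, h₂ s hs]
  · exact fun h' => ⟨fun s hs => h' s (Or.inl hs), fun s hs => h' s (Or.inr hs)⟩

variable {V' : Scheme.{u}} {β : V' ⟶ P8 K}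
  {j' : Spec (CommRingCat.of (MvPolynomial σ K)) ⟶ V'}

lemma transform_initial_blowup (β : V' ⟶ (initial K).V) (W : Closeds (P8 K)) :
    ((initial K).blowup β).transform W = properTransform β (cuspLocus K) W := by
  change properTransform (β ≫ 𝟙 _) _ _ = _
  rw [Category.comp_id]

lemma IsInitialChart.isDirectedChart_blowup (h : IsInitialChart j φ r t) (k₀ : Fin 3)
    (hj' : j' ≫ β = blowupMap K (Set.range r ∪ Set.range t) (r k₀) ≫ j)
    (hc : ((initial K).blowup β).IsCoordChart j'
      ((blowupHom K (Set.range r ∪ Set.range t) (r k₀)).comp φ)) :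
    ((initial K).blowup β).IsDirectedChart j'
      ((blowupHom K (Set.range r ∪ Set.range t) (r k₀)).comp φ) 1 (r k₀) t := by
  have : IsOpenImmersion j := h.isOpenImmersion
  have : IsOpenImmersion j' := hc.isOpenImmersion
  have hi : r k₀ ∈ Set.range r ∪ Set.range t := Or.inl ⟨k₀, rfl⟩
  have hexc := mem_preimageClosed_chart hi hj' h.mem_cuspLocus
  have hdir : ∀ y, j' y ∈ properTransform β (cuspLocus K) (rowZero K 2) ↔
      y ∈ coordLocus K (Set.range t) := fun y => by
    rw [mem_properTransform_chart_of_coordLocus hi hj' h.mem_cuspLocus h.mem_rowZero_two]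
    exact and_iff_right fun ⟨k, hk⟩ => h.ne k _ hk
  refine { hc with
    ne := fun k => h.ne k _
    injective := h.injective_t
    row₁ := ⟨fun k => if k = k₀ then 1 else X (r k), fun k => ?_, k₀, if_pos rfl⟩
    row₂ := fun k => ?_
    exc := hexc
    dir := hdir
    center := fun y => ?_
    rest := fun y hy => ?_ }
  · rw [AlgHom.comp_apply, h.row₁]
    beta_reduce
    split_ifs with hk
    · rw [hk, blowupHom_X_self, mul_one]
    · rw [blowupHom_X_of_mem (show r k ∈ Set.range r ∪ Set.range t from Or.inl ⟨k, rfl⟩)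
        (h.injective_r.ne hk), mul_comm]
  · rw [AlgHom.comp_apply, h.row₂,
      blowupHom_X_of_mem (show t k ∈ Set.range r ∪ Set.range t from Or.inr ⟨k, rfl⟩) (h.ne k _)]
    ring
  · refine (and_congr (hexc y) (hdir y)).trans ?_
    rw [mem_coordLocus_insert, mem_coordLocus_singleton]
  · exact notMem_properTransform_chart (W := ⊥ ⊔ ⊥) hj' (fun y hy => hy.elim id id) y hy

/-- The remaining charts of the first blow-up. -/
lemma IsInitialChart.isDirectedOff_blowup [Infinite K] (hm : 1 ≤ m) (hmn : m < n)
    (h : IsInitialChart j φ r t) (k₀ : Fin 3)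
    (hj' : j' ≫ β = blowupMap K (Set.range r ∪ Set.range t) (t k₀) ≫ j)
    (hc : ((initial K).blowup β).IsCoordChart j'
      ((blowupHom K (Set.range r ∪ Set.range t) (t k₀)).comp φ))
    (y : Spec (CommRingCat.of (MvPolynomial σ K))) :
    j' y ∉ ((initial K).blowup β).center ∧ IsDirectedOff m n ((initial K).blowup β) 1 (j' y) := by
  have : IsOpenImmersion j := h.isOpenImmersion
  have : IsOpenImmersion j' := hc.isOpenImmersion
  have hio : @IsOpenImmersion _ ((initial K).blowup β).V j' := hc.isOpenImmersion
  have hi : t k₀ ∈ Set.range r ∪ Set.range t := Or.inr ⟨k₀, rfl⟩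
  have hexc : ∀ y, j' y ∈ ((initial K).blowup β).exc ↔ _ :=
    mem_preimageClosed_chart hi hj' h.mem_cuspLocus
  have hdir : ∀ y, j' y ∉ ((initial K).blowup β).dir := fun y hy =>
    ((mem_properTransform_chart_of_coordLocus hi hj' h.mem_cuspLocus h.mem_rowZero_two y).1 hy).1
      ⟨k₀, rfl⟩
  have hrest : ∀ y, j' y ∉ ((initial K).blowup β).rest :=
    notMem_properTransform_chart (W := ⊥ ⊔ ⊥) hj' (fun y hy => hy.elim id id)
  have htr : ∀ y, j' y ∈ ((initial K).blowup β).transform (rowZero K 1) ↔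
      y ∈ coordLocus K (Set.range r) := fun y => by
    refine (iff_of_eq (congrArg (j' y ∈ ·) (transform_initial_blowup β _))).trans ?_
    exact (mem_properTransform_chart_of_coordLocus hi hj' h.mem_cuspLocus
      h.mem_rowZero_one y).trans (and_iff_right fun ⟨k, hk⟩ => h.ne _ k hk.symm)
  let ψ := blowupHom K (Set.range r ∪ Set.range t) (t k₀)
  let w : Fin 3 → MvPolynomial σ K := fun k => if k = k₀ then 1 else X (t k)
  have hrow₁ : ∀ k, (ψ.comp φ).toRingHom (X (1, k)) = X (t k₀) * X (r k) := fun k => by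
    change ψ (φ _) = _
    rw [h.row₁, blowupHom_X_of_mem (show r k ∈ Set.range r ∪ Set.range t from Or.inl ⟨k, rfl⟩)
      (h.ne _ _).symm, mul_comm]
  have hrow₂ : ∀ k, (ψ.comp φ).toRingHom (X (2, k)) = X (t k₀) * w k := fun k => by
    change ψ (φ _) = _
    rw [h.row₂]
    simp only [w]
    split_ifs with hk
    · rw [hk, blowupHom_X_self, mul_one]
    · rw [blowupHom_X_of_mem (show t k ∈ Set.range r ∪ Set.range t from Or.inr ⟨k, rfl⟩)
        (h.injective_t.ne hk), mul_comm]
  have h1 : ∀ w : MvPolynomial σ K, w = 1 → w ∉ y.asIdeal := by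
    rintro _ rfl; exact y.isPrime.one_notMem
  have hw : w k₀ = 1 := if_pos rfl
  refine ⟨fun hy => hdir y hy.2, ?_, fun h' => Or.inr ?_⟩
  · by_cases hr : ∀ k, (X (r k) : MvPolynomial σ K) ∈ y.asIdeal
    · exact Or.inr (Or.inr (Or.inl ((htr y).2 (mem_coordLocus_range.2 hr))))
    · push Not at hr
      obtain ⟨k₁, hk₁⟩ := hr
      refine Or.inr (Or.inr (Or.inr ?_))
      refine hasGerm_of_chart hc.isPt y _ fun R _ θ hθ hu => ?_
      refine ⟨θ (X (t k₀)), fun k => θ (X (r k)), fun k => θ (w k),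
        (map_ne_zero_iff θ hθ).2 (X_ne_zero _), fun he => ?_, fun k => ?_, fun k => ?_,
        ⟨k₁, (hu _).2 hk₁⟩, fun hk => ?_⟩
      · refine (hexc y).2 (mem_coordLocus_singleton.2 ?_)
        by_contra h'; exact he ((hu _).2 h')
      · exact (congrArg θ (hrow₁ k)).trans (map_mul _ _ _)
      · exact (congrArg θ (hrow₂ k)).trans (by rw [map_mul, pow_one])
      · exact (hk k₀ (by simp only [hw, map_one, isUnit_one])).elim
  · obtain ⟨l, rfl⟩ := Nat.exists_eq_add_of_lt hmn
    -- The exceptional divisor has the vector `(1, 1)` with defect `n - m = l + 1`, which is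
    -- positive.
    have hpow : (1 : MvPolynomial σ K) * X (t k₀) ^ (m + l + 1) = X (t k₀) ^ m * X (t k₀) ^ (l + 1) := by
      ring
    have key := fun hd => notMem_baseSet_of_pow_eq (c := (initial K).blowup β) (y := y) hc.isPt hm
      hmn (fun _ => rfl) hrow₁ hrow₂ (hc.row_zero.imp fun k hk => h1 _ hk) ⟨k₀, h1 _ hw⟩
      (h1 _ rfl) hpow hd
    rcases h' with h' | h' | h' | ⟨h', -⟩
    · exact (hrest y h').elim
    · exact key (Or.inr (mem_coordLocus_range.1 ((htr y).1 h')))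
    · exact (hdir y h').elim
    · exact key (Or.inl (Ideal.pow_mem_of_mem _ (mem_coordLocus_singleton.1 ((hexc y).1 h')) _
        l.succ_pos))

end

lemma mem_transform_initial {x : P8 K} (hx : x ∉ cuspLocus K) (W : Closeds (P8 K)) :
    x ∈ (initial K).transform W ↔ x ∈ W := by
  constructor
  · intro h
    have : (properTransform (𝟙 (P8 K)) (cuspLocus K) W : Set (P8 K)) ⊆ W :=
      closure_minimal (fun y hy => hy.1) W.2
    exact this h
  · exact fun h => subset_closure ⟨h, hx⟩

/-- Off `B` no factor has to be removed, so the criteria apply with `r = t = 1`: if one of the last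
two rows vanishes at the point, the other does not. -/
lemma isDirectedOff_initial [Infinite K] (hm : 1 ≤ m) (hmn : m < n) {x : P8 K}
    (hx : x ∉ cuspLocus K) : IsDirectedOff m n (initial K) 1 x := by
  by_cases h0 : x ∈ rowZero K 0
  · exact ⟨Or.inr (Or.inl h0), fun _ => Or.inl h0⟩
  obtain ⟨σ, j, φ, r, t, y, h, rfl⟩ := exists_isInitialChart_mem h0
  have hio : @IsOpenImmersion _ (initial K).V j := h.isOpenImmersion
  have h₁ := h.mem_rowZero_one y
  have h₂ := h.mem_rowZero_two y
  rw [mem_coordLocus_range] at h₁ h₂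
  have hr₁ : ∀ k, φ.toRingHom (X (1, k)) = 1 * X (r k) := fun k => (h.row₁ k).trans (one_mul _).symm
  have hr₂ : ∀ k, φ.toRingHom (X (2, k)) = 1 * X (t k) := fun k => (h.row₂ k).trans (one_mul _).symm
  have h1 : ∀ w : MvPolynomial σ K, w = 1 → w ∉ y.asIdeal := by
    rintro _ rfl; exact y.isPrime.one_notMem
  refine ⟨?_, fun h' => Or.inr ?_⟩
  · by_cases hr : j y ∈ rowZero K 1
    · exact Or.inr (Or.inr (Or.inl ((mem_transform_initial hx _).2 hr)))
    · rw [h₁] at hr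
      push Not at hr
      obtain ⟨k₁, hk₁⟩ := hr
      refine Or.inr (Or.inr (Or.inr ?_))
      refine hasGerm_of_chart h.isPt y _ fun R _ θ hθ hu => ?_
      have : Nontrivial R := hθ.nontrivial
      refine ⟨1, fun k => θ (X (r k)), fun k => θ (X (t k)), one_ne_zero,
        fun h => (h isUnit_one).elim, fun k => ?_, fun k => ?_, ⟨k₁, (hu _).2 hk₁⟩,
        fun hk => h₂.2 fun k => ?_⟩
      · exact (congrArg θ (hr₁ k)).trans (by rw [map_mul, map_one])
      · exact (congrArg θ (hr₂ k)).trans (by rw [map_mul, map_one, one_pow])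
      · by_contra h'; exact hk k ((hu _).2 h')
  · have hpow : ∀ a b : ℕ, (1 : MvPolynomial σ K) * 1 ^ a = 1 ^ b * 1 := fun a b => by simp
    rcases h' with h' | h' | h' | ⟨h', -⟩
    · exact h'.elim
    · have hr := (mem_transform_initial hx _).1 h'
      have ht : ∃ k, (X (t k) : MvPolynomial σ K) ∉ y.asIdeal := by
        by_contra! ht
        exact hx ⟨hr, h₂.2 ht⟩
      exact notMem_baseSet_of_pow_eq (c := initial K) h.isPt hm hmn (fun _ => rfl) hr₁ hr₂
        (h.row_zero.imp fun k hk => h1 _ hk) ht (h1 _ rfl) (hpow n m) (Or.inr (h₁.1 hr))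
    · have hr : ∃ k, (X (r k) : MvPolynomial σ K) ∉ y.asIdeal := by
        by_contra! hr
        exact hx ⟨h₁.2 hr, h'⟩
      exact notMem_baseSet_of_pow_eq' (c := initial K) h.isPt hm hmn hr₁ hr₂ hr (h1 _ rfl)
        (hpow m n) (Or.inr (h₂.1 h'))
    · exact h'.elim

lemma isDirectedStage_initial_blowup [Infinite K] (hm : 1 ≤ m) (hmn : m < n) {V' : Scheme.{u}}
    {β : V' ⟶ (initial K).V} (hβ : IsBlowup β (initial K).center) :
    IsDirectedStage m n ((initial K).blowup β) 1 := by
  have hd : orderDefect m n (1, 1) ≠ 0 := by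
    simp only [orderDefect]; zify at *; lia
  have hchart : ∀ x ∈ (initial K).center, ∃ (σ : Type)
      (j : Spec (CommRingCat.of (MvPolynomial σ K)) ⟶ P8 K)
      (φ : MatrixCoordRing K →ₐ[K] MvPolynomial σ K) (r t : Fin 3 → σ) (y : _),
      IsInitialChart j φ r t ∧ j y = x := fun x hx =>
    exists_isInitialChart_mem (notMem_rowZero_zero_of_mem_cuspLocus hx)
  have key : ∀ x' : V', β x' ∈ (initial K).center →
      (∃ (σ : Type) (j : Spec (CommRingCat.of (MvPolynomial σ K)) ⟶ V')
        (φ : MatrixCoordRing K →ₐ[K] MvPolynomial σ K) (u : σ) (T : Fin 3 → σ) (y : _),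
        ((initial K).blowup β).IsDirectedChart j φ 1 u T ∧ j y = x') ∨
      (x' ∉ ((initial K).blowup β).center ∧ IsDirectedOff m n ((initial K).blowup β) 1 x') := by
    intro x' hx'
    obtain ⟨σ, j, φ, r, t, y, h, hy⟩ := hchart _ hx'
    obtain ⟨i, hi, j', y', hj', hy', hc⟩ :=
      h.toIsCoordChart.exists_blowup_mem hβ h.mem_cuspLocus hy
    rcases hi with ⟨k₀, rfl⟩ | ⟨k₀, rfl⟩
    · exact Or.inl ⟨σ, j', _, _, _, y', h.isDirectedChart_blowup k₀ hj' hc, hy'⟩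
    · exact Or.inr (hy' ▸ h.isDirectedOff_blowup hm hmn k₀ hj' hc y')
  refine ⟨?_, le_rfl, fun x' hx' => ?_, ?_, fun x' hx' => ?_⟩
  · refine isGood_initial.blowup_of_charts hβ fun x hx => ?_
    obtain ⟨σ, j, φ, r, t, y, h, hy⟩ := hchart x hx
    exact ⟨σ, j, φ, _, y, h.toIsCoordChart, h.mem_cuspLocus, hy⟩
  · exact (key x' hx'.1).resolve_right fun h' => h'.1 hx'
  · obtain ⟨j, h⟩ := exists_isInitialChart_initialHom (K := K)
    obtain ⟨j', hj', hc⟩ := h.toIsCoordChart.exists_blowup hβ h.mem_cuspLocus (i := 2)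
      (Or.inl ⟨0, rfl⟩)
    have h' := h.isDirectedChart_blowup 0 hj' hc
    have hφ : (blowupHom K (Set.range ![2, 3, 4] ∪ Set.range ![5, 6, 7]) 2).comp (initialHom K) =
        chartOneHom (K := K) 1 := by
      apply MvPolynomial.algHom_ext
      rintro ⟨i, k⟩
      fin_cases i <;> fin_cases k <;>
        simp [chartOneHom, chartMatrixOne, initialHom, blowupHom] <;> ring
    exact ⟨j', hφ ▸ h'⟩
  · by_cases hx : β x' ∈ (initial K).center
    · rcases key x' hx with ⟨σ, j, φ, u, T, y, h, rfl⟩ | h'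
      · exact h.isDirectedOff hm hmn le_rfl (by lia) hx'
      · exact h'.2
    · have hmem := fun W =>
        IsBlowup.mem_properTransform_iff (β := β) (Z := (initial K).center) x' hx W
      have hoff := isDirectedOff_initial (K := K) hm hmn hx
      refine ⟨?_, fun h' => ?_⟩
      · rcases hoff.status with h' | h' | h' | h'
        · exact h'.elim
        · exact Or.inr (Or.inl h')
        · exact Or.inr (Or.inr (Or.inl (hβ.mem_properTransform_comp x' hx _ h')))
        · exact Or.inr (Or.inr (Or.inr
            ((DirectedRows.mono h' (fun h3 => h3.elim) fun h3 => (hmem _).2 h3).blowup hβ hx)))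
      · refine (hoff.base ?_).imp_right notMem_baseSet_blowup
        rcases h' with h' | h' | h' | ⟨h', -⟩
        · exact ((hmem _).1 h').elim (fun h3 => h3.elim) fun h3 => h3.elim
        · exact Or.inr (Or.inl (properTransform_comp_le _ _ h'))
        · exact Or.inr (Or.inr (Or.inl ((hmem _).1 h')))
        · exact (hx h').elim

end BlowupStage

end

/-! ### Moving points into the standard chart -/

section

variable {K : Type u} [Field K]

lemma isPt_matrixPoint {R : Type u} [CommRing R] [Algebra K R] (M : Matrix (Fin 3) (Fin 3) R)
    (h : M 0 0 = 1) :
    IsPt (aeval (R := K) fun p : Fin 3 × Fin 3 => M p.1 p.2).toRingHom (matrixPoint K M h) := by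
  have hu : IsUnit ((aeval (R := K) fun p : Fin 3 × Fin 3 => M p.1 p.2).toRingHom (X (0, 0))) := by
    change IsUnit (aeval (R := K) (fun p : Fin 3 × Fin 3 => M p.1 p.2) (X (0, 0)))
    rw [aeval_X, h]
    exact isUnit_one
  exact ⟨0, hu, fromOfGlobalSections_eq _ _ hu _ _⟩

/-- A nonzero vector is the first column of an invertible matrix. -/
lemma exists_GL_col_zero {ξ : Fin 3 → K} (hξ : ξ ≠ 0) :
    ∃ g : GL (Fin 3) K, ∀ l, (g : Matrix (Fin 3) (Fin 3) K) l 0 = ξ l := by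
  obtain ⟨k, hk⟩ := Function.ne_iff.1 hξ
  suffices h : ∃ M : Matrix (Fin 3) (Fin 3) K, M.det ≠ 0 ∧ ∀ l, M l 0 = ξ l by
    obtain ⟨M, hM, h⟩ := h
    exact ⟨Matrix.GeneralLinearGroup.mkOfDetNeZero M hM, h⟩
  fin_cases k
  · refine ⟨!![ξ 0, 0, 0; ξ 1, 1, 0; ξ 2, 0, 1], ?_, fun l => by fin_cases l <;> rfl⟩
    simpa [Matrix.det_fin_three] using hk
  · refine ⟨!![ξ 0, 1, 0; ξ 1, 0, 0; ξ 2, 0, 1], ?_, fun l => by fin_cases l <;> rfl⟩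
    simpa [Matrix.det_fin_three] using hk
  · refine ⟨!![ξ 0, 1, 0; ξ 1, 0, 1; ξ 2, 0, 0], ?_, fun l => by fin_cases l <;> rfl⟩
    simpa [Matrix.det_fin_three] using hk

/-- Invertible monomial substitutions over a commutative group. -/
lemma exists_monomial_eq {G : Type*} [CommGroup G] {a b : ℕ × ℕ}
    (h : (a.1 * b.2 : ℤ) - a.2 * b.1 = 1 ∨ (a.1 * b.2 : ℤ) - a.2 * b.1 = -1) (α β : G) :
    ∃ ε δ : G, ε ^ a.1 * δ ^ b.1 = α ∧ ε ^ a.2 * δ ^ b.2 = β := by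
  obtain ⟨s, hs⟩ : ∃ s : ℤ, s * ((a.1 * b.2 : ℤ) - a.2 * b.1) = 1 := by
    rcases h with h | h
    exacts [⟨1, by rw [h]; rfl⟩, ⟨-1, by rw [h]; rfl⟩]
  -- The exponents are the entries of the inverse of the unimodular exponent matrix, with `s` its
  -- determinant.
  refine ⟨α ^ (s * b.2) * β ^ (-(s * b.1)), α ^ (-(s * a.2)) * β ^ (s * a.1), ?_, ?_⟩
  · simp only [← zpow_natCast, mul_zpow, ← zpow_mul]
    rw [mul_mul_mul_comm, ← zpow_add, ← zpow_add]
    have h1 : s * b.2 * a.1 + -(s * a.2) * b.1 = 1 := by linear_combination hs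
    have h2 : -(s * b.1) * a.1 + s * a.1 * b.1 = 0 := by ring
    rw [h1, h2, zpow_one, zpow_zero, mul_one]
  · simp only [← zpow_natCast, mul_zpow, ← zpow_mul]
    rw [mul_mul_mul_comm, ← zpow_add, ← zpow_add]
    have h1 : s * b.2 * a.2 + -(s * a.2) * b.2 = 0 := by ring
    have h2 : -(s * b.1) * a.2 + s * a.1 * b.2 = 1 := by linear_combination hs
    rw [h1, h2, zpow_one, zpow_zero, one_mul]

namespace BlowupStage

variable {c : BlowupStage K}

/-- The values `v` define a morphism to the standard chart which has, up to the scalar `ω`, the same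
homogeneous coordinates as the translated germ. Tameness lifts this equality from `ℙ⁸` to the stage;
`h₁` puts the generic point off `B`. -/
lemma IsGood.canBeMovedInto_of_eq (h : c.IsGood)
    {ι : Spec (CommRingCat.of (ChartRing K)) ⟶ c.V} {φ₀ : MatrixCoordRing K →ₐ[K] ChartRing K}
    (hι : IsPt φ₀.toRingHom (ι ≫ c.π)) (h₀ : φ₀ (X (0, 0)) = 1)
    {R : Type u} [CommRing R] [IsDomain R] {j : Spec (CommRingCat.of R) ⟶ c.V}
    {φ : MatrixCoordRing K →+* R} (hφ : IsPt φ (j ≫ c.π)) (h₁ : ∃ k, φ (X (1, k)) ≠ 0)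
    (g : GL (Fin 3) K) (ω : Rˣ) (v : Fin 8 → R)
    (hv : ∀ p, φ (rightMulAlgHom (g : Matrix (Fin 3) (Fin 3) K) (X p)) =
      ω * eval₂Hom (φ.comp C) v (φ₀ (X p))) (y : Spec (CommRingCat.of R)) :
    c.CanBeMovedInto (j y) (Set.range ι) := by
  obtain ⟨τ, hτ⟩ := h.exists_lift g
  refine ⟨g, τ, hτ.isLift, ?_⟩
  let ψ : ChartRing K →+* R := eval₂Hom (φ.comp C) v
  have hu : IsUnit (φ (rightMulAlgHom (g : Matrix (Fin 3) (Fin 3) K) (X (0, 0)))) := by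
    rw [hv, h₀, map_one, mul_one]
    exact ω.isUnit
  have hpt := hφ.rightMul g hu
  have hpt' := (hι.comp ψ).scale (φ' := φ.comp
    (rightMulAlgHom (g : Matrix (Fin 3) (Fin 3) K) : MatrixCoordRing K →+* MatrixCoordRing K))
    ω.isUnit (fun a => ?_) hv
  · have heq : (j ≫ τ) ≫ c.π = (Spec.map (CommRingCat.ofHom ψ) ≫ ι) ≫ c.π := by
      rw [Category.assoc, Category.assoc, hτ.isLift, ← Category.assoc]
      exact hpt.unique hpt'
    have hext : j ≫ τ = Spec.map (CommRingCat.ofHom ψ) ≫ ι := by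
      refine h.tame.hom_ext _ _ _ heq fun hc => ?_
      rw [← Scheme.Hom.comp_apply, Category.assoc, hτ.isLift, ← Category.assoc,
        Scheme.Hom.comp_apply, rightMul_mem_cuspLocus, hφ.apply_mem_cuspLocus_iff] at hc
      obtain ⟨k, hk⟩ := h₁
      exact hk (hc.1 k)
    rw [← Scheme.Hom.comp_apply, hext, Scheme.Hom.comp_apply]
    exact ⟨_, rfl⟩
  · change φ (rightMulAlgHom (g : Matrix (Fin 3) (Fin 3) K) (C a)) = ψ (φ₀ (C a))
    have e1 : rightMulAlgHom (g : Matrix (Fin 3) (Fin 3) K) (C a) = C a := AlgHom.commutes _ a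
    have e2 : φ₀ (C a) = C a := AlgHom.commutes _ a
    rw [e1, e2]
    simp [ψ]

lemma map_rightMulAlgHom_X {R : Type u} [CommRing R] (φ : MatrixCoordRing K →+* R)
    (g : Matrix (Fin 3) (Fin 3) K) {i : Fin 3} {r : R} {w : Fin 3 → R}
    (hw : ∀ k, φ (X (i, k)) = r * w k) (k : Fin 3) :
    φ (rightMulAlgHom g (X (i, k))) = r * ∑ l, φ (C (g l k)) * w l := by
  simp only [rightMulAlgHom, aeval_X, map_sum, map_mul, hw, Finset.mul_sum]
  exact Finset.sum_congr rfl fun l _ => by ring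

/-- The last two rows are exactly divisible by the monomials with the exponents `a.1`, `b.1` and
`a.2`, `b.2` in two elements. -/
def MonomialRows (a b : ℕ × ℕ) (R : Type u) [CommRing R] (φ : MatrixCoordRing K →+* R) : Prop :=
  ∃ (p q : R) (w₁ w₂ : Fin 3 → R), p ≠ 0 ∧ q ≠ 0 ∧
    (∀ k, φ (X (1, k)) = p ^ a.1 * q ^ b.1 * w₁ k) ∧
    (∀ k, φ (X (2, k)) = p ^ a.2 * q ^ b.2 * w₂ k) ∧ (∃ k, IsUnit (w₁ k)) ∧ ∃ k, IsUnit (w₂ k)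

lemma MonomialRows.symm {a b : ℕ × ℕ} {R : Type u} [CommRing R] {φ : MatrixCoordRing K →+* R}
    (h : MonomialRows a b R φ) : MonomialRows b a R φ := by
  obtain ⟨p, q, w₁, w₂, hp, hq, h₁, h₂, h⟩ := h
  exact ⟨q, p, w₁, w₂, hq, hp, fun k => by rw [h₁, mul_comm (p ^ _)],
    fun k => by rw [h₂, mul_comm (p ^ _)], h⟩

lemma PowerRows.monomialRows {a b : ℕ × ℕ} {Z : Prop} {R : Type u} [CommRing R]
    {φ : MatrixCoordRing K →+* R} (h : PowerRows a Z R φ) : MonomialRows a b R φ := by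
  obtain ⟨p, w₁, w₂, hp, -, h₁, h₂, h⟩ := h
  have : Nontrivial R := ⟨p, 0, hp⟩
  exact ⟨p, 1, w₁, w₂, hp, one_ne_zero, fun k => by rw [h₁, one_pow, mul_one],
    fun k => by rw [h₂, one_pow, mul_one], h⟩

/-- A general first column of `g` keeps the first entries of finitely many rows out of the maximal
ideal at once. -/
lemma exists_unit_generic [Infinite K] {R : Type u} [CommRing R] [IsLocalRing R]
    (f : K →+* R) {κ : Type} [Finite κ] [Nonempty κ] (w : κ → Fin 3 → R)
    (hw : ∀ a, ∃ k, IsUnit (w a k)) :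
    ∃ g : GL (Fin 3) K, ∀ a, IsUnit (∑ l, f ((g : Matrix (Fin 3) (Fin 3) K) l 0) * w a l) := by
  obtain ⟨ξ, hξ⟩ := exists_generic_vector f (IsLocalRing.maximalIdeal R) w fun a =>
    (hw a).imp fun k hk => by rwa [IsLocalRing.mem_maximalIdeal, mem_nonunits_iff, not_not]
  have hξ' : ∀ a, IsUnit (∑ l, f (ξ l) * w a l) := fun a => by
    have := hξ a
    rwa [IsLocalRing.mem_maximalIdeal, mem_nonunits_iff, not_not] at this
  obtain ⟨g, hg⟩ := exists_GL_col_zero (ξ := ξ) (by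
    rintro rfl
    obtain ⟨a⟩ := ‹Nonempty κ›
    have := hξ' a
    simp at this)
  exact ⟨g, fun a => by simpa only [hg] using hξ' a⟩

lemma exists_isUnit_row_zero_of_isPt {R : Type u} [CommRing R] {φ : MatrixCoordRing K →+* R}
    {u : Spec (CommRingCat.of R) ⟶ P8 K} (h : IsPt φ u) : ∃ k, IsUnit (φ (X (0, k))) := by
  obtain ⟨k, hk, -⟩ := h
  exact ⟨k, hk⟩

/-- After a general `g` the three rows have unit first entries `ω₀`, `ω₁`, `ω₂` apart from the
monomials. Normalizing these entries to 1 multiplies the monomials by two arbitrary units, which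
unimodularity allows to be absorbed into `p` and `q`. -/
lemma IsGood.canBeMovedInto_of_monomialRows [Infinite K] (h : c.IsGood) {a b : ℕ × ℕ}
    (hab : (a.1 * b.2 : ℤ) - a.2 * b.1 = 1 ∨ (a.1 * b.2 : ℤ) - a.2 * b.1 = -1)
    {ι : Spec (CommRingCat.of (ChartRing K)) ⟶ c.V}
    (hι : IsPt (chartHom (X 2 ^ a.1 * X 5 ^ b.1) (X 2 ^ a.2 * X 5 ^ b.2)).toRingHom (ι ≫ c.π))
    {x : c.V} (hx : c.HasGerm x (MonomialRows a b)) : c.CanBeMovedInto x (Set.range ι) := by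
  obtain ⟨R, _, _, _, j, φ, rfl, hφ, p, q, w₁, w₂, hp, hq, h₁, h₂, hw₁, hw₂⟩ := hx
  have h₀ : ∀ k, φ (X (0, k)) = 1 * φ (X (0, k)) := fun k => (one_mul _).symm
  obtain ⟨g, hg⟩ := exists_unit_generic (φ.comp C) ![fun k => φ (X (0, k)), w₁, w₂] (by
    intro i; fin_cases i; exacts [exists_isUnit_row_zero_of_isPt hφ, hw₁, hw₂])
  obtain ⟨ω₀, hω₀⟩ := hg 0
  obtain ⟨ω₁, hω₁⟩ := hg 1
  obtain ⟨ω₂, hω₂⟩ := hg 2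
  simp only [Matrix.cons_val, RingHom.comp_apply] at hω₀ hω₁ hω₂
  have e₀ := map_rightMulAlgHom_X φ (g : Matrix (Fin 3) (Fin 3) K) h₀
  have e₁ := map_rightMulAlgHom_X φ (g : Matrix (Fin 3) (Fin 3) K) h₁
  have e₂ := map_rightMulAlgHom_X φ (g : Matrix (Fin 3) (Fin 3) K) h₂
  generalize hW₀ : (fun k => ∑ l, φ (C ((g : Matrix (Fin 3) (Fin 3) K) l k)) * φ (X (0, l))) = W₀
  generalize hW₁ : (fun k => ∑ l, φ (C ((g : Matrix (Fin 3) (Fin 3) K) l k)) * w₁ l) = W₁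
  generalize hW₂ : (fun k => ∑ l, φ (C ((g : Matrix (Fin 3) (Fin 3) K) l k)) * w₂ l) = W₂
  replace e₀ := fun k => (e₀ k).trans (congrArg (_ * ·) (congrFun hW₀ k))
  replace e₁ := fun k => (e₁ k).trans (congrArg (_ * ·) (congrFun hW₁ k))
  replace e₂ := fun k => (e₂ k).trans (congrArg (_ * ·) (congrFun hW₂ k))
  replace hω₀ := hω₀.trans (congrFun hW₀ 0)
  replace hω₁ := hω₁.trans (congrFun hW₁ 0)
  replace hω₂ := hω₂.trans (congrFun hW₂ 0)
  -- The chart matrix has upper left entry 1, so everything is measured relative to `ω₀`; `p * ε`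
  -- and `q * δ` become the coordinates `s₃` and `s₆`.
  obtain ⟨ε, δ, hε, hδ⟩ := exists_monomial_eq hab (ω₁ * ω₀⁻¹) (ω₂ * ω₀⁻¹)
  replace hε : (ε : R) ^ a.1 * (δ : R) ^ b.1 = ω₁ * ↑ω₀⁻¹ := by exact_mod_cast congrArg Units.val hε
  replace hδ : (ε : R) ^ a.2 * (δ : R) ^ b.2 = ω₂ * ↑ω₀⁻¹ := by exact_mod_cast congrArg Units.val hδ
  have i₀ := ω₀.mul_inv
  have i₁ := ω₁.mul_inv
  have i₂ := ω₂.mul_inv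
  refine h.canBeMovedInto_of_eq hι (by simp [chartHom, chartMatrix]) hφ ?_ g ω₀
    ![ω₀⁻¹ * W₀ 1, ω₀⁻¹ * W₀ 2, p * ε, ω₁⁻¹ * W₁ 1, ω₁⁻¹ * W₁ 2, q * δ, ω₂⁻¹ * W₂ 1, ω₂⁻¹ * W₂ 2]
    ?_ _
  · obtain ⟨k, hk⟩ := hw₁
    refine ⟨k, ?_⟩
    rw [h₁]
    exact mul_ne_zero (mul_ne_zero (pow_ne_zero _ hp) (pow_ne_zero _ hq)) hk.ne_zero
  · have f₁ : (ω₀ : R) * ((p * ε) ^ a.1 * (q * δ) ^ b.1) = p ^ a.1 * q ^ b.1 * ω₁ := by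
      rw [mul_pow, mul_pow]
      linear_combination (p ^ a.1 * q ^ b.1 * ω₀) * hε + (p ^ a.1 * q ^ b.1 * ω₁) * i₀
    have f₂ : (ω₀ : R) * ((p * ε) ^ a.2 * (q * δ) ^ b.2) = p ^ a.2 * q ^ b.2 * ω₂ := by
      rw [mul_pow, mul_pow]
      linear_combination (p ^ a.2 * q ^ b.2 * ω₀) * hδ + (p ^ a.2 * q ^ b.2 * ω₂) * i₀
    rintro ⟨i, k⟩
    fin_cases i
    · refine (e₀ k).trans ?_
      fin_cases k
      · simp [chartHom, chartMatrix, hω₀]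
      · simp [chartHom, chartMatrix]
      · simp [chartHom, chartMatrix]
    · refine (e₁ k).trans ?_
      fin_cases k
      · simp [chartHom, chartMatrix]
        linear_combination -f₁ - (p ^ a.1 * q ^ b.1) * hω₁
      · simp [chartHom, chartMatrix]
        linear_combination (-↑ω₁⁻¹ * W₁ 1) * f₁ - (p ^ a.1 * q ^ b.1 * W₁ 1) * i₁
      · simp [chartHom, chartMatrix]
        linear_combination (-↑ω₁⁻¹ * W₁ 2) * f₁ - (p ^ a.1 * q ^ b.1 * W₁ 2) * i₁
    · refine (e₂ k).trans ?_
      fin_cases k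
      · simp [chartHom, chartMatrix]
        linear_combination -f₂ - (p ^ a.2 * q ^ b.2) * hω₂
      · simp [chartHom, chartMatrix]
        linear_combination (-↑ω₂⁻¹ * W₂ 1) * f₂ - (p ^ a.2 * q ^ b.2 * W₂ 1) * i₂
      · simp [chartHom, chartMatrix]
        linear_combination (-↑ω₂⁻¹ * W₂ 2) * f₂ - (p ^ a.2 * q ^ b.2 * W₂ 2) * i₂

/-- Only the first two rows must be normalized: the cofactors of the third row are free coordinates
of the chart and may all vanish at the point. -/
lemma IsGood.canBeMovedInto_of_directedRows [Infinite K] (h : c.IsGood) {a : ℕ} {Z W : Prop}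
    {ι : Spec (CommRingCat.of (ChartRing K)) ⟶ c.V}
    (hι : IsPt (chartOneHom a).toRingHom (ι ≫ c.π))
    {x : c.V} (hx : c.HasGerm x (DirectedRows a Z W)) : c.CanBeMovedInto x (Set.range ι) := by
  obtain ⟨R, _, _, _, j, φ, rfl, hφ, p, w₁, w₂, hp, -, h₁, h₂, hw₁, -⟩ := hx
  have h₀ : ∀ k, φ (X (0, k)) = 1 * φ (X (0, k)) := fun k => (one_mul _).symm
  obtain ⟨g, hg⟩ := exists_unit_generic (φ.comp C) ![fun k => φ (X (0, k)), w₁] (by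
    intro i; fin_cases i; exacts [exists_isUnit_row_zero_of_isPt hφ, hw₁])
  obtain ⟨ω₀, hω₀⟩ := hg 0
  obtain ⟨ω₁, hω₁⟩ := hg 1
  simp only [Matrix.cons_val, RingHom.comp_apply] at hω₀ hω₁
  have e₀ := map_rightMulAlgHom_X φ (g : Matrix (Fin 3) (Fin 3) K) h₀
  have e₁ := map_rightMulAlgHom_X φ (g : Matrix (Fin 3) (Fin 3) K) h₁
  have e₂ := map_rightMulAlgHom_X φ (g : Matrix (Fin 3) (Fin 3) K) h₂
  generalize hW₀ : (fun k => ∑ l, φ (C ((g : Matrix (Fin 3) (Fin 3) K) l k)) * φ (X (0, l))) = W₀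
  generalize hW₁ : (fun k => ∑ l, φ (C ((g : Matrix (Fin 3) (Fin 3) K) l k)) * w₁ l) = W₁
  generalize hW₂ : (fun k => ∑ l, φ (C ((g : Matrix (Fin 3) (Fin 3) K) l k)) * w₂ l) = W₂
  replace e₀ := fun k => (e₀ k).trans (congrArg (_ * ·) (congrFun hW₀ k))
  replace e₁ := fun k => (e₁ k).trans (congrArg (_ * ·) (congrFun hW₁ k))
  replace e₂ := fun k => (e₂ k).trans (congrArg (_ * ·) (congrFun hW₂ k))
  replace hω₀ := hω₀.trans (congrFun hW₀ 0)
  replace hω₁ := hω₁.trans (congrFun hW₁ 0)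
  have i₀ := ω₀.mul_inv
  have i₁ := ω₁.mul_inv
  -- Corrects the third row for the scaling by `ω₀` and for the replacement of `p` by `p * ω₁ *
  -- ω₀⁻¹`.
  let s : Rˣ := ω₀⁻¹ * ((ω₁ * ω₀⁻¹) ^ a)⁻¹
  have hs : (ω₀ : R) * ((p * ω₁ * ↑ω₀⁻¹) ^ a * s) = p ^ a := by
    have : ω₀ * ((ω₁ * ω₀⁻¹) ^ a * s) = 1 := by
      rw [mul_left_comm _ ω₀⁻¹, mul_inv_cancel, mul_one, mul_inv_cancel]
    have := congrArg Units.val this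
    simp only [Units.val_mul, Units.val_pow_eq_pow_val, Units.val_one] at this
    rw [mul_assoc p, mul_pow p]
    linear_combination p ^ a * this
  refine h.canBeMovedInto_of_eq hι (by simp [chartOneHom, chartMatrixOne]) hφ ?_ g ω₀
    ![ω₀⁻¹ * W₀ 1, ω₀⁻¹ * W₀ 2, p * ω₁ * ω₀⁻¹, ω₁⁻¹ * W₁ 1, ω₁⁻¹ * W₁ 2, s * W₂ 0, s * W₂ 1,
      s * W₂ 2] ?_ _
  · obtain ⟨k, hk⟩ := hw₁
    exact ⟨k, by rw [h₁]; exact mul_ne_zero hp hk.ne_zero⟩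
  · generalize (s : R) = s' at hs
    rintro ⟨i, k⟩
    fin_cases i
    · refine (e₀ k).trans ?_
      fin_cases k
      · simp [chartOneHom, chartMatrixOne, hω₀]
      · simp [chartOneHom, chartMatrixOne]
      · simp [chartOneHom, chartMatrixOne]
    · refine (e₁ k).trans ?_
      fin_cases k
      · simp [chartOneHom, chartMatrixOne]
        linear_combination -p * hω₁ - p * ω₁ * i₀
      · simp [chartOneHom, chartMatrixOne]
        linear_combination (-p * W₁ 1) * i₁ - (p * ω₁ * ↑ω₁⁻¹ * W₁ 1) * i₀
      · simp [chartOneHom, chartMatrixOne]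
        linear_combination (-p * W₁ 2) * i₁ - (p * ω₁ * ↑ω₁⁻¹ * W₁ 2) * i₀
    · refine (e₂ k).trans ?_
      fin_cases k
      · simp [chartOneHom, chartMatrixOne]
        linear_combination -W₂ 0 * hs
      · simp [chartOneHom, chartMatrixOne]
        linear_combination -W₂ 1 * hs
      · simp [chartOneHom, chartMatrixOne]
        linear_combination -W₂ 2 * hs

end BlowupStage

end

/-! ### The Euclidean algorithm on exponent vectors -/

section

variable {K : Type u} [Field K]

namespace BlowupStage

variable {c : BlowupStage K} {m n a : ℕ} {E D : ℕ × ℕ} {e d : Fin 8}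

/-- The excluded loci are invariant under the lifts and disjoint from the chart, which gives one
direction. For the other, matrices with zero first row lie off `B`, so a point over one of them is
on the proper transform. -/
lemma IsGood.canBeMovedInto_iff (h : c.IsGood)
    {ι : Spec (CommRingCat.of (ChartRing K)) ⟶ c.V} {φ₀ : MatrixCoordRing K →ₐ[K] ChartRing K}
    (hι : c.IsCoordChart ι φ₀) (hrest : ∀ y, ι y ∉ c.rest)
    (htr : ∀ y, ι y ∉ c.transform (rowZero K 1)) (x : c.V)
    (hx : x ∈ c.rest ∨ c.π x ∈ rowZero K 0 ∨ x ∈ c.transform (rowZero K 1) ∨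
      c.CanBeMovedInto x (Set.range ι)) :
    c.CanBeMovedInto x (Set.range ι) ↔
      x ∉ c.rest ∧ x ∉ c.transform (rowZero K 0) ∧ x ∉ c.transform (rowZero K 1) := by
  constructor
  · rintro ⟨g, τ, hτ, y, hy⟩
    have hτ' := h.isGoodLift hτ
    refine ⟨fun hx => hrest y ?_, fun hx => hι.notMem_rowZero y ?_, fun hx => htr y ?_⟩
    · rwa [hy, hτ'.rest]
    · rw [hy]
      have hle : (c.transform (rowZero K 0) : Set c.V) ⊆ c.π ⁻¹' (rowZero K 0) :=
        closure_minimal (fun z hz => hz.1) ((rowZero K 0).2.preimage c.π.continuous)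
      exact hle ((hτ'.mem_transform 0 x).2 hx)
    · rwa [hy, hτ'.mem_transform]
  · rintro ⟨h₁, h₂, h₃⟩
    rcases hx with hx | hx | hx | hx
    · exact (h₁ hx).elim
    · exact (h₂ (subset_closure ⟨hx, fun h' => notMem_rowZero_zero_of_mem_cuspLocus h' hx⟩)).elim
    · exact (h₃ hx).elim
    · exact hx

lemma IsPost.status (h : IsPost m n c E D e d) (x : c.V) :
    x ∈ c.rest ∨ c.π x ∈ rowZero K 0 ∨ x ∈ c.transform (rowZero K 1) ∨
      c.HasGerm x (MonomialRows E D) := by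
  by_cases hx : x ∈ c.center
  · obtain ⟨σ, j, φ, e, d, y, h, rfl⟩ := h.chart x hx
    refine Or.inr (Or.inr (Or.inr (hasGerm_of_chart h.isPt y _ fun R _ ψ hψ _ => ?_)))
    obtain ⟨w₁, w₂, h₁, h₂, ⟨k₁, hk₁⟩, k₂, hk₂⟩ := h.rows.map ψ
    simp only [map_mul, map_pow] at h₁ h₂
    exact ⟨ψ (X e), ψ (X d), w₁, w₂, (map_ne_zero_iff ψ hψ).2 (X_ne_zero e),
      (map_ne_zero_iff ψ hψ).2 (X_ne_zero d), h₁, h₂, ⟨k₁, hk₁ ▸ isUnit_one⟩,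
      k₂, hk₂ ▸ isUnit_one⟩
  · rcases (h.off x hx).status with h' | h' | h' | h' | h'
    · exact Or.inl h'
    · exact Or.inr (Or.inl h')
    · exact Or.inr (Or.inr (Or.inl h'))
    · exact Or.inr (Or.inr (Or.inr (h'.imp fun _ _ _ hr => hr.monomialRows)))
    · exact Or.inr (Or.inr (Or.inr (h'.imp fun _ _ _ hr => hr.monomialRows.symm)))

lemma IsPostChart.notMem_transform {σ : Type}
    {j : Spec (CommRingCat.of (MvPolynomial σ K)) ⟶ c.V}
    {φ : MatrixCoordRing K →ₐ[K] MvPolynomial σ K} {e d : σ} (h : c.IsPostChart j φ E D e d)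
    (hE : 0 < E.2) (hD : 0 < D.2) (y : Spec (CommRingCat.of (MvPolynomial σ K))) :
    j y ∉ c.transform (rowZero K 1) :=
  h.toIsCoordChart.notMem_transform_rowZero_one_of_rows h.rows hE hD y

lemma IsPost.notMem_baseSet (h : IsPost m n c E D e d) {x : c.V}
    (hx : x ∈ c.rest ∨ x ∈ c.transform (rowZero K 1)) :
    c.π x ∈ rowZero K 0 ∨ x ∉ c.baseSet m n := by
  by_cases hc : x ∈ c.center
  · obtain ⟨σ, j, φ, e, d, y, h', rfl⟩ := h.chart x hc
    rcases hx with hx | hx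
    · exact (h'.rest y hx).elim
    · exact (h'.notMem_transform h.pos.1 h.pos.2 y hx).elim
  · refine (h.off x hc).base ?_
    rcases hx with hx | hx
    exacts [Or.inl hx, Or.inr (Or.inl hx)]

lemma IsDirectedStage.status (h : IsDirectedStage m n c a) (x : c.V) :
    x ∈ c.rest ∨ c.π x ∈ rowZero K 0 ∨ x ∈ c.transform (rowZero K 1) ∨
      c.HasGerm x (DirectedRows a (x ∈ c.exc) (x ∈ c.dir)) := by
  by_cases hx : x ∈ c.center
  · obtain ⟨σ, j, φ, u, T, y, h, rfl⟩ := h.chart x hx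
    exact Or.inr (Or.inr (Or.inr (h.hasGerm y)))
  · exact (h.off x hx).status

lemma IsDirectedStage.notMem_baseSet (h : IsDirectedStage m n c a) {x : c.V}
    (hx : x ∈ c.rest ∨ x ∈ c.transform (rowZero K 1)) :
    c.π x ∈ rowZero K 0 ∨ x ∉ c.baseSet m n := by
  by_cases hc : x ∈ c.center
  · obtain ⟨σ, j, φ, u, T, y, h', rfl⟩ := h.chart x hc
    rcases hx with hx | hx
    · exact (h'.rest y hx).elim
    · exact (h'.notMem_transform h.pos y hx).elim
  · refine (h.off x hc).base ?_
    rcases hx with hx | hx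
    exacts [Or.inl hx, Or.inr (Or.inl hx)]

lemma isDirectedStage_of_isDirectedBlowup [Infinite K] (hm : 1 ≤ m) (hmn : m < n) {ℓ : ℕ}
    (hℓ : m * ℓ ≤ n) (h : IsDirectedBlowup ℓ (initial K) c) : IsDirectedStage m n c ℓ := by
  generalize h₀ : initial K = c₀ at h
  induction h with
  | one c V' β hβ =>
    subst h₀
    exact isDirectedStage_initial_blowup hm hmn hβ
  | succ ℓ c c' h V' β hβ ih =>
    exact (ih (le_trans (Nat.mul_le_mul_left m ℓ.le_succ) hℓ) h₀).blowup hm hmn hℓ hβ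

lemma orderDefect_nsmul (m n ℓ : ℕ) (v : ℕ × ℕ) :
    orderDefect m n (ℓ • v) = ℓ * orderDefect m n v := by
  simp only [orderDefect, Prod.smul_fst, Prod.smul_snd, smul_eq_mul, Nat.cast_mul]
  ring

/-- After `ℓ` blow-ups the defect is `s * (x - ℓ * y)`. While `ℓ * y ≤ x` it does not change sign,
and it is nonzero before the last blow-up, as each single step requires. -/
lemma isPost_of_isDirectedBlowup [Infinite K] (hm : 1 ≤ m) (hmn : m < n)
    (hed : ({e, d} : Set (Fin 8)) ⊆ {2, 5}) {s : ℤ} (hs : s ≠ 0) {x y : ℕ} (hy : 0 < y)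
    (hE : orderDefect m n E = s * x) (hD : orderDefect m n D = -s * y) {ℓ : ℕ} (hℓ : ℓ * y ≤ x)
    {c' : BlowupStage K} (h : IsDirectedBlowup ℓ c c')
    (hc : ∀ (V' : Scheme.{u}) (β : V' ⟶ c.V), IsBlowup β c.center →
      IsPost m n (c.blowup β) (E + D) D e d) :
    IsPost m n c' (E + ℓ • D) D e d := by
  induction h with
  | one c V' β hβ =>
    rw [one_smul]
    exact hc V' β hβ
  | succ ℓ c c' h V' β hβ ih =>
    have h₁ := ih (le_trans (Nat.mul_le_mul_right y ℓ.le_succ) hℓ) hc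
    have h₂ : orderDefect m n (E + ℓ • D) = s * (x - ℓ * y) := by
      rw [orderDefect_add, orderDefect_nsmul, hE, hD]
      ring
    have h₃ : orderDefect m n (E + ℓ • D + D) = s * (x - (ℓ + 1) * y) := by
      rw [orderDefect_add, h₂, hD]
      ring
    have h₄ : ((ℓ : ℤ) + 1) * y ≤ x := by exact_mod_cast hℓ
    have h₅ : (0 : ℤ) < y := by exact_mod_cast hy
    have h₆ : (0 : ℤ) < x - ℓ * y := by linarith
    rw [succ_nsmul, ← add_assoc]
    refine h₁.blowup hm hmn ?_ ?_ ?_ hed hβ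
    · rw [h₂]
      exact mul_ne_zero hs h₆.ne'
    · rw [hD]
      exact mul_ne_zero (neg_ne_zero.2 hs) h₅.ne'
    · rw [h₃, h₂, mul_mul_mul_comm]
      exact mul_nonneg (mul_self_nonneg s) (mul_nonneg h₆.le (by linarith))

/-- The oriented area spanned by two exponent vectors. -/
def exponentDet (v w : ℕ × ℕ) : ℤ := v.1 * w.2 - v.2 * w.1

lemma exponentDet_add_nsmul (v w : ℕ × ℕ) (ℓ : ℕ) :
    exponentDet (v + ℓ • w) w = exponentDet v w := by
  simp only [exponentDet, Prod.fst_add, Prod.snd_add, Prod.smul_fst, Prod.smul_snd, smul_eq_mul,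
    Nat.cast_add, Nat.cast_mul]
  ring

lemma exponentDet_swap (v w : ℕ × ℕ) : exponentDet w v = -exponentDet v w := by
  simp only [exponentDet]
  ring

/-- A directed blow-up replaces the defects `s * x` and `-s * y` by `s * (x % y)` and `-s * y`. A
turn swaps the two vectors, the sign and the two coordinates, and negates the determinant. The
hypothesis `hc` concerns the stage after one more blow-up because the stage at which the second
directed blow-up starts still has a center of codimension four and no two-coordinate charts. -/
lemma exists_isPost_of_isDirectedSequence [Infinite K] (hm : 1 ≤ m) (hmn : m < n) {L : List ℕ}
    {c' : BlowupStage K} (h : IsDirectedSequence L c c')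
    (hed : ({e, d} : Set (Fin 8)) ⊆ {2, 5}) {s : ℤ} (hs : s ≠ 0) {x y : ℕ} (hy : 0 < y)
    (hL : L = euclidQuotients x y)
    (hE : orderDefect m n E = s * x) (hD : orderDefect m n D = -s * y)
    (hc : ∀ (V' : Scheme.{u}) (β : V' ⟶ c.V), IsBlowup β c.center →
      IsPost m n (c.blowup β) (E + D) D e d) :
    ∃ E' D' e' d', IsPost m n c' E' D' e' d' ∧ orderDefect m n E' = 0 ∧
      ((Odd L.length ∧ e' = e ∧ d' = d ∧ exponentDet E' D' = exponentDet E D) ∨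
      (Even L.length ∧ e' = d ∧ d' = e ∧ exponentDet E' D' = -exponentDet E D)) := by
  have hdef : ∀ x y : ℕ, 0 < y → orderDefect m n E = s * x → orderDefect m n D = -s * y →
      orderDefect m n (E + (x / y) • D) = s * (x % y : ℕ) := fun x y hy hE hD => by
    rw [orderDefect_add, orderDefect_nsmul, hE, hD, Nat.mod_eq_sub_div_mul,
      Nat.cast_sub (Nat.div_mul_le_self x y), Nat.cast_mul]
    ring
  induction h generalizing x y E D e d s with
  | single ℓ c c' h =>
    rw [euclidQuotients, dif_neg hy.ne', List.cons.injEq] at hL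
    obtain ⟨rfl, hL⟩ := hL
    have hmod : x % y = 0 := by
      by_contra hne
      rw [euclidQuotients, dif_neg hne] at hL
      cases hL
    refine ⟨_, _, _, _, isPost_of_isDirectedBlowup hm hmn hed hs hy hE hD
      (Nat.div_mul_le_self x y) h hc, ?_, Or.inl ⟨odd_one, rfl, rfl, exponentDet_add_nsmul _ _ _⟩⟩
    rw [hdef x y hy hE hD, hmod, Nat.cast_zero, mul_zero]
  | cons ℓ L c c' c'' h h' ih =>
    rw [euclidQuotients, dif_neg hy.ne', List.cons.injEq] at hL
    obtain ⟨rfl, hL⟩ := hL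
    have hmod : x % y ≠ 0 := by
      intro h0
      rw [h0, euclidQuotients, dif_pos rfl] at hL
      subst hL
      cases h'
    have h₁ := isPost_of_isDirectedBlowup hm hmn hed hs hy hE hD (Nat.div_mul_le_self x y) h hc
    have h₂ := hdef x y hy hE hD
    have hed' : ({d, e} : Set (Fin 8)) ⊆ {2, 5} := by rwa [Set.pair_comm]
    have hlt : ((x % y : ℕ) : ℤ) ≤ y := by exact_mod_cast (Nat.mod_lt x hy).le
    have hy' : (0 : ℤ) < y := by exact_mod_cast hy
    obtain ⟨E', D', e', d', h₃, h₄, h₅⟩ := ih hed' (neg_ne_zero.2 hs) (Nat.pos_of_ne_zero hmod) hL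
      (E := D) (D := E + (x / y) • D) (by rw [hD]) (by rw [h₂, neg_neg]) (fun V' β hβ => by
        refine h₁.blowup_turn hm hmn ?_ ?_ ?_ hed' hβ
        · rw [h₂]
          exact mul_ne_zero hs (Nat.cast_ne_zero.2 hmod)
        · rw [hD]
          exact mul_ne_zero (neg_ne_zero.2 hs) hy'.ne'
        · rw [orderDefect_add, h₂, hD]
          have : -s * (y : ℤ) * (-s * y + s * (x % y : ℕ)) = s * s * (y * (y - (x % y : ℕ))) := by
            ring
          rw [this]
          exact mul_nonneg (mul_self_nonneg s) (mul_nonneg hy'.le (by linarith)))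
      (fun x y hy hE hD => by
        rw [orderDefect_add, orderDefect_nsmul, hE, hD, Nat.mod_eq_sub_div_mul,
          Nat.cast_sub (Nat.div_mul_le_self x y), Nat.cast_mul]
        ring)
    have hdet : exponentDet D (E + (x / y) • D) = -exponentDet E D := by
      rw [exponentDet_swap, exponentDet_add_nsmul]
    rw [hdet, neg_neg] at h₅
    refine ⟨E', D', e', d', h₃, h₄, ?_⟩
    rw [List.length_cons]
    rcases h₅ with ⟨h₅, h₆⟩ | ⟨h₅, h₆⟩
    · exact Or.inr ⟨h₅.add_one, h₆⟩
    · exact Or.inl ⟨h₅.add_one, h₆⟩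

end BlowupStage

/-- Zero defect and coprimality make `E` a multiple `k` of `(m, n)`, and `k` divides the determinant
`±1`. -/
lemma eq_of_orderDefect_eq_zero {m n : ℕ} (hm : 1 ≤ m) (hcop : m.Coprime n) {E D : ℕ × ℕ}
    (h : orderDefect m n E = 0)
    (hdet : BlowupStage.exponentDet E D = 1 ∨ BlowupStage.exponentDet E D = -1) : E = (m, n) := by
  have h₁ : n * E.1 = m * E.2 := by
    simp only [orderDefect] at h
    zify
    linarith
  obtain ⟨k, hk⟩ : m ∣ E.1 := hcop.dvd_of_dvd_mul_left ⟨_, h₁⟩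
  have h₂ : E.2 = n * k := by
    rw [hk] at h₁
    refine Nat.eq_of_mul_eq_mul_left (Nat.lt_of_lt_of_le one_pos hm) ?_
    rw [← h₁]
    ring
  have h₃ : (k : ℤ) ∣ 1 := by
    have h₄ : (k : ℤ) ∣ BlowupStage.exponentDet E D := by
      simp only [BlowupStage.exponentDet, hk, h₂, Nat.cast_mul]
      exact dvd_sub ⟨m * D.2, by ring⟩ ⟨n * D.1, by ring⟩
    rcases hdet with h' | h'
    · rwa [h'] at h₄
    · rwa [h', dvd_neg] at h₄
  have hk1 : k = 1 := by
    have := Int.eq_one_of_dvd_one (Int.natCast_nonneg k) h₃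
    exact_mod_cast this
  subst hk1
  exact Prod.ext (by rw [hk, mul_one]) (by rw [h₂, mul_one])

end

end

/-! ### Assembly of the proposition -/

theorem proposition2p6 {K : Type u} [Field K] [IsAlgClosed K] [CharZero K]
    (m n : ℕ) (hm : 1 ≤ m) (hmn : m < n) (hcop : m.Coprime n)
    (c : BlowupStage K)
    (hc : BlowupStage.IsDirectedSequence (euclidQuotients n m) (BlowupStage.initial K) c) :
    (∀ g : GL (Fin 3) K, ∃! τ : c.V ⟶ c.V, c.IsLift g τ) ∧
    ∃ ι : Spec (CommRingCat.of (ChartRing K)) ⟶ c.V, IsOpenImmersion ι ∧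
      ((euclidQuotients n m).length = 1 →
        ι ≫ c.π = matrixPoint K (chartMatrixOne K n) rfl) ∧
      (1 < (euclidQuotients n m).length → Odd (euclidQuotients n m).length →
        ∃ A B : ℕ, B * m = A * n + 1 ∧
          ι ≫ c.π = matrixPoint K
            (chartMatrix K (coord K 2 ^ m * coord K 5 ^ A) (coord K 2 ^ n * coord K 5 ^ B)) rfl) ∧
      (Even (euclidQuotients n m).length →
        ∃ A B : ℕ, A * n = B * m + 1 ∧
          ι ≫ c.π = matrixPoint K
            (chartMatrix K (coord K 2 ^ A * coord K 5 ^ m) (coord K 2 ^ B * coord K 5 ^ n)) rfl) ∧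
      (∀ x : c.V, c.CanBeMovedInto x (Set.range ι) ↔
        x ∉ c.rest ∧ x ∉ c.transform (rowZero K 0) ∧ x ∉ c.transform (rowZero K 1)) ∧
      (∀ x ∈ c.baseSet m n, c.π x ∉ rowZero K 0 → c.CanBeMovedInto x (Set.range ι)) := by
  have hinf : Infinite K := Infinite.of_injective _ (Nat.cast_injective (R := K))
  suffices h : c.IsGood ∧ ∃ (ι : Spec (CommRingCat.of (ChartRing K)) ⟶ c.V)
      (φ₀ : MatrixCoordRing K →ₐ[K] ChartRing K), c.IsCoordChart ι φ₀ ∧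
      ((euclidQuotients n m).length = 1 → φ₀ = chartOneHom n) ∧
      (1 < (euclidQuotients n m).length → Odd (euclidQuotients n m).length →
        ∃ A B : ℕ, B * m = A * n + 1 ∧
          φ₀ = chartHom (coord K 2 ^ m * coord K 5 ^ A) (coord K 2 ^ n * coord K 5 ^ B)) ∧
      (Even (euclidQuotients n m).length →
        ∃ A B : ℕ, A * n = B * m + 1 ∧
          φ₀ = chartHom (coord K 2 ^ A * coord K 5 ^ m) (coord K 2 ^ B * coord K 5 ^ n)) ∧
      (∀ y, ι y ∉ c.rest) ∧ (∀ y, ι y ∉ c.transform (rowZero K 1)) ∧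
      (∀ x, x ∈ c.rest ∨ c.π x ∈ rowZero K 0 ∨ x ∈ c.transform (rowZero K 1) ∨
        c.CanBeMovedInto x (Set.range ι)) ∧
      ∀ x, x ∈ c.rest ∨ x ∈ c.transform (rowZero K 1) →
        c.π x ∈ rowZero K 0 ∨ x ∉ c.baseSet m n by
    obtain ⟨hg, ι, φ₀, hι, h₁, h₂, h₃, h₄, h₅, h₆, h₇⟩ := h
    refine ⟨hg.existsUnique_lift, ι, hι.isOpenImmersion, fun hl => ?_, fun hl hl' => ?_,
      fun hl => ?_, fun x => hg.canBeMovedInto_iff hι h₄ h₅ x (h₆ x), fun x hx hx0 => ?_⟩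
    · have hpt := hι.isPt
      rw [h₁ hl] at hpt
      exact hpt.unique (isPt_matrixPoint _ _)
    · obtain ⟨A, B, hAB, rfl⟩ := h₂ hl hl'
      exact ⟨A, B, hAB, hι.isPt.unique (isPt_matrixPoint _ _)⟩
    · obtain ⟨A, B, hAB, rfl⟩ := h₃ hl
      exact ⟨A, B, hAB, hι.isPt.unique (isPt_matrixPoint _ _)⟩
    · rcases h₆ x with h | h | h | h
      · exact ((h₇ x (Or.inl h)).elim hx0 fun h' => h' hx).elim
      · exact (hx0 h).elim
      · exact ((h₇ x (Or.inr h)).elim hx0 fun h' => h' hx).elim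
      · exact h
  have hm0 : m ≠ 0 := by lia
  generalize hL : euclidQuotients n m = L at hc
  rw [euclidQuotients, dif_neg hm0] at hL
  cases hc with
  | single ℓ _ _ h =>
    rw [List.cons.injEq] at hL
    obtain ⟨rfl, hL⟩ := hL
    have hmod : n % m = 0 := by
      by_contra hne
      rw [euclidQuotients, dif_neg hne] at hL
      cases hL
    have hm1 : m = 1 := Nat.Coprime.eq_one_of_dvd hcop (Nat.dvd_of_mod_eq_zero hmod)
    have hst := BlowupStage.isDirectedStage_of_isDirectedBlowup hm hmn (Nat.mul_div_le n m) h
    have hdiv : n / m = n := by rw [hm1, Nat.div_one]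
    rw [hdiv] at hst
    obtain ⟨j, hj⟩ := hst.tracked
    refine ⟨hst.good, j, _, hj.toIsCoordChart, fun _ => rfl, fun h' => (lt_irrefl _ h').elim,
      fun h' => (Nat.not_even_one h').elim, hj.rest, hj.notMem_transform hst.pos, fun x => ?_,
      fun x => hst.notMem_baseSet⟩
    rcases hst.status x with h' | h' | h' | h'
    · exact Or.inl h'
    · exact Or.inr (Or.inl h')
    · exact Or.inr (Or.inr (Or.inl h'))
    · exact Or.inr (Or.inr (Or.inr (hst.good.canBeMovedInto_of_directedRows hj.isPt h')))
  | cons ℓ L _ c' _ h h' =>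
    rw [List.cons.injEq] at hL
    obtain ⟨rfl, hL⟩ := hL
    have hmod : n % m ≠ 0 := by
      intro h0
      rw [h0, euclidQuotients, dif_pos rfl] at hL
      subst hL
      cases h'
    have hLne : L ≠ [] := by
      rintro rfl
      cases h'
    have hst := BlowupStage.isDirectedStage_of_isDirectedBlowup hm hmn (Nat.mul_div_le n m) h
    have hdm := Nat.div_add_mod n m
    have hlt := Nat.mod_lt n (Nat.pos_of_ne_zero hm0)
    -- The vector `(0, 1)` stands for `P`. Its defect is `-m`, that of `(1, n / m)` is `n % m`, so
    -- the remaining algorithm runs on `m` and `n % m` with sign `s = -1`. The initial determinant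
    -- is `-1`.
    obtain ⟨E, D, e, d, hp, hE, hcase⟩ := BlowupStage.exists_isPost_of_isDirectedSequence hm hmn h'
      (e := 5) (d := 2) (by rw [Set.pair_comm]) (neg_ne_zero.2 one_ne_zero)
      (Nat.pos_of_ne_zero hmod) hL.symm (E := (0, 1)) (D := (1, n / m))
      (by simp [orderDefect]) (by simp only [orderDefect]; zify at hdm; push_cast; linarith)
      (fun V' β hβ => by
        have := hst.blowup_turn hm hmn (by lia) (by rw [mul_add]; lia) hβ
        rwa [add_comm] at this)
    have h01 : BlowupStage.exponentDet (0, 1) (1, n / m) = -1 := by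
      simp [BlowupStage.exponentDet]
    rw [h01] at hcase
    have hEeq : E = (m, n) := by
      refine eq_of_orderDefect_eq_zero hm hcop (D := D) hE ?_
      rcases hcase with ⟨-, -, -, h'⟩ | ⟨-, -, -, h'⟩
      · exact Or.inr h'
      · exact Or.inl (by rw [h', neg_neg])
    subst hEeq
    obtain ⟨A, B⟩ := D
    have hlen : 0 < L.length := List.length_pos_iff.2 hLne
    obtain ⟨j, hj⟩ := hp.tracked
    -- The list `L` omits the first quotient, so its parity is opposite to that of `e`. The parity
    -- decides whether the last divisor is `s₆ = 0` or `s₃ = 0`, and the sign of the Bézout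
    -- relation.
    rcases hcase with ⟨hodd, rfl, rfl, hdet⟩ | ⟨heven, rfl, rfl, hdet⟩
    · have hAB : A * n = B * m + 1 := by
        simp only [BlowupStage.exponentDet] at hdet
        zify
        linarith
      have hφ : chartHom (X 5 ^ m * X 2 ^ A) (X 5 ^ n * X 2 ^ B) =
          chartHom (coord K 2 ^ A * coord K 5 ^ m) (coord K 2 ^ B * coord K 5 ^ n) := by
        rw [mul_comm, mul_comm (X 5 ^ n)]
      refine ⟨hp.good, j, _, hj.toIsCoordChart, fun h' => ?_, fun _ h' => ?_,
        fun _ => ⟨A, B, hAB, hφ⟩, hj.rest, hj.notMem_transform hp.pos.1 hp.pos.2, fun x => ?_,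
        fun x => hp.notMem_baseSet⟩
      · rw [List.length_cons] at h'
        lia
      · rw [List.length_cons] at h'
        exact (Nat.not_even_iff_odd.2 h' hodd.add_one).elim
      · refine (hp.status x).imp_right (Or.imp_right (Or.imp_right fun hx => ?_))
        have hpt := hj.isPt
        simp only at hpt
        rw [hφ] at hpt
        refine hp.good.canBeMovedInto_of_monomialRows (a := (A, B)) (b := (m, n)) (Or.inl ?_) hpt
          (hx.imp fun _ _ _ h' => h'.symm)
        zify at hAB
        linarith
    · have hAB : B * m = A * n + 1 := by
        simp only [BlowupStage.exponentDet] at hdet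
        zify
        linarith
      refine ⟨hp.good, j, _, hj.toIsCoordChart, fun h' => ?_, fun _ _ => ⟨A, B, hAB, rfl⟩,
        fun h' => ?_, hj.rest, hj.notMem_transform hp.pos.1 hp.pos.2, fun x => ?_,
        fun x => hp.notMem_baseSet⟩
      · rw [List.length_cons] at h'
        lia
      · rw [List.length_cons] at h'
        exact (Nat.not_even_iff_odd.2 heven.add_one h').elim
      · refine (hp.status x).imp_right (Or.imp_right (Or.imp_right fun hx => ?_))
        refine hp.good.canBeMovedInto_of_monomialRows (a := (m, n)) (b := (A, B)) (Or.inl ?_)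
          hj.isPt hx
        zify at hAB
        linarith
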